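/- Let $k$ be a commutative ring, $A$ a dg algebra over $k$, $n\ge 0$, and $R_n=k[t]/(t^{n+1})$. Let $A_n$ be a cdg deformation of $A$ of order $n$, i.e. a structure of curved dg (cdg) algebra over $R_n$, with predifferential $d$ and curvature $c$, on the graded $R_n$-module $A\otimes_k R_n$, which reduces modulo $t$ to the dg algebra $A$ (in particular $c\in tA_n$). Put $A_{n-1}=A_n/t^nA_n$ (so $A_{-1}=0$), with projection $\pi\colon A_n\to A_{n-1}$. A cdg module $M$ over a cdg algebra $B$ is a graded left module with a derivation $d$ of degree $1$ such that $d^2=c\cdot$; $\operatorname{Hot}(B)$ is the category of cdg modules and closed degree $0$ morphisms up to homotopy, triangulated by cones. An $A_n$-module $M$ is called $n$-acyclic if the complexes $\operatorname{Gr}^i_t(M)=t^iM/t^{i+1}M$ are acyclic for $0\le i\le n$, and $D^n(A_n)$ is the Verdier quotient of $\operatorname{Hot}(A_n)$ by the $n$-acyclic modules. Likewise $D^{n-1}(A_{n-1})$ is the quotient of $\operatorname{Hot}(A_{n-1})$ by the modules with $\operatorname{Gr}^i_t$ acyclic for $0\le i\le n-1$ (it is $0$ if $n=0$), and $D(A)$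 is the usual derived category. Let $\iota_n\colon D^{n-1}(A_{n-1})\to D^n(A_n)$ be induced by restriction of scalars, with essential image $\iota_nD^{n-1}(A_{n-1})$, and let $\operatorname{Im}t^n\colon D^n(A_n)\to D(A)$ be induced by $M\mapsto t^nM$. Let $\mathcal T_n\subseteq D^n(A_n)$ be the full subcategory of the modules $M$ such that $M/t^nM$ is $(n-1)$-acyclic over $A_{n-1}$. Choose an element $\tfrac ct\in A_n$ of degree $2$ with $t\cdot\tfrac ct=c$ (one exists), let $\Gamma_n$ be the cdg $A_n$-module with underlying graded module $A_n\oplus A_{n-1}[1]$ and differential $(\alpha,a)\mapsto(d\alpha+ta,\,-da+\pi(\alpha\tfrac ct))$, and let $G_n$ be the cocone of the projection $\Gamma_n\to\Gamma_n/t^n\Gamma_n$. A localizing subcategory is a strictly full triangulated subcategory closed under small coproducts. Then: 1. $\mathcal T_n$ is a localizing subcategory of $D^n(A_n)$, and it is the smallest one containing $G_n$ (for every choice of $\tfrac ct$). 2. The restriction of $\operatorname{Im}t^n$ to $\mathcal T_n$ is an equivalence $\mathcal T_n\simeq D(A)$. 3. $\iota_nD^{n-1}(A_{n-1})$ is a triangulated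 subcategory of $D^n(A_n)$, and $\operatorname{Im}t^n$ exhibits $D(A)$ as the Verdier quotient $D^n(A_n)/\iota_nD^{n-1}(A_{n-1})$. 4. The functors $\iota_n$ and $\operatorname{Im}t^n$ are part of a recollement of $D^n(A_n)$ by $D^{n-1}(A_{n-1})$ and $D(A)$: they are triangulated, $\operatorname{Im}t^n\circ\iota_n=0$, $\iota_n$ is fully faithful with a left adjoint $\iota_n^*$ and a right adjoint $\iota_n^!$, $\operatorname{Im}t^n$ has a left adjoint $j_!$ and a right adjoint $j_*$, both fully faithful, and every object $X$ lies in distinguished triangles $j_!\operatorname{Im}t^nX\to X\to\iota_n\iota_n^*X\to$ and $\iota_n\iota_n^!X\to X\to j_*\operatorname{Im}t^nX\to$ formed by the units and counits. Moreover $\iota_n^*$ is induced by $M\mapsto\operatorname{Coker}(t^n\colon M\to M)$ and $\iota_n^!$ by $M\mapsto\operatorname{Ker}(t^n\colon M\to M)$. -/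

import Mathlib

open CategoryTheory CategoryTheory.Limits CategoryTheory.Pretriangulated

universe u

noncomputable section

namespace CDG

/-- The sign `(-1)^i` as an integer. -/
def sgn (i : ℤ) : ℤ := ((Int.negOnePow i : ℤˣ) : ℤ)

@[simp] lemma sgn_zero : sgn 0 = 1 := by simp [sgn]
@[simp] lemma sgn_one : sgn 1 = -1 := by simp [sgn]
@[simp] lemma sgn_two : sgn 2 = 1 := by simp [sgn, Int.negOnePow_even 2 (by decide)]
lemma sgn_add (i j : ℤ) : sgn (i + j) = sgn i * sgn j := by simp [sgn, Int.negOnePow_add]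
@[simp] lemma sgn_sq (i : ℤ) : sgn i * sgn i = 1 := by simp [sgn]
@[simp] lemma sgn_succ (i : ℤ) : sgn (i + 1) = -sgn i := by simp [sgn_add]

/-! ### Curved differential graded algebras -/

/-- A curved dg algebra over a commutative ring `R`: a `ℤ`-graded unital associative `R`-algebra
with a degree one `R`-linear derivation `d` and a degree two element `curv` with `d curv = 0` and
`d (d a) = curv * a - a * curv`. The product of elements of degrees `i` and `j` is recorded as a
map into degree `k` for every `k` with `i + j = k`. -/
structure CDGAlgebra (R : Type u) [CommRing R] where
  X : ℤ → Type u
  [grp : ∀ i, AddCommGroup (X i)]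
  [mod : ∀ i, Module R (X i)]
  mul : ∀ {i j k : ℤ}, i + j = k → (X i →ₗ[R] X j →ₗ[R] X k)
  one : X 0
  one_mul : ∀ {i : ℤ} (a : X i), mul (zero_add i) one a = a
  mul_one : ∀ {i : ℤ} (a : X i), mul (add_zero i) a one = a
  mul_assoc : ∀ {i j l ij jl ijl : ℤ} (h₁ : i + j = ij) (h₂ : ij + l = ijl) (h₃ : j + l = jl)
    (h₄ : i + jl = ijl) (a : X i) (b : X j) (c : X l),
    mul h₂ (mul h₁ a b) c = mul h₄ a (mul h₃ b c)
  d : ∀ i : ℤ, X i →ₗ[R] X (i + 1)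
  leibniz : ∀ {i j k : ℤ} (h : i + j = k) (h₁ : i + 1 + j = k + 1) (h₂ : i + (j + 1) = k + 1)
    (a : X i) (b : X j),
    d k (mul h a b) = mul h₁ (d i a) b + sgn i • mul h₂ a (d j b)
  curv : X 2
  d_curv : d 2 curv = 0
  d_d : ∀ {i : ℤ} (h₁ : 2 + i = i + 1 + 1) (h₂ : i + 2 = i + 1 + 1) (a : X i),
    d (i + 1) (d i a) = mul h₁ curv a - mul h₂ a curv

attribute [instance] CDGAlgebra.grp CDGAlgebra.mod

/-- A dg algebra is a curved dg algebra with zero curvature. -/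
structure DGAlgebra (k : Type u) [CommRing k] extends CDGAlgebra k where
  curv_eq_zero : curv = 0

namespace CDGAlgebra

variable {R : Type u} [CommRing R] (B : CDGAlgebra R)

lemma d_one : B.d 0 B.one = 0 := by
  have h := B.leibniz (zero_add 0) (by norm_num) (by norm_num) B.one B.one
  rw [B.one_mul] at h
  have h1 : B.mul (show (0:ℤ) + 1 + 0 = 0 + 1 by norm_num) (B.d 0 B.one) B.one = B.d 0 B.one :=
    B.mul_one _
  have h2 : B.mul (show (0:ℤ) + (0 + 1) = 0 + 1 by norm_num) B.one (B.d 0 B.one) = B.d 0 B.one :=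
    B.one_mul _
  rw [h1, h2] at h
  simpa using h

/-- The homogeneous two-sided ideal `rB` in degree `i`. -/
def ideal (r : R) (i : ℤ) : Submodule R (B.X i) := LinearMap.range (LinearMap.lsmul R (B.X i) r)

lemma mem_ideal (r : R) (i : ℤ) (x : B.X i) : x ∈ B.ideal r i ↔ ∃ y, r • y = x := Iff.rfl

/-- The multiplication of `B / rB`. -/
def quotMul (r : R) {i j k : ℤ} (h : i + j = k) :
    (B.X i ⧸ B.ideal r i) →ₗ[R] (B.X j ⧸ B.ideal r j) →ₗ[R] (B.X k ⧸ B.ideal r k) :=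
  (B.ideal r i).liftQ
    (((B.ideal r j).liftQ (((B.mul h).compr₂ (B.ideal r k).mkQ).flip) (by
        rintro _ ⟨b, rfl⟩
        rw [LinearMap.mem_ker]
        ext a
        exact (Submodule.Quotient.mk_eq_zero _).2 ⟨B.mul h a b, by simp⟩)).flip)
    (by
      rintro _ ⟨a, rfl⟩
      rw [LinearMap.mem_ker]
      ext b
      exact (Submodule.Quotient.mk_eq_zero _).2 ⟨B.mul h a b, by simp⟩)

lemma quotMul_mk (r : R) {i j k : ℤ} (h : i + j = k) (a : B.X i) (b : B.X j) :
    B.quotMul r h (Submodule.Quotient.mk a) (Submodule.Quotient.mk b) =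
      Submodule.Quotient.mk (B.mul h a b) := rfl

/-- The quotient cdg algebra `B / rB`, for `r` in the base ring. -/
def quot (r : R) : CDGAlgebra R where
  X i := B.X i ⧸ B.ideal r i
  mul h := B.quotMul r h
  one := Submodule.Quotient.mk B.one
  one_mul a := by
    obtain ⟨a, rfl⟩ := Submodule.mkQ_surjective _ a
    exact congrArg Submodule.Quotient.mk (B.one_mul a)
  mul_one a := by
    obtain ⟨a, rfl⟩ := Submodule.mkQ_surjective _ a
    exact congrArg Submodule.Quotient.mk (B.mul_one a)
  mul_assoc h₁ h₂ h₃ h₄ a b c := by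
    obtain ⟨a, rfl⟩ := Submodule.mkQ_surjective _ a
    obtain ⟨b, rfl⟩ := Submodule.mkQ_surjective _ b
    obtain ⟨c, rfl⟩ := Submodule.mkQ_surjective _ c
    exact congrArg Submodule.Quotient.mk (B.mul_assoc h₁ h₂ h₃ h₄ a b c)
  d i := (B.ideal r i).mapQ (B.ideal r (i + 1)) (B.d i) (by
    rintro _ ⟨y, rfl⟩; exact ⟨B.d i y, by simp⟩)
  leibniz h h₁ h₂ a b := by
    obtain ⟨a, rfl⟩ := Submodule.mkQ_surjective _ a
    obtain ⟨b, rfl⟩ := Submodule.mkQ_surjective _ b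
    exact congrArg Submodule.Quotient.mk (B.leibniz h h₁ h₂ a b)
  curv := Submodule.Quotient.mk B.curv
  d_curv := congrArg Submodule.Quotient.mk B.d_curv
  d_d h₁ h₂ a := by
    obtain ⟨a, rfl⟩ := Submodule.mkQ_surjective _ a
    exact congrArg Submodule.Quotient.mk (B.d_d h₁ h₂ a)

end CDGAlgebra

/-- A morphism of cdg algebras (possibly over different base rings): a unital map of graded rings
commuting with the predifferentials and preserving the curvatures. -/
structure AlgHom {R R' : Type u} [CommRing R] [CommRing R'] (B : CDGAlgebra R)
    (B' : CDGAlgebra R') where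
  f : ∀ i, B.X i →+ B'.X i
  map_one : f 0 B.one = B'.one
  map_mul : ∀ {i j k : ℤ} (h : i + j = k) (a : B.X i) (b : B.X j),
    f k (B.mul h a b) = B'.mul h (f i a) (f j b)
  map_d : ∀ {i : ℤ} (a : B.X i), f (i + 1) (B.d i a) = B'.d i (f i a)
  map_curv : f 2 B.curv = B'.curv

/-- The projection `B → B / rB`. -/
def CDGAlgebra.proj {R : Type u} [CommRing R] (B : CDGAlgebra R) (r : R) :
    AlgHom B (B.quot r) where
  f i := (B.ideal r i).mkQ.toAddMonoidHom
  map_one := rfl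
  map_mul _ _ _ := rfl
  map_d _ := rfl
  map_curv := rfl

/-! ### Curved dg modules -/

/-- A left cdg module over the cdg algebra `B`: a graded left module with a degree one
derivation `d` satisfying `d (d m) = curv • m`. The base ring acts through the unit of `B`;
since `B.d` kills the scalars, `d` is automatically linear over the base ring. -/
structure Mod {R : Type u} [CommRing R] (B : CDGAlgebra R) where
  X : ℤ → Type u
  [grp : ∀ i, AddCommGroup (X i)]
  smul : ∀ {i j k : ℤ}, i + j = k → B.X i → X j → X k
  smul_add : ∀ {i j k : ℤ} (h : i + j = k) (b : B.X i) (m m' : X j),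
    smul h b (m + m') = smul h b m + smul h b m'
  add_smul : ∀ {i j k : ℤ} (h : i + j = k) (b b' : B.X i) (m : X j),
    smul h (b + b') m = smul h b m + smul h b' m
  one_smul : ∀ {i : ℤ} (m : X i), smul (zero_add i) B.one m = m
  mul_smul : ∀ {i j l ij jl ijl : ℤ} (h₁ : i + j = ij) (h₂ : ij + l = ijl) (h₃ : j + l = jl)
    (h₄ : i + jl = ijl) (a : B.X i) (b : B.X j) (m : X l),
    smul h₂ (B.mul h₁ a b) m = smul h₄ a (smul h₃ b m)
  d : ∀ i : ℤ, X i →+ X (i + 1)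
  leibniz : ∀ {i j k : ℤ} (h : i + j = k) (h₁ : i + 1 + j = k + 1) (h₂ : i + (j + 1) = k + 1)
    (b : B.X i) (m : X j),
    d k (smul h b m) = smul h₁ (B.d i b) m + sgn i • smul h₂ b (d j m)
  d_d : ∀ {i : ℤ} (h : 2 + i = i + 1 + 1) (m : X i), d (i + 1) (d i m) = smul h B.curv m

attribute [instance] Mod.grp

namespace Mod

variable {R : Type u} [CommRing R] {B : CDGAlgebra R}

section
variable (M : Mod B)

/-- Transport along an equality of degrees. -/
def tr {i j : ℤ} (h : i = j) : M.X i →+ M.X j := h ▸ AddMonoidHom.id (M.X i)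

@[simp] lemma tr_rfl {i : ℤ} (h : i = i) (m : M.X i) : M.tr h m = m := rfl
@[simp] lemma tr_tr {i j l : ℤ} (h : i = j) (h' : j = l) (m : M.X i) :
    M.tr h' (M.tr h m) = M.tr (h.trans h') m := by subst h h'; rfl
@[simp] lemma d_tr {i j : ℤ} (h : i = j) (m : M.X i) :
    M.d j (M.tr h m) = M.tr (by rw [h]) (M.d i m) := by subst h; rfl
@[simp] lemma tr_smul {i j k l : ℤ} (h : i + j = k) (h' : k = l) (b : B.X i) (m : M.X j) :
    M.tr h' (M.smul h b m) = M.smul (h.trans h') b m := by subst h'; rfl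
@[simp] lemma smul_tr {i j j' k : ℤ} (h : i + j' = k) (h' : j = j') (b : B.X i) (m : M.X j) :
    M.smul h b (M.tr h' m) = M.smul (by rw [h', h]) b m := by subst h'; rfl

/-- The action as a biadditive map. -/
def smulHom {i j k : ℤ} (h : i + j = k) : B.X i →+ M.X j →+ M.X k :=
  AddMonoidHom.mk' (fun b => AddMonoidHom.mk' (M.smul h b) (M.smul_add h b))
    (fun b b' => by ext m; exact M.add_smul h b b' m)

@[simp] lemma smul_zero {i j k : ℤ} (h : i + j = k) (b : B.X i) :
    M.smul h b (0 : M.X j) = 0 := (M.smulHom h b).map_zero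
@[simp] lemma zero_smul {i j k : ℤ} (h : i + j = k) (m : M.X j) :
    M.smul h (0 : B.X i) m = 0 := DFunLike.congr_fun (M.smulHom h).map_zero m
@[simp] lemma smul_neg {i j k : ℤ} (h : i + j = k) (b : B.X i) (m : M.X j) :
    M.smul h b (-m) = -M.smul h b m := (M.smulHom h b).map_neg m
@[simp] lemma smul_sub {i j k : ℤ} (h : i + j = k) (b : B.X i) (m m' : M.X j) :
    M.smul h b (m - m') = M.smul h b m - M.smul h b m' := (M.smulHom h b).map_sub m m'
lemma sub_smul {i j k : ℤ} (h : i + j = k) (b b' : B.X i) (m : M.X j) :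
    M.smul h (b - b') m = M.smul h b m - M.smul h b' m :=
  DFunLike.congr_fun ((M.smulHom h).map_sub b b') m
@[simp] lemma smul_zsmul {i j k : ℤ} (h : i + j = k) (z : ℤ) (b : B.X i) (m : M.X j) :
    M.smul h b (z • m) = z • M.smul h b m := (M.smulHom h b).map_zsmul z m

end

/-- Closed morphisms of degree zero between cdg modules. -/
@[ext]
structure Hom (M N : Mod B) where
  f : ∀ i, M.X i →+ N.X i
  map_smul : ∀ {i j k : ℤ} (h : i + j = k) (b : B.X i) (m : M.X j),
    f k (M.smul h b m) = N.smul h b (f j m)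
  comm : ∀ {i : ℤ} (m : M.X i), f (i + 1) (M.d i m) = N.d i (f i m)

/-- The category of cdg modules and closed morphisms of degree zero. -/
instance : Category (Mod B) where
  Hom M N := Hom M N
  id M := ⟨fun i => AddMonoidHom.id _, fun _ _ _ => rfl, fun _ => rfl⟩
  comp {M N P} f g := ⟨fun i => (g.f i).comp (f.f i), fun h b m => by
    simp [f.map_smul, g.map_smul], fun m => by simp [f.comm, g.comm]⟩

variable {M N P : Mod B}

@[ext] lemma hom_ext {f g : M ⟶ N} (h : ∀ i (m : M.X i), f.f i m = g.f i m) : f = g :=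
  Hom.ext (funext fun i => AddMonoidHom.ext (h i))

@[simp] lemma id_f (i : ℤ) (m : M.X i) : Hom.f (𝟙 M) i m = m := rfl
@[simp] lemma comp_f (f : M ⟶ N) (g : N ⟶ P) (i : ℤ) (m : M.X i) :
    (f ≫ g).f i m = g.f i (f.f i m) := rfl
@[simp] lemma f_smul (f : M ⟶ N) {i j k : ℤ} (h : i + j = k) (b : B.X i) (m : M.X j) :
    f.f k (M.smul h b m) = N.smul h b (f.f j m) := f.map_smul h b m
@[simp] lemma f_d (f : M ⟶ N) {i : ℤ} (m : M.X i) :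
    f.f (i + 1) (M.d i m) = N.d i (f.f i m) := f.comm m
@[simp] lemma f_tr (f : M ⟶ N) {i j : ℤ} (h : i = j) (m : M.X i) :
    f.f j (M.tr h m) = N.tr h (f.f i m) := by subst h; rfl

lemma zsmul_comm_smul {i j k : ℤ} (h : i + j = k) (z : ℤ) (b : B.X i) (m : M.X j) :
    M.smul h b (z • m) = z • M.smul h b m := M.smul_zsmul h z b m

instance : Zero (M ⟶ N) := ⟨⟨fun _ => 0, by intros; simp, by intros; simp⟩⟩
instance : Add (M ⟶ N) := ⟨fun f g => ⟨fun i => f.f i + g.f i,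
  by intros; simp [N.smul_add], by intros; simp⟩⟩
instance : Neg (M ⟶ N) := ⟨fun f => ⟨fun i => -f.f i, by intros; simp, by intros; simp⟩⟩
instance : Sub (M ⟶ N) := ⟨fun f g => ⟨fun i => f.f i - g.f i, by intros; simp,
  by intros; simp⟩⟩

@[simp] lemma zero_f (i : ℤ) (m : M.X i) : (0 : M ⟶ N).f i m = 0 := rfl
@[simp] lemma add_f (f g : M ⟶ N) (i : ℤ) (m : M.X i) : (f + g).f i m = f.f i m + g.f i m := rfl
@[simp] lemma neg_f (f : M ⟶ N) (i : ℤ) (m : M.X i) : (-f).f i m = -f.f i m := rfl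
@[simp] lemma sub_f (f g : M ⟶ N) (i : ℤ) (m : M.X i) : (f - g).f i m = f.f i m - g.f i m := rfl

instance : Preadditive (Mod B) where
  homGroup M N :=
    { add_assoc := fun _ _ _ => by ext; simp [add_assoc]
      zero_add := fun _ => by ext; simp
      add_zero := fun _ => by ext; simp
      add_comm := fun _ _ => by ext; simp [add_comm]
      neg_add_cancel := fun _ => by ext; simp
      sub_eq_add_neg := fun _ _ => by ext; simp [sub_eq_add_neg]
      nsmul := nsmulRec
      zsmul := zsmulRec }
  add_comp _ _ _ _ _ _ := by ext; simp
  comp_add _ _ _ _ _ _ := by ext; simp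

end Mod
namespace Mod

variable {R : Type u} [CommRing R] {B : CDGAlgebra R} {M N P : Mod B}

/-! ### Shifts -/

/-- The shift `M[a]`, with `M[a]^i = M^{i+a}`, differential `(-1)^a d` and action
`b • m = (-1)^{a|b|} b m`. -/
def shift (M : Mod B) (a : ℤ) : Mod B where
  X i := M.X (i + a)
  smul {i j k} h b m := sgn (a * i) • M.smul (by omega) b m
  smul_add _ _ _ _ := by simp [M.smul_add]
  add_smul _ _ _ _ := by simp [M.add_smul]
  one_smul m := by
    simp only [mul_zero, sgn_zero, one_zsmul]
    exact M.one_smul m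
  mul_smul {i j l ij jl ijl} h₁ h₂ h₃ h₄ r s m := by
    subst h₁
    rw [M.mul_smul rfl _ (show j + (l + a) = jl + a by omega) (by omega), smul_zsmul, smul_smul,
      mul_add, sgn_add]
  d i := sgn a • (M.tr (by omega)).comp (M.d (i + a))
  leibniz {i j k} h h₁ h₂ b m := by
    simp only [AddMonoidHom.smul_apply, AddMonoidHom.comp_apply, map_zsmul, smul_zsmul, smul_tr]
    rw [M.leibniz (show i + (j + a) = k + a by omega) (by omega) (by omega)]
    simp only [map_add, map_zsmul, tr_smul, mul_add, sgn_add, mul_one]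
    module
  d_d {i} h m := by
    simp only [AddMonoidHom.smul_apply, AddMonoidHom.comp_apply, map_zsmul, d_tr, tr_tr]
    rw [M.d_d (by omega), smul_smul, sgn_sq, mul_comm a 2, two_mul, sgn_add, sgn_sq]
    simp

lemma shift_d (a : ℤ) {i : ℤ} (m : M.X (i + a)) :
    (M.shift a).d i m = sgn a • M.tr (by omega) (M.d (i + a) m) := rfl
lemma shift_smul (a : ℤ) {i j k : ℤ} (h : i + j = k) (b : B.X i) (m : M.X (j + a)) :
    (M.shift a).smul h b m = sgn (a * i) • M.smul (show i + (j + a) = k + a by omega) b m := rfl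
lemma shift_tr (a : ℤ) {i j : ℤ} (h : i = j) (m : M.X (i + a)) :
    (M.shift a).tr h m = M.tr (by rw [h]) m := by subst h; rfl

/-- The shift functors. -/
def shiftF (a : ℤ) : Mod B ⥤ Mod B where
  obj M := M.shift a
  map {M N} f :=
    { f := fun i => f.f (i + a)
      map_smul := fun {i j k} h b (m : M.X (j + a)) => by
        change f.f (k + a) (sgn (a * i) • M.smul _ b m) = sgn (a * i) • N.smul _ b (f.f (j + a) m)
        simp
      comm := fun {i} (m : M.X (i + a)) => by
        change f.f _ (sgn a • M.tr _ (M.d _ m)) = sgn a • N.tr _ (N.d _ (f.f _ m))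
        simp }
  map_id _ := rfl
  map_comp _ _ := rfl

lemma eqToHom_shift_f {a b : ℤ} (h : a = b) (h' : (shiftF a).obj M = (shiftF b).obj M) (i : ℤ)
    (m : M.X (i + a)) : Hom.f (eqToHom h') i m = M.tr (by rw [h]) m := by
  subst h; rfl

/-- Isomorphisms from degreewise additive bijections. -/
def isoMk (f : M ⟶ N) (g : ∀ i, N.X i → M.X i) (h₁ : ∀ i m, g i (f.f i m) = m)
    (h₂ : ∀ i n, f.f i (g i n) = n) : M ≅ N where
  hom := f
  inv :=
    { f := fun i => AddMonoidHom.mk' (g i) (fun a b => by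
        rw [← h₁ i (g i a + g i b), map_add, h₂, h₂])
      map_smul := fun {i j k} h b m => by
        change g k _ = M.smul h b (g j m)
        rw [← h₁ k (M.smul h b (g j m)), f_smul, h₂]
      comm := fun {i} m => by
        change g (i + 1) _ = M.d i (g i m)
        rw [← h₁ _ (M.d i (g i m)), f_d, h₂] }
  hom_inv_id := by ext i m; exact h₁ i m
  inv_hom_id := by ext i m; exact h₂ i m

/-- `M[0] ≅ M`. -/
def shiftZero : shiftF (B := B) 0 ≅ 𝟭 _ :=
  NatIso.ofComponents (fun M => isoMk
      ⟨fun i => M.tr (show i + 0 = i by omega), fun {i j k} h b (m : M.X (j + 0)) => by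
          change M.tr _ (sgn (0 * i) • M.smul _ b m) = M.smul _ b (M.tr _ m)
          simp,
        fun {i} (m : M.X (i + 0)) => by
          change M.tr _ (sgn 0 • M.tr _ (M.d _ m)) = M.d _ (M.tr _ m)
          simp⟩
      (fun i => M.tr (by simp)) (fun i m => M.tr_tr _ _ m) (fun i m => M.tr_tr _ _ m))
    (fun f => by ext i m; exact (f_tr f _ m).symm)

/-- `M[a + b] ≅ M[a][b]`. -/
def shiftAdd (a b : ℤ) : shiftF (B := B) (a + b) ≅ shiftF a ⋙ shiftF b :=
  NatIso.ofComponents (fun M => isoMk (M := M.shift (a + b)) (N := (M.shift a).shift b)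
      ⟨fun i => M.tr (show i + (a + b) = i + b + a by omega),
        fun {i j k} h r (m : M.X (j + (a + b))) => by
          change M.tr _ (sgn ((a + b) * i) • M.smul _ r m) =
            sgn (b * i) • (sgn (a * i) • M.smul _ r (M.tr _ m))
          simp only [map_zsmul, tr_smul, smul_tr, smul_smul, add_mul, sgn_add]
          rw [mul_comm (sgn (b * i))],
        fun {i} (m : M.X (i + (a + b))) => by
          change M.tr (show i + 1 + (a + b) = i + 1 + b + a by omega)
            (sgn (a + b) • M.tr (show i + (a + b) + 1 = i + 1 + (a + b) by omega) (M.d _ m)) =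
            sgn b • (M.shift a).tr (show i + b + 1 = i + 1 + b by omega)
              (sgn a • M.tr (show i + b + a + 1 = i + b + 1 + a by omega) (M.d _ (M.tr _ m)))
          rw [shift_tr]
          simp only [map_zsmul, tr_tr, d_tr, sgn_add]
          rw [mul_comm (sgn a)]
          exact (smul_smul _ _ _).symm⟩
      (fun i => M.tr (show i + b + a = i + (a + b) by omega))
      (fun i m => M.tr_tr _ _ m) (fun i m => M.tr_tr _ _ m))
    (fun f => by ext i m; exact (f_tr f _ m).symm)

instance : HasShift (Mod B) ℤ := hasShiftMk _ _
  { F := shiftF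
    zero := shiftZero
    add := shiftAdd
    assoc_hom_app := fun a b c M => by
      have key : ∀ (i : ℤ) (m : M.X (i + (a + b + c))),
          M.tr (show i + c + (a + b) = i + c + b + a by omega)
            (M.tr (show i + (a + b + c) = i + c + (a + b) by omega) m) =
          (M.shift a).tr (show i + (b + c) = i + c + b by omega)
            (M.tr (show i + (a + (b + c)) = i + (b + c) + a by omega)
              (M.tr (show i + (a + b + c) = i + (a + (b + c)) by omega) m)) := by
        intro i m
        rw [shift_tr]
        simp
      ext i m
      rw [comp_f, comp_f, comp_f]
      erw [eqToHom_shift_f (add_assoc a b c)]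
      exact key i m
    zero_add_hom_app := fun a M => by
      ext i m
      rw [comp_f]
      erw [eqToHom_shift_f (zero_add a)]
      exact (M.tr_tr (show i + (0 + a) = i + a by omega) (show i + a = i + a + 0 by omega) m).symm
    add_zero_hom_app := fun a M => by
      have key : ∀ (i : ℤ) (m : M.X (i + (a + 0))),
          M.tr (show i + (a + 0) = i + 0 + a by omega) m =
          (M.shift a).tr (show i = i + 0 by omega)
            (M.tr (show i + (a + 0) = i + a by omega) m) := by
        intro i m
        rw [shift_tr]
        simp
      ext i m
      rw [comp_f]
      erw [eqToHom_shift_f (add_zero a)]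
      exact key i m }

lemma shiftFunctor_eq (a : ℤ) : shiftFunctor (Mod B) a = shiftF a := rfl

instance (a : ℤ) : (shiftFunctor (Mod B) a).Additive where
  map_add := by intros; rfl

lemma shiftFunctorAdd_hom_f (a b : ℤ) (i : ℤ) (m : M.X (i + (a + b))) :
    Hom.f ((shiftFunctorAdd (Mod B) a b).hom.app M) i m =
      M.tr (show i + (a + b) = i + b + a by omega) m := rfl

lemma shiftFunctorAdd_inv_f (a b : ℤ) (i : ℤ) (m : M.X (i + b + a)) :
    Hom.f ((shiftFunctorAdd (Mod B) a b).inv.app M) i m =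
      M.tr (show i + b + a = i + (a + b) by omega) m := rfl

lemma shiftFunctorComm_hom_f (a b : ℤ) (i : ℤ) (m : M.X (i + b + a)) :
    Hom.f ((shiftFunctorComm (Mod B) a b).hom.app M) i m =
      M.tr (show i + b + a = i + a + b by omega) m := by
  have key : ∀ (c : ℤ) (h : b + a = c), Hom.f ((shiftFunctorAdd' (Mod B) b a c h).hom.app M) i =
      M.tr (show i + c = i + a + b by omega) := by
    intro c h; subst h
    rw [shiftFunctorAdd'_eq_shiftFunctorAdd]; rfl
  rw [shiftFunctorComm_eq _ a b (a + b) rfl]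
  simp only [Iso.trans_hom, Iso.symm_hom, NatTrans.comp_app]
  change Hom.f ((shiftFunctorAdd' (Mod B) b a (a + b) (add_comm b a)).hom.app M) i
    (Hom.f ((shiftFunctorAdd' (Mod B) a b (a + b) rfl).inv.app M) i m) = _
  rw [key, shiftFunctorAdd'_eq_shiftFunctorAdd]
  exact M.tr_tr _ _ m

/-! ### Homotopies -/

/-- A homotopy between closed morphisms: a degree `-1` map `h`, linear in the graded sense, with
`f - g = d h + h d`. -/
structure Htpy (f g : M ⟶ N) where
  h : ∀ i : ℤ, M.X (i + 1) →+ N.X i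
  h_smul : ∀ {i j k : ℤ} (e : i + (j + 1) = k + 1) (e' : i + j = k) (b : B.X i) (m : M.X (j + 1)),
    h k (M.smul e b m) = sgn i • N.smul e' b (h j m)
  comm : ∀ (i : ℤ) (m : M.X (i + 1)),
    f.f (i + 1) m - g.f (i + 1) m = N.d i (h i m) + h (i + 1) (M.d (i + 1) m)

/-- The homotopy relation. -/
def homotopic (B : CDGAlgebra R) : HomRel (Mod B) := fun _ _ f g => Nonempty (Htpy f g)

lemma homotopic_iff_sub (f g : M ⟶ N) : homotopic B f g ↔ homotopic B (f - g) 0 :=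
  ⟨fun ⟨h⟩ => ⟨⟨h.h, h.h_smul, fun i m => by simpa using h.comm i m⟩⟩,
    fun ⟨h⟩ => ⟨⟨h.h, h.h_smul, fun i m => by simpa using h.comm i m⟩⟩⟩

lemma homotopic_add {f g f' g' : M ⟶ N} (h₁ : homotopic B f g) (h₂ : homotopic B f' g') :
    homotopic B (f + f') (g + g') := by
  obtain ⟨h⟩ := h₁
  obtain ⟨h'⟩ := h₂
  refine ⟨⟨fun i => h.h i + h'.h i, fun e e' b m => ?_, fun i m => ?_⟩⟩
  · simp [h.h_smul e e', h'.h_smul e e', N.smul_add]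
  · have := h.comm i m
    have := h'.comm i m
    simp only [add_f, AddMonoidHom.add_apply, map_add]
    grind

lemma homotopic_neg {f g : M ⟶ N} (h₁ : homotopic B f g) : homotopic B (-f) (-g) := by
  obtain ⟨h⟩ := h₁
  refine ⟨⟨fun i => -h.h i, fun e e' b m => ?_, fun i m => ?_⟩⟩
  · simp [h.h_smul e e']
  · have := h.comm i m
    simp only [neg_f, AddMonoidHom.neg_apply, map_neg]
    grind

lemma homotopic_refl (f : M ⟶ N) : homotopic B f f :=
  ⟨⟨fun i => 0, by intros; simp, by intros; simp⟩⟩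

lemma homotopic_comp_left (f : M ⟶ N) {g g' : N ⟶ P} (h₁ : homotopic B g g') :
    homotopic B (f ≫ g) (f ≫ g') := by
  obtain ⟨h⟩ := h₁
  refine ⟨⟨fun i => (h.h i).comp (f.f (i + 1)), fun e e' b m => ?_, fun i m => ?_⟩⟩
  · simp [h.h_smul e e']
  · simpa using h.comm i (f.f _ m)

lemma homotopic_comp_right {f f' : M ⟶ N} (g : N ⟶ P) (h₁ : homotopic B f f') :
    homotopic B (f ≫ g) (f' ≫ g) := by
  obtain ⟨h⟩ := h₁
  refine ⟨⟨fun i => (g.f i).comp (h.h i), fun e e' b m => ?_, fun i m => ?_⟩⟩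
  · simp [h.h_smul e e']
  · simpa using congrArg (g.f _) (h.comm i m)

instance : Congruence (homotopic B) where
  equivalence := ⟨homotopic_refl, fun {f g} h => by
      have := homotopic_neg ((homotopic_iff_sub f g).1 h)
      rw [homotopic_iff_sub]
      simpa using this,
    fun {f g k} h h' => by
      have := homotopic_add ((homotopic_iff_sub f g).1 h) ((homotopic_iff_sub g k).1 h')
      rw [homotopic_iff_sub]
      simpa using this⟩
  comp_left f _ _ h := homotopic_comp_left f h
  comp_right g h := homotopic_comp_right g h

instance : (homotopic B).IsCompatibleWithShift ℤ where
  condition a M N f g := by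
    rintro ⟨h⟩
    refine ⟨⟨fun i => sgn a • (h.h (i + a)).comp (M.tr (show i + 1 + a = i + a + 1 by omega)),
      fun {i j k} e e' b (m : M.X (j + 1 + a)) => ?_, fun i (m : M.X (i + 1 + a)) => ?_⟩⟩
    · change sgn a • h.h (k + a) (M.tr _ (sgn (a * i) • M.smul _ b m)) =
        sgn i • (sgn (a * i) • N.smul _ b (sgn a • h.h (j + a) (M.tr _ m)))
      rw [map_zsmul, tr_smul, map_zsmul, ← smul_tr M (j := j + 1 + a) (j' := j + a + 1)
        (by omega) (by omega), h.h_smul _ (show i + (j + a) = k + a by omega), smul_zsmul]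
      module
    · have h₁ : ∀ {p q : ℤ} (e : p = q) (m : M.X (p + 1)),
          h.h q (M.tr (by rw [e]) m) = N.tr e (h.h p m) := by
        intro p q e m; subst e; rfl
      have h₂ : ∀ {p q : ℤ} (e : q + 1 = p) (m : M.X p), f.f p m - g.f p m =
          N.tr e (N.d q (h.h q (M.tr e.symm m))) + h.h p (M.d p m) := by
        intro p q e m; subst e; exact h.comm _ m
      change f.f (i + 1 + a) m - g.f (i + 1 + a) m =
        sgn a • N.tr _ (N.d (i + a) (sgn a • h.h (i + a) (M.tr _ m))) +
        sgn a • h.h (i + 1 + a) (M.tr _ (sgn a • M.tr _ (M.d (i + 1 + a) m)))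
      rw [h₂ (show i + a + 1 = i + 1 + a by omega)]
      simp only [map_zsmul, smul_smul, sgn_sq, one_zsmul, tr_tr]
      rfl

end Mod

/-! ### The homotopy category -/

variable {R : Type u} [CommRing R]

/-- The homotopy category `Hot(B)` of cdg modules. -/
abbrev Hot (B : CDGAlgebra R) := Quotient (Mod.homotopic B)

namespace Hot

variable {B : CDGAlgebra R}

/-- The projection from cdg modules to the homotopy category. -/
abbrev Q (B : CDGAlgebra R) : Mod B ⥤ Hot B := Quotient.functor (Mod.homotopic B)

instance : Preadditive (Hot B) :=
  Quotient.preadditive _ (fun _ _ _ _ _ _ h h' => Mod.homotopic_add h h')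

instance : (Q B).Additive := Quotient.functor_additive _
  (fun _ _ _ _ _ _ h h' => Mod.homotopic_add h h')

lemma map_eq_iff {M N : Mod B} (f g : M ⟶ N) :
    (Q B).map f = (Q B).map g ↔ Mod.homotopic B f g := Quotient.functor_map_eq_iff _ f g

instance (a : ℤ) : (shiftFunctor (Hot B) a).Additive := by
  have : (Q B ⋙ shiftFunctor _ a).Additive :=
    Functor.additive_of_iso ((Q B).commShiftIso a)
  exact Functor.additive_of_full_essSurj_comp (Q B) _

end Hot
namespace Mod

variable {R : Type u} [CommRing R] {B : CDGAlgebra R} {M N P : Mod B}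

/-! ### Cones -/

/-- The cone of a closed morphism `f : M ⟶ N`: the graded module `N ⊕ M[1]` with differential
`(n, m) ↦ (d n + f m, -d m)`. -/
def cone (f : M ⟶ N) : Mod B where
  X i := N.X i × M.X (i + 1)
  smul {i j k} h b x := (N.smul h b x.1, sgn i • M.smul (by omega) b x.2)
  smul_add _ _ _ _ := by simp [N.smul_add, M.smul_add]
  add_smul _ _ _ _ := by simp [N.add_smul, M.add_smul]
  one_smul m := by
    refine Prod.ext (N.one_smul _) ?_
    simp only [sgn_zero, one_zsmul]
    exact M.one_smul _
  mul_smul {i j l ij jl ijl} h₁ h₂ h₃ h₄ r s m := by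
    subst h₁
    refine Prod.ext (N.mul_smul _ _ _ _ _ _ _) ?_
    simp only
    rw [M.mul_smul rfl _ (show j + (l + 1) = jl + 1 by omega) (by omega), smul_zsmul, smul_smul,
      sgn_add]
  d i := AddMonoidHom.mk' (fun x => (N.d i x.1 + f.f (i + 1) x.2, -M.d (i + 1) x.2)) (by
    intro x y
    refine Prod.ext ?_ ?_
    · simp only [Prod.fst_add, Prod.snd_add, map_add]; abel
    · simp only [Prod.snd_add, map_add]; abel)
  leibniz {i j k} h h₁ h₂ b m := by
    simp only [AddMonoidHom.mk'_apply, map_zsmul, f_smul]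
    rw [N.leibniz h h₁ h₂, M.leibniz (show i + (j + 1) = k + 1 by omega) (by omega) (by omega)]
    refine Prod.ext ?_ ?_
    · simp only [Prod.fst_add, N.smul_add, Prod.smul_fst]; module
    · simp only [Prod.snd_add, Prod.smul_snd, smul_neg, sgn_succ]; module
  d_d {i} h m := by
    simp only [AddMonoidHom.mk'_apply, map_add, map_neg, f_d]
    rw [N.d_d h, M.d_d (by omega)]
    refine Prod.ext ?_ ?_
    · simp
    · simp

/-- The inclusion of the target into the cone. -/
def coneIn (f : M ⟶ N) : N ⟶ cone f where
  f i := AddMonoidHom.inl (N.X i) (M.X (i + 1))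
  map_smul {i j k} h b m := by
    refine Prod.ext rfl ?_
    change (0 : M.X (k + 1)) = sgn i • M.smul _ b 0
    simp
  comm {i} m := by
    refine Prod.ext ?_ ?_
    · change N.d i m = N.d i m + f.f _ 0
      simp
    · change (0 : M.X (i + 1 + 1)) = -M.d _ 0
      simp

/-- The projection of the cone onto the shifted source. -/
def coneOut (f : M ⟶ N) : cone f ⟶ M⟦(1 : ℤ)⟧ where
  f i := AddMonoidHom.snd (N.X i) (M.X (i + 1))
  map_smul {i j k} h b x := by
    change sgn i • M.smul _ b x.2 = sgn (1 * i) • M.smul _ b x.2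
    rw [one_mul]
  comm {i} x := by
    change -M.d (i + 1) x.2 = sgn 1 • M.tr rfl (M.d (i + 1) x.2)
    simp

/-- The triangle `M ⟶ N ⟶ cone f ⟶ M[1]`. -/
def coneTriangle (f : M ⟶ N) : Triangle (Mod B) := Triangle.mk f (coneIn f) (coneOut f)

lemma cone_ext {f : M ⟶ N} {i : ℤ} {x y : (cone f).X i} (h₁ : x.1 = y.1) (h₂ : x.2 = y.2) :
    x = y := Prod.ext h₁ h₂

lemma cone_id_contractible (M : Mod B) : homotopic B (𝟙 (cone (𝟙 M))) 0 := by
  refine ⟨⟨fun i => (AddMonoidHom.inr (M.X i) (M.X (i + 1))).comp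
    (AddMonoidHom.fst (M.X (i + 1)) (M.X (i + 1 + 1))), ?_, ?_⟩⟩
  · intro i j k e e' b x
    refine cone_ext ?_ ?_
    · change (0 : M.X k) = sgn i • M.smul e' b 0
      simp
    · change M.smul e b x.1 = sgn i • (sgn i • M.smul _ b x.1)
      rw [smul_smul, sgn_sq, one_zsmul]
  · intro i x
    refine cone_ext ?_ ?_
    · change x.1 - 0 = (M.d i 0 + x.1) + 0
      simp
    · change x.2 - 0 = -M.d (i + 1) x.1 + (M.d (i + 1) x.1 + x.2)
      abel

/-- The map on cones induced by a square commuting up to homotopy. -/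
def coneMap {M' N' : Mod B} {f : M ⟶ N} {f' : M' ⟶ N'} {a : M ⟶ M'} {b : N ⟶ N'}
    (H : Htpy (f ≫ b) (a ≫ f')) : cone f ⟶ cone f' where
  f i := ((AddMonoidHom.coprod (b.f i) (H.h i)).prod
    ((a.f (i + 1)).comp (AddMonoidHom.snd (N.X i) (M.X (i + 1)))))
  map_smul {i j k} h r x := by
    refine cone_ext ?_ ?_
    · change b.f k (N.smul h r x.1) + H.h k (sgn i • M.smul _ r x.2) =
        N'.smul h r (b.f j x.1 + H.h j x.2)
      rw [map_zsmul, H.h_smul _ h, N'.smul_add, smul_smul, sgn_sq, one_zsmul, f_smul]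
    · change a.f (k + 1) (sgn i • M.smul _ r x.2) = sgn i • M'.smul _ r (a.f (j + 1) x.2)
      simp
  comm {i} x := by
    have h := H.comm i x.2
    refine cone_ext ?_ ?_
    · change b.f (i + 1) (N.d i x.1 + f.f (i + 1) x.2) + H.h (i + 1) (-M.d (i + 1) x.2) =
        N'.d i (b.f i x.1 + H.h i x.2) + f'.f (i + 1) (a.f (i + 1) x.2)
      simp only [comp_f] at h
      simp only [map_add, map_neg, f_d]
      rw [sub_eq_iff_eq_add] at h
      rw [h]
      abel
    · change a.f (i + 1 + 1) (-M.d (i + 1) x.2) = -M'.d (i + 1) (a.f (i + 1) x.2)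
      simp

section rotate

variable (f : M ⟶ N)

/-- `M[1] ⟶ cone (N ⟶ cone f)`. -/
def rotHom : M⟦(1 : ℤ)⟧ ⟶ cone (coneIn f) where
  f i := (AddMonoidHom.inr (N.X i) (M.X (i + 1))).prod (-f.f (i + 1))
  map_smul {i j k} h b (m : M.X (j + 1)) := by
    refine cone_ext (cone_ext ?_ ?_) ?_
    · change (0 : N.X k) = N.smul h b 0
      simp
    · change sgn (1 * i) • M.smul _ b m = sgn i • M.smul _ b m
      rw [one_mul]
    · change -f.f (k + 1) (sgn (1 * i) • M.smul _ b m) = sgn i • N.smul _ b (-f.f (j + 1) m)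
      simp
  comm {i} (m : M.X (i + 1)) := by
    refine cone_ext (cone_ext ?_ ?_) ?_
    · change (0 : N.X (i + 1)) = (N.d i 0 + f.f (i + 1) m) + -f.f (i + 1) m
      simp
    · change sgn 1 • M.tr rfl (M.d (i + 1) m) = -M.d (i + 1) m + 0
      simp
    · change -f.f (i + 1 + 1) (sgn 1 • M.tr rfl (M.d (i + 1) m)) = -N.d (i + 1) (-f.f (i + 1) m)
      simp

/-- `cone (N ⟶ cone f) ⟶ M[1]`. -/
def rotInv : cone (coneIn f) ⟶ M⟦(1 : ℤ)⟧ where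
  f i := (AddMonoidHom.snd (N.X i) (M.X (i + 1))).comp
    (AddMonoidHom.fst (N.X i × M.X (i + 1)) (N.X (i + 1)))
  map_smul {i j k} h b x := by
    change sgn i • M.smul _ b x.1.2 = sgn (1 * i) • M.smul _ b x.1.2
    rw [one_mul]
  comm {i} x := by
    change -M.d (i + 1) x.1.2 + 0 = sgn 1 • M.tr rfl (M.d (i + 1) x.1.2)
    simp

lemma rotHom_inv : rotHom f ≫ rotInv f = 𝟙 _ := rfl

lemma coneIn_rotInv : coneIn (coneIn f) ≫ rotInv f = coneOut f := rfl

lemma rotInv_hom : homotopic B (rotInv f ≫ rotHom f) (𝟙 _) := by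
  refine ⟨⟨fun i => (AddMonoidHom.inr (N.X i × M.X (i + 1)) (N.X (i + 1))).comp
    (-(AddMonoidHom.fst (N.X (i + 1)) (M.X (i + 1 + 1))).comp
      (AddMonoidHom.fst (N.X (i + 1) × M.X (i + 1 + 1)) (N.X (i + 1 + 1)))), ?_, ?_⟩⟩
  · intro i j k e e' b x
    refine cone_ext (cone_ext ?_ ?_) ?_
    · change (0 : N.X k) = sgn i • N.smul e' b 0
      simp
    · change (0 : M.X (k + 1)) = sgn i • (sgn i • M.smul _ b 0)
      simp
    · change -N.smul e b x.1.1 = sgn i • (sgn i • N.smul _ b (-x.1.1))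
      rw [smul_smul, sgn_sq, one_zsmul, smul_neg]
  · intro i x
    refine cone_ext (cone_ext ?_ ?_) ?_
    · change 0 - x.1.1 = (N.d i 0 + f.f (i + 1) 0 + -x.1.1) + 0
      simp
    · change x.1.2 - x.1.2 = (-M.d (i + 1) 0 + 0) + 0
      simp
    · change -f.f (i + 1 + 1) x.1.2 - x.2 = -N.d (i + 1) (-x.1.1) +
        -(N.d (i + 1) x.1.1 + f.f (i + 1 + 1) x.1.2 + x.2)
      simp only [map_neg]
      abel

end rotate

section shift

variable (f : M ⟶ N) (a : ℤ)

/-- `(cone f)[a] ≅ cone (f[a])`. -/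
def coneShiftIso : (cone f)⟦a⟧ ≅ cone (f⟦a⟧') :=
  isoMk
    { f := fun i => AddMonoidHom.prodMap (AddMonoidHom.id (N.X (i + a)))
        (sgn a • M.tr (show i + a + 1 = i + 1 + a by omega))
      map_smul := fun {i j k} h b (x : N.X (j + a) × M.X (j + a + 1)) => by
        refine cone_ext rfl ?_
        change sgn a • M.tr _ (sgn (a * i) • (sgn i • M.smul _ b x.2)) =
          sgn i • (sgn (a * i) • M.smul _ b (sgn a • M.tr _ x.2))
        simp only [map_zsmul, tr_smul, smul_zsmul, smul_tr]
        module
      comm := fun {i} (x : N.X (i + a) × M.X (i + a + 1)) => by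
        have h : ∀ {p q : ℤ} (e : p = q) (x : (cone f).X p), (cone f).tr e x =
            ((N.tr e x.1, M.tr (by rw [e]) x.2) : N.X q × M.X (q + 1)) := by
          intro p q e x; subst e; rfl
        have h' : (((cone f)⟦a⟧).d i x : N.X (i + 1 + a) × M.X (i + 1 + a + 1)) =
          (sgn a • N.tr (show i + a + 1 = i + 1 + a by omega) (N.d (i + a) x.1 + f.f _ x.2),
            sgn a • M.tr (show i + a + 1 + 1 = i + 1 + a + 1 by omega) (-M.d _ x.2)) := by
          change sgn a • (cone f).tr _ ((cone f).d (i + a) x) = _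
          rw [h]
          rfl
        refine Eq.trans (congrArg (fun x : N.X (i + 1 + a) × M.X (i + 1 + a + 1) =>
          ((x.1, sgn a • M.tr (show i + 1 + a + 1 = i + 1 + 1 + a by omega) x.2) :
          N.X (i + 1 + a) × M.X (i + 1 + 1 + a))) h') ?_
        refine Prod.ext ?_ ?_
        · change sgn a • N.tr _ (N.d (i + a) x.1 + f.f _ x.2) =
            sgn a • N.tr _ (N.d (i + a) x.1) + f.f (i + 1 + a) (sgn a • M.tr _ x.2)
          simp only [map_add, map_zsmul, f_tr, _root_.smul_add]
          rfl
        · change sgn a • M.tr _ (sgn a • M.tr _ (-M.d _ x.2)) =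
            -(sgn a • M.tr _ (M.d _ (sgn a • M.tr _ x.2)))
          simp only [map_zsmul, map_neg, tr_tr, d_tr, _root_.smul_neg] }
    (fun i (x : N.X (i + a) × M.X (i + 1 + a)) =>
      ((x.1, sgn a • M.tr (show i + 1 + a = i + a + 1 by omega) x.2) :
        N.X (i + a) × M.X (i + a + 1)))
    (fun i (x : N.X (i + a) × M.X (i + a + 1)) => by
      refine Prod.ext rfl ?_
      change sgn a • M.tr _ (sgn a • M.tr _ x.2) = x.2
      rw [map_zsmul, smul_smul, sgn_sq, one_zsmul, tr_tr, tr_rfl])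
    (fun i (x : N.X (i + a) × M.X (i + 1 + a)) => by
      refine Prod.ext rfl ?_
      change sgn a • M.tr _ (sgn a • M.tr _ x.2) = x.2
      rw [map_zsmul, smul_smul, sgn_sq, one_zsmul, tr_tr, tr_rfl])

lemma units_smul_f (u : ℤˣ) (g : M ⟶ N) (i : ℤ) (m : M.X i) : (u • g).f i m = (u : ℤ) • g.f i m := by
  rcases Int.units_eq_one_or u with rfl | rfl
  · simp
  · simp

/-- The shift of a cone triangle is a cone triangle. -/
def coneTriangleShiftIso :
    (Triangle.shiftFunctor _ a).obj (coneTriangle f) ≅ coneTriangle (f⟦a⟧') := by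
  refine Triangle.isoMk _ _ (Iso.refl _) (a.negOnePow • Iso.refl _) (coneShiftIso f a) ?_ ?_ ?_
  · change (a.negOnePow • f⟦a⟧') ≫ (a.negOnePow • 𝟙 _) = 𝟙 _ ≫ f⟦a⟧'
    rw [Linear.units_smul_comp, Linear.comp_units_smul, smul_smul, Int.units_mul_self]
    simp
  · change (a.negOnePow • (coneIn f)⟦a⟧') ≫ (coneShiftIso f a).hom =
      (a.negOnePow • 𝟙 _) ≫ coneIn (f⟦a⟧')
    ext i m
    rw [comp_f, comp_f, units_smul_f, units_smul_f, map_zsmul, map_zsmul]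
    congr 1
    refine Prod.ext rfl ?_
    change sgn a • M.tr _ 0 = 0
    simp
  · change (a.negOnePow • (coneOut f)⟦a⟧' ≫ (shiftFunctorComm _ 1 a).hom.app M) ≫ (𝟙 (M⟦a⟧))⟦(1 : ℤ)⟧' =
      (coneShiftIso f a).hom ≫ coneOut (f⟦a⟧')
    ext i m
    rw [comp_f, units_smul_f, map_zsmul, comp_f, comp_f]
    erw [shiftFunctorComm_hom_f]
    rfl

end shift

section octahedron

variable (f : M ⟶ N) (g : N ⟶ P)

/-- `cone f ⟶ cone (f ≫ g)`. -/
def octα : cone f ⟶ cone (f ≫ g) where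
  f i := AddMonoidHom.prodMap (g.f i) (AddMonoidHom.id (M.X (i + 1)))
  map_smul {i j k} h b x := by
    refine cone_ext ?_ rfl
    change g.f k (N.smul h b x.1) = P.smul h b (g.f j x.1)
    simp
  comm {i} x := by
    refine cone_ext ?_ rfl
    change g.f _ (N.d i x.1 + f.f (i + 1) x.2) = P.d i (g.f i x.1) + g.f _ (f.f _ x.2)
    simp

/-- `cone (f ≫ g) ⟶ cone g`. -/
def octβ : cone (f ≫ g) ⟶ cone g where
  f i := AddMonoidHom.prodMap (AddMonoidHom.id (P.X i)) (f.f (i + 1))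
  map_smul {i j k} h b x := by
    refine cone_ext rfl ?_
    change f.f (k + 1) (sgn i • M.smul _ b x.2) = sgn i • N.smul _ b (f.f (j + 1) x.2)
    simp
  comm {i} x := by
    refine cone_ext rfl ?_
    change f.f _ (-M.d _ x.2) = -N.d _ (f.f _ x.2)
    simp

/-- `cone g ⟶ cone (cone f ⟶ cone (f ≫ g))`. -/
def octHom : cone g ⟶ cone (octα f g) where
  f i := AddMonoidHom.prodMap (AddMonoidHom.inl (P.X i) (M.X (i + 1)))
    (AddMonoidHom.inl (N.X (i + 1)) (M.X (i + 1 + 1)))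
  map_smul {i j k} h b x := by
    refine cone_ext (cone_ext rfl ?_) (cone_ext rfl ?_)
    · change (0 : M.X (k + 1)) = sgn i • M.smul _ b 0
      simp
    · change (0 : M.X (k + 1 + 1)) = sgn i • (sgn i • M.smul _ b 0)
      simp
  comm {i} x := by
    refine cone_ext (cone_ext ?_ ?_) (cone_ext ?_ ?_)
    · change P.d i x.1 + g.f _ x.2 = (P.d i x.1 + g.f _ (f.f _ 0)) + g.f _ x.2
      simp
    · change (0 : M.X (i + 1 + 1)) = -M.d _ 0 + 0
      simp
    · change -N.d _ x.2 = -(N.d _ x.2 + f.f _ 0)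
      simp
    · change (0 : M.X (i + 1 + 1 + 1)) = -(-M.d _ 0)
      simp

/-- `cone (cone f ⟶ cone (f ≫ g)) ⟶ cone g`. -/
def octInv : cone (octα f g) ⟶ cone g where
  f i := ((AddMonoidHom.fst (P.X i) (M.X (i + 1))).comp
      (AddMonoidHom.fst _ (N.X (i + 1) × M.X (i + 1 + 1)))).prod
    ((AddMonoidHom.fst (N.X (i + 1)) (M.X (i + 1 + 1))).comp
      (AddMonoidHom.snd (P.X i × M.X (i + 1)) _) + ((f.f (i + 1)).comp
        (AddMonoidHom.snd (P.X i) (M.X (i + 1)))).comp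
      (AddMonoidHom.fst _ (N.X (i + 1) × M.X (i + 1 + 1))))
  map_smul {i j k} h b x := by
    refine cone_ext rfl ?_
    change sgn i • N.smul _ b x.2.1 + f.f _ (sgn i • M.smul _ b x.1.2) =
      sgn i • N.smul _ b (x.2.1 + f.f _ x.1.2)
    simp [N.smul_add]
  comm {i} x := by
    refine cone_ext ?_ ?_
    · change (P.d i x.1.1 + g.f _ (f.f _ x.1.2)) + g.f _ x.2.1 =
        P.d i x.1.1 + g.f _ (x.2.1 + f.f _ x.1.2)
      simp only [map_add]; abel
    · change -(N.d _ x.2.1 + f.f _ x.2.2) + f.f _ (-M.d _ x.1.2 + x.2.2) =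
        -N.d _ (x.2.1 + f.f _ x.1.2)
      simp only [map_add, map_neg, f_d]; abel

lemma octHom_inv : octHom f g ≫ octInv f g = 𝟙 _ := by
  ext i x
  refine cone_ext rfl ?_
  change x.2 + f.f _ 0 = x.2
  simp

lemma coneIn_octInv : coneIn (octα f g) ≫ octInv f g = octβ f g := by
  ext i x
  refine cone_ext rfl ?_
  change 0 + f.f _ x.2 = f.f _ x.2
  simp

lemma octHom_coneOut : octHom f g ≫ coneOut (octα f g) = coneOut g ≫ (coneIn f)⟦(1 : ℤ)⟧' := rfl

lemma octInv_hom : homotopic B (octInv f g ≫ octHom f g) (𝟙 _) := by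
  refine ⟨⟨fun i => ((AddMonoidHom.inr (P.X i × M.X (i + 1)) (N.X (i + 1) × M.X (i + 1 + 1))).comp
      (AddMonoidHom.inr (N.X (i + 1)) (M.X (i + 1 + 1)))).comp
    (-(AddMonoidHom.snd (P.X (i + 1)) (M.X (i + 1 + 1))).comp
      (AddMonoidHom.fst _ (N.X (i + 1 + 1) × M.X (i + 1 + 1 + 1)))), ?_, ?_⟩⟩
  · intro i j k e e' b x
    refine cone_ext (cone_ext ?_ ?_) (cone_ext ?_ ?_)
    · change (0 : P.X k) = sgn i • P.smul e' b 0
      simp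
    · change (0 : M.X (k + 1)) = sgn i • (sgn i • M.smul _ b 0)
      simp
    · change (0 : N.X (k + 1)) = sgn i • (sgn i • N.smul _ b 0)
      simp
    · change -(sgn i • M.smul _ b x.1.2) = sgn i • (sgn i • (sgn i • M.smul _ b (-x.1.2)))
      rw [smul_smul, sgn_sq, one_zsmul, smul_neg, _root_.smul_neg]
  · intro i x
    refine cone_ext (cone_ext ?_ ?_) (cone_ext ?_ ?_)
    · change x.1.1 - x.1.1 = (P.d i 0 + g.f _ (f.f _ 0) + g.f _ 0) + 0
      simp
    · change 0 - x.1.2 = (-M.d (i + 1) 0 + -x.1.2) + 0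
      simp
    · change (x.2.1 + f.f _ x.1.2) - x.2.1 = -(N.d (i + 1) 0 + f.f _ (-x.1.2)) + 0
      simp
    · change 0 - x.2.2 = -(-M.d (i + 1 + 1) (-x.1.2)) + -(-M.d _ x.1.2 + x.2.2)
      simp

end octahedron

/-- The zero module. -/
def zeroMod (B : CDGAlgebra R) : Mod B where
  X _ := PUnit
  smul _ _ _ := 0
  smul_add := by intros; rfl
  add_smul := by intros; rfl
  one_smul := by intros; rfl
  mul_smul := by intros; rfl
  d _ := 0
  leibniz := by intros; rfl
  d_d := by intros; rfl

lemma isZero_zeroMod : IsZero (zeroMod B) := by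
  rw [IsZero.iff_id_eq_zero]
  ext i m
  rfl

instance : HasZeroObject (Mod B) := ⟨zeroMod B, isZero_zeroMod⟩

end Mod

namespace Hot

variable {R : Type u} [CommRing R] {B : CDGAlgebra R} {M N P : Mod B}

instance : HasZeroObject (Hot B) := ⟨(Q B).obj (Mod.zeroMod B), by
  rw [IsZero.iff_id_eq_zero, ← (Q B).map_id, Mod.isZero_zeroMod.eq_of_src (𝟙 _) 0]
  exact (Q B).map_zero _ _⟩

/-- Mutually inverse homotopy equivalences give isomorphisms in the homotopy category. -/
def isoOfHtpy (u : M ⟶ N) (v : N ⟶ M) (h₁ : Mod.homotopic B (u ≫ v) (𝟙 _))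
    (h₂ : Mod.homotopic B (v ≫ u) (𝟙 _)) : (Q B).obj M ≅ (Q B).obj N where
  hom := (Q B).map u
  inv := (Q B).map v
  hom_inv_id := by
    rw [← (Q B).map_comp, (map_eq_iff _ _).2 h₁, (Q B).map_id]
  inv_hom_id := by
    rw [← (Q B).map_comp, (map_eq_iff _ _).2 h₂, (Q B).map_id]

/-- The image of the cone triangle in the homotopy category. -/
abbrev stdTriangle (f : M ⟶ N) : Triangle (Hot B) :=
  (Q B).mapTriangle.obj (Mod.coneTriangle f)

/-- Distinguished triangles are those isomorphic to the image of a cone triangle. -/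
def distTriangles (B : CDGAlgebra R) : Set (Triangle (Hot B)) :=
  { T | ∃ (M N : Mod B) (f : M ⟶ N), Nonempty (T ≅ stdTriangle f) }

lemma mem_of_iso {T T' : Triangle (Hot B)} (h : T ∈ distTriangles B) (e : T' ≅ T) :
    T' ∈ distTriangles B := by
  obtain ⟨M, N, f, ⟨e'⟩⟩ := h
  exact ⟨M, N, f, ⟨e ≪≫ e'⟩⟩

lemma mem_of_coneIso (T : Triangle (Mod B)) (e : (Q B).obj T.obj₃ ≅ (Q B).obj (Mod.cone T.mor₁))
    (h₂ : (Q B).map T.mor₂ ≫ e.hom = (Q B).map (Mod.coneIn T.mor₁))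
    (h₃ : (Q B).map T.mor₃ = e.hom ≫ (Q B).map (Mod.coneOut T.mor₁)) :
    (Q B).mapTriangle.obj T ∈ distTriangles B := by
  refine ⟨_, _, T.mor₁, ⟨Triangle.isoMk _ _ (Iso.refl _) (Iso.refl _) e ?_ ?_ ?_⟩⟩
  · exact (Category.comp_id _).trans (Category.id_comp _).symm
  · exact h₂.trans (Category.id_comp _).symm
  · change ((Q B).map T.mor₃ ≫ ((Q B).commShiftIso (1 : ℤ)).hom.app T.obj₁) ≫ (𝟙 _)⟦(1 : ℤ)⟧' =
      e.hom ≫ (Q B).map (Mod.coneOut T.mor₁) ≫ ((Q B).commShiftIso (1 : ℤ)).hom.app T.obj₁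
    rw [h₃, CategoryTheory.Functor.map_id]
    exact (Category.comp_id _).trans (Category.assoc _ _ _)

lemma contractible_mem (X : Hot B) : contractibleTriangle X ∈ distTriangles B := by
  obtain ⟨M⟩ := X
  have h : IsZero ((Q B).obj (Mod.cone (𝟙 M))) := by
    rw [IsZero.iff_id_eq_zero, ← (Q B).map_id, ← (Q B).map_zero, map_eq_iff]
    exact Mod.cone_id_contractible M
  refine ⟨_, _, 𝟙 M, ⟨Triangle.isoMk _ _ (Iso.refl _) (Iso.refl _) h.isoZero.symm ?_ ?_ ?_⟩⟩
  · exact (Category.comp_id _).trans (((Q B).map_id M).symm.trans (Category.id_comp _).symm)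
  · exact h.eq_of_tgt _ _
  · exact (isZero_zero _).eq_of_src _ _

lemma rotate_mem (T : Triangle (Hot B)) (hT : T ∈ distTriangles B) :
    T.rotate ∈ distTriangles B := by
  obtain ⟨M, N, f, ⟨e⟩⟩ := hT
  refine mem_of_iso (mem_of_coneIso (Mod.coneTriangle f).rotate
    (isoOfHtpy (Mod.rotHom f) (Mod.rotInv f) ?_ (Mod.rotInv_hom f)) ?_ ?_)
    ((rotate _).mapIso e ≪≫ ((Q B).mapTriangleRotateIso.app (Mod.coneTriangle f)))
  · exact Mod.homotopic_refl (𝟙 (M⟦(1 : ℤ)⟧))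
  · rw [← Iso.eq_comp_inv]
    exact congrArg (Q B).map (Mod.coneIn_rotInv f).symm
  · exact (Q B).map_comp (Mod.rotHom f) (Mod.coneOut (Mod.coneIn f)) ▸ congrArg (Q B).map rfl

lemma shift_mem (T : Triangle (Hot B)) (hT : T ∈ distTriangles B) (a : ℤ) :
    (Triangle.shiftFunctor _ a).obj T ∈ distTriangles B := by
  obtain ⟨M, N, f, ⟨e⟩⟩ := hT
  exact ⟨_, _, f⟦a⟧', ⟨(Triangle.shiftFunctor _ a).mapIso e ≪≫
    ((Q B).mapTriangle.commShiftIso a).symm.app _ ≪≫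
    (Q B).mapTriangle.mapIso (Mod.coneTriangleShiftIso f a)⟩⟩

lemma invRotate_mem (T : Triangle (Hot B)) (hT : T ∈ distTriangles B) :
    T.invRotate ∈ distTriangles B :=
  mem_of_iso (shift_mem _ (rotate_mem _ (rotate_mem _ hT)) _)
    ((invRotateIsoRotateRotateShiftFunctorNegOne _).app T)

lemma complete_mem (T₁ T₂ : Triangle (Hot B)) (hT₁ : T₁ ∈ distTriangles B)
    (hT₂ : T₂ ∈ distTriangles B) (a : T₁.obj₁ ⟶ T₂.obj₁) (b : T₁.obj₂ ⟶ T₂.obj₂)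
    (fac : T₁.mor₁ ≫ b = a ≫ T₂.mor₁) :
    ∃ c : T₁.obj₃ ⟶ T₂.obj₃, T₁.mor₂ ≫ c = b ≫ T₂.mor₂ ∧
      T₁.mor₃ ≫ a⟦(1 : ℤ)⟧' = c ≫ T₂.mor₃ := by
  obtain ⟨M, N, f, ⟨e₁⟩⟩ := hT₁
  obtain ⟨M', N', f', ⟨e₂⟩⟩ := hT₂
  obtain ⟨a', ha'⟩ := (Q B).map_surjective
    (X := M) (Y := M') (e₁.inv.hom₁ ≫ a ≫ e₂.hom.hom₁)
  obtain ⟨b', hb'⟩ := (Q B).map_surjective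
    (X := N) (Y := N') (e₁.inv.hom₂ ≫ b ≫ e₂.hom.hom₂)
  have ha : e₁.hom.hom₁ ≫ (Q B).map a' = a ≫ e₂.hom.hom₁ :=
    (congrArg (e₁.hom.hom₁ ≫ ·) ha').trans (e₁.hom_inv_id_triangle_hom₁_assoc _)
  have hb : e₁.hom.hom₂ ≫ (Q B).map b' = b ≫ e₂.hom.hom₂ :=
    (congrArg (e₁.hom.hom₂ ≫ ·) hb').trans (e₁.hom_inv_id_triangle_hom₂_assoc _)
  have c : (Q B).map f ≫ (Q B).map b' = (Q B).map a' ≫ (Q B).map f' := by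
    have c₁ : T₁.mor₁ ≫ e₁.hom.hom₂ = e₁.hom.hom₁ ≫ (stdTriangle f).mor₁ := e₁.hom.comm₁
    have c₂ : T₂.mor₁ ≫ e₂.hom.hom₂ = e₂.hom.hom₁ ≫ (stdTriangle f').mor₁ := e₂.hom.comm₁
    have : e₁.hom.hom₁ ≫ (stdTriangle f).mor₁ ≫ (Q B).map b' =
        e₁.hom.hom₁ ≫ (Q B).map a' ≫ (stdTriangle f').mor₁ := by
      refine (Category.assoc _ _ _).symm.trans ((congrArg (· ≫ (Q B).map b') c₁.symm).trans
        ((Category.assoc _ _ _).trans ?_))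
      have h₁ : T₁.mor₁ ≫ e₁.hom.hom₂ ≫ (Q B).map b' = (T₁.mor₁ ≫ b) ≫ e₂.hom.hom₂ :=
        (congrArg (T₁.mor₁ ≫ ·) hb).trans (Category.assoc _ _ _).symm
      have h₂ : (a ≫ T₂.mor₁) ≫ e₂.hom.hom₂ = (a ≫ e₂.hom.hom₁) ≫ (stdTriangle f').mor₁ := by
        rw [Category.assoc, Category.assoc, c₂]
      exact h₁.trans ((congrArg (· ≫ e₂.hom.hom₂) fac).trans (h₂.trans
        ((congrArg (· ≫ (stdTriangle f').mor₁) ha.symm).trans (Category.assoc _ _ _))))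
    exact (cancel_epi e₁.hom.hom₁).1 this
  obtain ⟨H⟩ : Mod.homotopic B (f ≫ b') (a' ≫ f') := by
    rw [← map_eq_iff, Functor.map_comp, Functor.map_comp, c]
  let γ : stdTriangle f ⟶ stdTriangle f' :=
    { hom₁ := (Q B).map a'
      hom₂ := (Q B).map b'
      hom₃ := (Q B).map (Mod.coneMap H)
      comm₁ := c
      comm₂ := by
        change (Q B).map (Mod.coneIn f) ≫ (Q B).map (Mod.coneMap H) =
          (Q B).map b' ≫ (Q B).map (Mod.coneIn f')
        rw [← Functor.map_comp, ← Functor.map_comp]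
        congr 1
        ext i n
        refine Mod.cone_ext ?_ ?_
        · change b'.f i n + H.h i 0 = b'.f i n
          simp
        · change a'.f _ 0 = 0
          simp
      comm₃ := by
        change ((Q B).map (Mod.coneOut f) ≫ ((Q B).commShiftIso (1 : ℤ)).hom.app M) ≫
            ((Q B).map a')⟦(1 : ℤ)⟧' = (Q B).map (Mod.coneMap H) ≫
              (Q B).map (Mod.coneOut f') ≫ ((Q B).commShiftIso (1 : ℤ)).hom.app M'
        rw [Category.assoc, ← Functor.commShiftIso_hom_naturality, ← Functor.map_comp_assoc,
          ← Functor.map_comp_assoc]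
        rfl }
  have h₁ : e₁.hom.hom₁ ≫ γ.hom₁ = a ≫ e₂.hom.hom₁ := ha
  have h₂ : e₁.hom.hom₂ ≫ γ.hom₂ = b ≫ e₂.hom.hom₂ := hb
  refine ⟨e₁.hom.hom₃ ≫ γ.hom₃ ≫ e₂.inv.hom₃, ?_, ?_⟩
  · rw [e₁.hom.comm₂_assoc, γ.comm₂_assoc, reassoc_of% h₂, e₂.inv.comm₂,
      Iso.hom_inv_id_triangle_hom₂_assoc]
  · rw [Category.assoc, Category.assoc, ← e₂.inv.comm₃, ← γ.comm₃_assoc, ← e₁.hom.comm₃_assoc,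
      ← Functor.map_comp, ← Functor.map_comp, reassoc_of% h₁, Iso.hom_inv_id_triangle_hom₁,
      Category.comp_id]

/-- The homotopy category of cdg modules is pretriangulated, with the cone triangles. -/
instance : Pretriangulated (Hot B) where
  distinguishedTriangles := distTriangles B
  isomorphic_distinguished _ hT _ e := mem_of_iso hT e
  contractible_distinguished := contractible_mem
  distinguished_cocone_triangle f := by
    obtain ⟨f, rfl⟩ := (Q B).map_surjective f
    exact ⟨_, _, _, ⟨_, _, f, ⟨Iso.refl _⟩⟩⟩
  rotate_distinguished_triangle T := ⟨rotate_mem T, fun hT =>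
    mem_of_iso (invRotate_mem T.rotate hT) ((triangleRotation _).unitIso.app T)⟩
  complete_distinguished_triangle_morphism := complete_mem

lemma std_dist (f : M ⟶ N) : stdTriangle f ∈ distTriang (Hot B) := ⟨_, _, f, ⟨Iso.refl _⟩⟩

lemma oct_dist (f : M ⟶ N) (g : N ⟶ P) :
    (Q B).mapTriangle.obj (Triangle.mk (Mod.octα f g) (Mod.octβ f g)
      (Mod.coneOut g ≫ (Mod.coneIn f)⟦(1 : ℤ)⟧')) ∈ distTriang (Hot B) := by
  refine mem_of_coneIso _ (isoOfHtpy (Mod.octHom f g) (Mod.octInv f g) ?_ (Mod.octInv_hom f g))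
    ?_ ?_
  · exact (congrArg (fun u => Mod.homotopic B u (𝟙 (Mod.cone g)))
      (Mod.octHom_inv f g)).mpr (Mod.homotopic_refl _)
  · rw [← Iso.eq_comp_inv]
    exact (congrArg (Q B).map (Mod.coneIn_octInv f g).symm).trans ((Q B).map_comp _ _)
  · exact (congrArg (Q B).map (Mod.octHom_coneOut f g).symm).trans ((Q B).map_comp _ _)

instance : IsTriangulated (Hot B) := IsTriangulated.mk' (by
  rintro ⟨M⟩ ⟨N⟩ ⟨P⟩ f' g'
  obtain ⟨f, rfl⟩ := (Q B).map_surjective f'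
  obtain ⟨g, rfl⟩ := (Q B).map_surjective g'
  have h : Triangle.mk ((Q B).map f ≫ (Q B).map g) ((Q B).map (Mod.coneIn (f ≫ g)))
      ((Q B).map (Mod.coneOut (f ≫ g)) ≫ ((Q B).commShiftIso (1 : ℤ)).hom.app M) ∈
      distTriang (Hot B) := by
    rw [← Functor.map_comp]
    exact std_dist (f ≫ g)
  refine ⟨(Q B).obj M, (Q B).obj N, (Q B).obj P, _, _, _, (Q B).map f, (Q B).map g,
    Iso.refl _, Iso.refl _, Iso.refl _,
    (Category.comp_id _).trans (Category.id_comp _).symm,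
    (Category.comp_id _).trans (Category.id_comp _).symm,
    _, _, std_dist f, _, _, std_dist g, _, _, h,
    ⟨⟨(Q B).map (Mod.octα f g), (Q B).map (Mod.octβ f g), ?_, ?_, ?_, ?_, ?_⟩⟩⟩
  · exact ((Q B).map_comp _ _).symm.trans ((congrArg (Q B).map (by rfl)).trans ((Q B).map_comp _ _))
  · exact (Category.assoc _ _ _).symm.trans (congrArg (· ≫ ((Q B).commShiftIso (1 : ℤ)).hom.app M)
      (((Q B).map_comp (Mod.octα f g) (Mod.coneOut (f ≫ g))).symm.trans rfl))
  · refine ((Q B).map_comp _ _).symm.trans (congrArg (Q B).map ?_)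
    ext i x
    refine Mod.cone_ext rfl ?_
    change f.f _ 0 = 0
    simp
  · change ((Q B).map (Mod.coneOut (f ≫ g)) ≫ ((Q B).commShiftIso (1 : ℤ)).hom.app M) ≫
        ((Q B).map f)⟦(1 : ℤ)⟧' = (Q B).map (Mod.octβ f g) ≫
          (Q B).map (Mod.coneOut g) ≫ ((Q B).commShiftIso (1 : ℤ)).hom.app N
    rw [Category.assoc, ← Functor.commShiftIso_hom_naturality, ← Functor.map_comp_assoc,
      ← Functor.map_comp_assoc]
    rfl
  · have e : ((Q B).map (Mod.coneOut g) ≫ ((Q B).commShiftIso (1 : ℤ)).hom.app N) ≫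
        ((Q B).map (Mod.coneIn f))⟦(1 : ℤ)⟧' = (Q B).map (Mod.coneOut g ≫ (Mod.coneIn f)⟦(1 : ℤ)⟧') ≫
          ((Q B).commShiftIso (1 : ℤ)).hom.app (Mod.cone f) := by
      rw [Category.assoc, ← Functor.commShiftIso_hom_naturality, Functor.map_comp, Category.assoc]
    have h' : Triangle.mk ((Q B).map (Mod.octα f g)) ((Q B).map (Mod.octβ f g))
        (((Q B).map (Mod.coneOut g) ≫ ((Q B).commShiftIso (1 : ℤ)).hom.app N) ≫
          ((Q B).map (Mod.coneIn f))⟦(1 : ℤ)⟧') ∈ distTriang (Hot B) := by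
      rw [e]
      exact oct_dist f g
    exact h')

end Hot
namespace Mod

variable {R : Type u} [CommRing R] {B : CDGAlgebra R} {M N P : Mod B}

/-! ### Acyclicity with respect to the filtration by powers of `t` -/

/-- The action of a scalar `r` of the base ring on a module, through `r • 1`. -/
def act (M : Mod B) (r : R) (i : ℤ) : M.X i →+ M.X i := M.smulHom (zero_add i) (r • B.one)

lemma act_def (r : R) {i : ℤ} (m : M.X i) : M.act r i m = M.smul (zero_add i) (r • B.one) m := rfl

lemma smul_act (r : R) {i j k : ℤ} (h : i + j = k) (b : B.X i) (m : M.X j) :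
    M.smul h b (M.act r j m) = M.act r k (M.smul h b m) := by
  rw [act_def, act_def, ← M.mul_smul (add_zero i) h (zero_add j) h,
    ← M.mul_smul (zero_add i) h h (zero_add k)]
  simp [B.mul_one, B.one_mul]

lemma smul_smul_eq_act (r : R) {i j k : ℤ} (h : i + j = k) (b : B.X i) (m : M.X j) :
    M.smul h (r • b) m = M.act r k (M.smul h b m) := by
  rw [act_def, ← M.mul_smul (zero_add i) h h (zero_add k)]
  simp [B.one_mul]

@[simp] lemma act_one {i : ℤ} (m : M.X i) : M.act 1 i m = m := by
  rw [act_def, _root_.one_smul, M.one_smul]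

@[simp] lemma act_zero {i : ℤ} (m : M.X i) : M.act 0 i m = 0 := by
  rw [act_def, _root_.zero_smul, zero_smul]

lemma act_mul (r s : R) {i : ℤ} (m : M.X i) : M.act (r * s) i m = M.act r i (M.act s i m) := by
  rw [act_def, ← smul_smul, smul_smul_eq_act]
  rfl

@[simp] lemma d_act (r : R) {i : ℤ} (m : M.X i) :
    M.d i (M.act r i m) = M.act r (i + 1) (M.d i m) := by
  rw [act_def, M.leibniz (zero_add i) (by omega) (by omega)]
  simp only [map_smul, B.d_one, _root_.smul_zero, zero_smul, sgn_zero, one_zsmul, _root_.zero_add]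
  rfl

@[simp] lemma f_act (f : M ⟶ N) (r : R) {i : ℤ} (m : M.X i) :
    f.f i (M.act r i m) = N.act r i (f.f i m) := f_smul f _ _ _

lemma Htpy.h_act {f g : M ⟶ N} (H : Htpy f g) (r : R) {i : ℤ} (m : M.X (i + 1)) :
    H.h i (M.act r (i + 1) m) = N.act r i (H.h i m) := by
  rw [act_def, H.h_smul _ (zero_add i), sgn_zero, one_zsmul]
  rfl

lemma act_tr (r : R) {i j : ℤ} (h : i = j) (m : M.X i) :
    M.act r j (M.tr h m) = M.tr h (M.act r i m) := by subst h; rfl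

/-- The degree `i` part of the submodule `rM`. -/
def im (M : Mod B) (r : R) (i : ℤ) : AddSubgroup (M.X i) := (M.act r i).range

lemma mem_im (r : R) {i : ℤ} (m : M.X i) : m ∈ M.im r i ↔ ∃ m', M.act r i m' = m := Iff.rfl

lemma act_mem_im (r : R) {i : ℤ} (m : M.X i) : M.act r i m ∈ M.im r i := ⟨m, rfl⟩

lemma d_mem_im {r : R} {i : ℤ} {m : M.X i} (h : m ∈ M.im r i) : M.d i m ∈ M.im r (i + 1) := by
  obtain ⟨m, rfl⟩ := h; exact ⟨M.d i m, (d_act r m).symm⟩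

lemma f_mem_im (f : M ⟶ N) {r : R} {i : ℤ} {m : M.X i} (h : m ∈ M.im r i) :
    f.f i m ∈ N.im r i := by
  obtain ⟨m, rfl⟩ := h; exact ⟨f.f i m, (f_act f r m).symm⟩

lemma smul_mem_im {r : R} {i j k : ℤ} (h : i + j = k) (b : B.X i) {m : M.X j} (hm : m ∈ M.im r j) :
    M.smul h b m ∈ M.im r k := by
  obtain ⟨m, rfl⟩ := hm; exact ⟨_, (smul_act r h b m).symm⟩

lemma Htpy.h_mem_im {f g : M ⟶ N} (H : Htpy f g) {r : R} {i : ℤ} {m : M.X (i + 1)}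
    (hm : m ∈ M.im r (i + 1)) : H.h i m ∈ N.im r i := by
  obtain ⟨m, rfl⟩ := hm; exact ⟨_, (H.h_act r m).symm⟩

lemma im_anti (t : R) {p q : ℕ} (h : p ≤ q) (i : ℤ) : M.im (t ^ q) i ≤ M.im (t ^ p) i := by
  rintro _ ⟨m, rfl⟩
  exact ⟨M.act (t ^ (q - p)) i m, by rw [← act_mul, ← pow_add, Nat.add_sub_cancel' h]⟩

/-- The graded piece `Gr_t^p(M) = t^p M / t^{p+1} M`, with the map induced by `d`, is acyclic:
every `x ∈ t^p M` with `d x ∈ t^{p+1} M` is congruent modulo `t^{p+1} M` to `d y` for some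
`y ∈ t^p M`. -/
def GrAcyclic (t : R) (M : Mod B) (p : ℕ) : Prop :=
  ∀ (i : ℤ), ∀ x ∈ M.im (t ^ p) (i + 1), M.d (i + 1) x ∈ M.im (t ^ (p + 1)) (i + 1 + 1) →
    ∃ y ∈ M.im (t ^ p) i, x - M.d i y ∈ M.im (t ^ (p + 1)) (i + 1)

/-- The graded pieces `Gr_t^p(M)` are acyclic for all `p < N`. For a module over a deformation
over `k[t]/(t^{n+1})`, being `n`-acyclic is the case `N = n + 1`. -/
def IsNAcyclic (t : R) (N : ℕ) (M : Mod B) : Prop := ∀ p < N, GrAcyclic t M p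

/-- A dg module is acyclic if its cohomology vanishes. -/
def IsAcyclic (M : Mod B) : Prop := ∀ (i : ℤ) (x : M.X (i + 1)), M.d (i + 1) x = 0 →
  ∃ y, M.d i y = x

lemma mem_im_zero {i : ℤ} (m : M.X i) : m ∈ M.im 0 i ↔ m = 0 :=
  ⟨by rintro ⟨m, rfl⟩; exact act_zero m, by rintro rfl; exact zero_mem _⟩

/-- Acyclicity is the case `t = 0`, `N = 1` of the acyclicity of graded pieces. -/
lemma isNAcyclic_zero_one_iff (M : Mod B) : IsNAcyclic (0 : R) 1 M ↔ IsAcyclic M := by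
  constructor
  · intro h i x hx
    obtain ⟨y, _, hy⟩ := h 0 one_pos i x (by rw [pow_zero]; exact ⟨x, act_one x⟩)
      (by rw [hx]; exact zero_mem _)
    rw [zero_add, pow_one, mem_im_zero, sub_eq_zero] at hy
    exact ⟨y, hy.symm⟩
  · intro h p hp i x _ hx
    obtain rfl : p = 0 := by omega
    rw [zero_add, pow_one, mem_im_zero] at hx
    obtain ⟨y, rfl⟩ := h i x hx
    exact ⟨y, by rw [pow_zero]; exact ⟨y, act_one y⟩, by rw [sub_self]; exact zero_mem _⟩

lemma isNAcyclic_zeroMod (t : R) (n : ℕ) : IsNAcyclic t n (zeroMod B) := fun _ _ _ _ _ _ =>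
  ⟨0, zero_mem _, ⟨0, rfl⟩⟩

lemma IsNAcyclic.of_homotopic {t : R} {n : ℕ} (hM : IsNAcyclic t n M) (u : N ⟶ M) (v : M ⟶ N)
    (H : homotopic B (u ≫ v) (𝟙 N)) : IsNAcyclic t n N := by
  obtain ⟨H⟩ := H
  intro p hp i x hx hdx
  obtain ⟨y, hy, hxy⟩ := hM p hp i (u.f _ x) (f_mem_im u hx) (by
    rw [← f_d]; exact f_mem_im u hdx)
  refine ⟨v.f _ y - H.h _ x, sub_mem (f_mem_im v hy) (H.h_mem_im hx), ?_⟩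
  have e : x - N.d i (v.f i y - H.h i x) =
      v.f _ (u.f _ x - M.d i y) - H.h _ (N.d _ x) := by
    have := H.comm i x
    simp only [comp_f, id_f] at this
    rw [sub_eq_iff_eq_add] at this
    simp only [map_sub, f_d, this]
    abel
  rw [e]
  exact sub_mem (f_mem_im v hxy) (H.h_mem_im hdx)

lemma shift_im (a : ℤ) (r : R) (i : ℤ) : (M⟦a⟧).im r i = M.im r (i + a) := by
  have h : (M⟦a⟧).act r i = M.act r (i + a) := by
    ext m
    have e : sgn (a * 0) • M.act r (i + a) m = M.act r (i + a) m := by simp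
    exact e
  unfold im
  rw [h]
  rfl

lemma tr_mem_im {r : R} {i j : ℤ} (h : i = j) {m : M.X i} (hm : m ∈ M.im r i) :
    M.tr h m ∈ M.im r j := by subst h; exact hm

lemma IsNAcyclic.shift {t : R} {n : ℕ} (hM : IsNAcyclic t n M) (a : ℤ) :
    IsNAcyclic t n (M⟦a⟧) := by
  intro p hp i x hx hdx
  rw [shift_im] at hx hdx
  change M.X (i + 1 + a) at x
  have hdx' : M.d _ x ∈ M.im (t ^ (p + 1)) (i + 1 + a + 1) := by
    have h₁ := AddSubgroup.zsmul_mem _ (tr_mem_im (show i + 1 + 1 + a = i + 1 + a + 1 by omega) hdx)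
      (sgn a)
    have h₂ : sgn a • M.tr (show i + 1 + 1 + a = i + 1 + a + 1 by omega)
        (sgn a • M.tr (show i + 1 + a + 1 = i + 1 + 1 + a by omega) (M.d _ x)) = M.d _ x := by
      rw [map_zsmul, smul_smul, sgn_sq, one_zsmul, tr_tr, tr_rfl]
    exact h₂ ▸ h₁
  obtain ⟨y, hy, hxy⟩ := hM p hp (i + a) (M.tr (by omega) x) (tr_mem_im _ hx)
    (by rw [d_tr]; exact tr_mem_im _ hdx')
  refine ⟨sgn a • y, ?_, ?_⟩
  · rw [shift_im]; exact AddSubgroup.zsmul_mem _ hy _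
  · rw [shift_im]
    change x - sgn a • M.tr _ (M.d _ (sgn a • y)) ∈ _
    have := tr_mem_im (show i + a + 1 = i + 1 + a by omega) hxy
    rw [map_sub, tr_tr, tr_rfl] at this
    rwa [map_zsmul, map_zsmul, smul_smul, sgn_sq, one_zsmul]

lemma mem_cone_im (f : M ⟶ N) (r : R) {i : ℤ} (x : N.X i) (y : M.X (i + 1)) :
    ((x, y) : N.X i × M.X (i + 1)) ∈ (cone f).im r i ↔ x ∈ N.im r i ∧ y ∈ M.im r (i + 1) := by
  have h : ∀ (x : N.X i) (y : M.X (i + 1)), (cone f).act r i ((x, y) : N.X i × M.X (i + 1)) =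
      ((N.act r i x, M.act r (i + 1) y) : N.X i × M.X (i + 1)) := by
    intro x y
    refine cone_ext rfl ?_
    change sgn 0 • M.act r (i + 1) y = _
    simp
  constructor
  · rintro ⟨⟨x', y'⟩, e⟩
    rw [h] at e
    exact ⟨⟨x', congrArg Prod.fst e⟩, ⟨y', congrArg Prod.snd e⟩⟩
  · rintro ⟨⟨x, rfl⟩, ⟨y, rfl⟩⟩
    exact ⟨((x, y) : N.X i × M.X (i + 1)), h x y⟩

lemma IsNAcyclic.cone {t : R} {n : ℕ} (hM : IsNAcyclic t n M) (hN : IsNAcyclic t n N)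
    (f : M ⟶ N) : IsNAcyclic t n (cone f) := by
  rintro p hp i ⟨x, m⟩ hx hdx
  replace hdx : ((N.d (i + 1) x + f.f _ m, -M.d _ m) : N.X (i + 1 + 1) × M.X (i + 1 + 1 + 1)) ∈
    (Mod.cone f).im (t ^ (p + 1)) (i + 1 + 1) := hdx
  replace hx := (mem_cone_im _ _ _ _).1 hx
  replace hdx := (mem_cone_im _ _ _ _).1 hdx
  obtain ⟨m', hm', hmm⟩ := hM p hp (i + 1) m hx.2 (neg_mem_iff.1 hdx.2)
  obtain ⟨x', hx', hxx⟩ := hN p hp i (x + f.f _ m') (add_mem hx.1 (f_mem_im f hm')) (by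
    have e : N.d _ (x + f.f _ m') = (N.d (i + 1) x + f.f _ m) - f.f _ (m - M.d _ m') := by
      simp only [map_add, map_sub, f_d]; abel
    rw [e]
    exact sub_mem hdx.1 (f_mem_im f hmm))
  refine ⟨((x', -m') : N.X i × M.X (i + 1)), (mem_cone_im _ _ _ _).2 ⟨hx', neg_mem hm'⟩, ?_⟩
  change ((x - (N.d i x' + f.f _ (-m')), m - -M.d _ (-m')) : N.X (i + 1) × M.X (i + 1 + 1)) ∈ _
  refine (mem_cone_im _ _ _ _).2 ⟨?_, ?_⟩
  · have e : x - (N.d i x' + f.f _ (-m')) = x + f.f _ m' - N.d i x' := by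
      simp only [map_neg]; abel
    rw [e]; exact hxx
  · simpa using hmm

end Mod

/-! ### Derived categories -/

section Derived

variable {R : Type u} [CommRing R]

/-- The full subcategory of the homotopy category on the modules whose graded pieces
`Gr_t^p`, `p < N`, are acyclic. -/
def acyclics (B : CDGAlgebra R) (t : R) (N : ℕ) : ObjectProperty (Hot B) :=
  fun M => Mod.IsNAcyclic t N M.as

variable {B : CDGAlgebra R} {t : R} {N : ℕ}

instance : (acyclics B t N).IsClosedUnderIsomorphisms where
  of_iso := by
    rintro ⟨M⟩ ⟨M'⟩ e h
    obtain ⟨u, hu⟩ := (Hot.Q B).map_surjective (X := M') (Y := M) e.inv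
    obtain ⟨v, hv⟩ := (Hot.Q B).map_surjective (X := M) (Y := M') e.hom
    refine Mod.IsNAcyclic.of_homotopic (M := M) h u v ?_
    rw [← Hot.map_eq_iff, Functor.map_comp, hu, hv]
    exact e.inv_hom_id

instance : (acyclics B t N).IsTriangulatedClosed₃ := .mk' (by
  rintro T ⟨M, M', f, ⟨e⟩⟩ h₁ h₂
  refine (acyclics B t N).prop_of_iso (Triangle.π₃.mapIso e).symm ?_
  exact Mod.IsNAcyclic.cone ((acyclics B t N).prop_of_iso (Triangle.π₁.mapIso e) h₁)
    ((acyclics B t N).prop_of_iso (Triangle.π₂.mapIso e) h₂) f)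

instance : (acyclics B t N).IsStableUnderShift ℤ where
  isStableUnderShiftBy a := ⟨by
    rintro ⟨M⟩ h
    exact (acyclics B t N).prop_of_iso (((Hot.Q B).commShiftIso a).app M)
      (Mod.IsNAcyclic.shift (M := M) h a)⟩

instance : (acyclics B t N).IsTriangulatedClosed₂ := .of_isTriangulatedClosed₃

instance : (acyclics B t N).IsTriangulated where
  exists_zero := ⟨(Hot.Q B).obj (Mod.zeroMod B),
    (Hot.Q B).map_isZero Mod.isZero_zeroMod, Mod.isNAcyclic_zeroMod t N⟩

/-- The Verdier quotient of `Hot(B)` by the modules whose graded pieces `Gr_t^p`, `p < N`, are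
acyclic. It is obtained by inverting the morphisms with cone in that subcategory. -/
abbrev Der (B : CDGAlgebra R) (t : R) (N : ℕ) := (acyclics B t N).trW.Localization

/-- The projection from modules to the derived category. -/
def toDer (B : CDGAlgebra R) (t : R) (N : ℕ) : Mod B ⥤ Der B t N :=
  Hot.Q B ⋙ (acyclics B t N).trW.Q


end Derived
/-! ### Induced functors -/

section Functors

variable {R R' : Type u} [CommRing R] [CommRing R'] {B : CDGAlgebra R} {B' : CDGAlgebra R'}
  {t : R} {t' : R'} {N N' : ℕ}

lemma trW_map_iff {M M' : Mod B} (f : M ⟶ M') :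
    (acyclics B t N).trW ((Hot.Q B).map f) ↔ Mod.IsNAcyclic t N (Mod.cone f) :=
  (acyclics B t N).trW_iff_of_distinguished _ (Hot.std_dist f)

/-- The functor on homotopy categories induced by a functor preserving homotopies. -/
def hotMap (F : Mod B ⥤ Mod B')
    (hF : ∀ (M M' : Mod B) (f g : M ⟶ M'), Mod.homotopic B f g →
      Mod.homotopic B' (F.map f) (F.map g)) : Hot B ⥤ Hot B' :=
  CategoryTheory.Quotient.lift _ (F ⋙ Hot.Q B') (fun M M' f g h => (Hot.map_eq_iff _ _).2 (hF M M' f g h))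

/-- The functor on derived categories induced by a functor preserving homotopies and morphisms
with acyclic cone. -/
def derMap (F : Mod B ⥤ Mod B')
    (hF : ∀ (M M' : Mod B) (f g : M ⟶ M'), Mod.homotopic B f g →
      Mod.homotopic B' (F.map f) (F.map g))
    (hc : ∀ (M M' : Mod B) (f : M ⟶ M'), Mod.IsNAcyclic t N (Mod.cone f) →
      Mod.IsNAcyclic t' N' (Mod.cone (F.map f))) : Der B t N ⥤ Der B' t' N' :=
  Localization.lift (hotMap F hF ⋙ (acyclics B' t' N').trW.Q) (by
    rintro ⟨M⟩ ⟨M'⟩ f hf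
    obtain ⟨f, rfl⟩ := (Hot.Q B).map_surjective (X := M) (Y := M') f
    exact Localization.inverts (acyclics B' t' N').trW.Q (acyclics B' t' N').trW _
      ((trW_map_iff (F.map f)).2 (hc M M' f ((trW_map_iff f).1 hf)))) (acyclics B t N).trW.Q

end Functors

namespace Mod

/-! ### Submodules, quotients, restriction and descent of scalars -/

section Sub

variable {R : Type u} [CommRing R] {B : CDGAlgebra R}

/-- A graded submodule closed under the differential, as a cdg module. -/
def sub (M : Mod B) (S : ∀ i, AddSubgroup (M.X i))
    (hs : ∀ {i j k : ℤ} (h : i + j = k) (b : B.X i) {m : M.X j}, m ∈ S j → M.smul h b m ∈ S k)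
    (hd : ∀ {i : ℤ} {m : M.X i}, m ∈ S i → M.d i m ∈ S (i + 1)) : Mod B where
  X i := S i
  smul h b m := ⟨M.smul h b m, hs h b m.2⟩
  smul_add h b m m' := Subtype.ext (M.smul_add h b m m')
  add_smul h b b' m := Subtype.ext (M.add_smul h b b' m)
  one_smul m := Subtype.ext (M.one_smul m.1)
  mul_smul h₁ h₂ h₃ h₄ a b m := Subtype.ext (M.mul_smul h₁ h₂ h₃ h₄ a b m)
  d i := ((M.d i).comp (S i).subtype).codRestrict (S (i + 1)) (fun m => hd m.2)
  leibniz h h₁ h₂ b m := Subtype.ext (M.leibniz h h₁ h₂ b m)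
  d_d h m := Subtype.ext (M.d_d h m.1)

/-- The quotient by a graded submodule closed under the differential, as a cdg module. -/
def quo (M : Mod B) (S : ∀ i, AddSubgroup (M.X i))
    (hs : ∀ {i j k : ℤ} (h : i + j = k) (b : B.X i) {m : M.X j}, m ∈ S j → M.smul h b m ∈ S k)
    (hd : ∀ {i : ℤ} {m : M.X i}, m ∈ S i → M.d i m ∈ S (i + 1)) : Mod B where
  X i := M.X i ⧸ S i
  smul {i j k} h b := QuotientAddGroup.map (S j) (S k) (M.smulHom h b) (fun _ hm => hs h b hm)
  smul_add h b m m' := map_add _ m m'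
  add_smul h b b' m := by
    obtain ⟨m, rfl⟩ := QuotientAddGroup.mk_surjective m
    exact congrArg QuotientAddGroup.mk (M.add_smul h b b' m)
  one_smul m := by
    obtain ⟨m, rfl⟩ := QuotientAddGroup.mk_surjective m
    exact congrArg QuotientAddGroup.mk (M.one_smul m)
  mul_smul h₁ h₂ h₃ h₄ a b m := by
    obtain ⟨m, rfl⟩ := QuotientAddGroup.mk_surjective m
    exact congrArg QuotientAddGroup.mk (M.mul_smul h₁ h₂ h₃ h₄ a b m)
  d i := QuotientAddGroup.map (S i) (S (i + 1)) (M.d i) (fun _ hm => hd hm)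
  leibniz h h₁ h₂ b m := by
    obtain ⟨m, rfl⟩ := QuotientAddGroup.mk_surjective m
    exact congrArg QuotientAddGroup.mk (M.leibniz h h₁ h₂ b m)
  d_d h m := by
    obtain ⟨m, rfl⟩ := QuotientAddGroup.mk_surjective m
    exact congrArg QuotientAddGroup.mk (M.d_d h m)

/-- The image `rM` of the action of `r`. -/
def image (M : Mod B) (r : R) : Mod B := M.sub (M.im r) smul_mem_im d_mem_im

/-- The kernel of the action of `r`. -/
def kernel (M : Mod B) (r : R) : Mod B :=
  M.sub (fun i => (M.act r i).ker)
    (fun h b m hm => by rw [AddMonoidHom.mem_ker] at *; rw [← smul_act, hm, smul_zero])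
    (fun {i m} hm => by rw [AddMonoidHom.mem_ker] at *; rw [← d_act, hm, map_zero])

/-- The cokernel `M / rM` of the action of `r`. -/
def coker (M : Mod B) (r : R) : Mod B := M.quo (M.im r) smul_mem_im d_mem_im

/-- The projection `M ⟶ M / rM`. -/
def toCoker (M : Mod B) (r : R) : M ⟶ M.coker r where
  f i := QuotientAddGroup.mk' (M.im r i)
  map_smul _ _ _ := rfl
  comm _ := rfl

/-- The functor `M ↦ rM`. -/
def imageF (B : CDGAlgebra R) (r : R) : Mod B ⥤ Mod B where
  obj M := M.image r
  map {M N} f :=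
    { f := fun i => ((f.f i).comp (M.im r i).subtype).codRestrict (N.im r i)
        (fun m => f_mem_im f m.2)
      map_smul := fun h b m => Subtype.ext (f_smul f h b m.1)
      comm := fun m => Subtype.ext (f_d f m.1) }
  map_id _ := rfl
  map_comp _ _ := rfl

/-- The functor sending `M` to the kernel of `r` on `M`. -/
def kernelF (B : CDGAlgebra R) (r : R) : Mod B ⥤ Mod B where
  obj M := M.kernel r
  map {M N} f :=
    { f := fun i => ((f.f i).comp (M.act r i).ker.subtype).codRestrict (N.act r i).ker
        (fun m => by
          have h : M.act r i m.1 = 0 := m.2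
          change N.act r i (f.f i m.1) = 0
          rw [← f_act, h, map_zero])
      map_smul := fun h b m => Subtype.ext (f_smul f h b m.1)
      comm := fun m => Subtype.ext (f_d f m.1) }
  map_id _ := rfl
  map_comp _ _ := rfl

/-- The functor `M ↦ M / rM`. -/
def cokerF (B : CDGAlgebra R) (r : R) : Mod B ⥤ Mod B where
  obj M := M.coker r
  map {M N} f :=
    { f := fun i => QuotientAddGroup.map (M.im r i) (N.im r i) (f.f i) (fun _ h => f_mem_im f h)
      map_smul := fun h b m => by
        obtain ⟨m, rfl⟩ := QuotientAddGroup.mk_surjective m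
        exact congrArg QuotientAddGroup.mk (f_smul f h b m)
      comm := fun m => by
        obtain ⟨m, rfl⟩ := QuotientAddGroup.mk_surjective m
        exact congrArg QuotientAddGroup.mk (f_d f m) }
  map_id M := by
    ext i m
    obtain ⟨m, rfl⟩ := QuotientAddGroup.mk_surjective m
    rfl
  map_comp f g := by
    ext i m
    obtain ⟨m, rfl⟩ := QuotientAddGroup.mk_surjective m
    rfl

end Sub

section Scalars

variable {R R' : Type u} [CommRing R] [CommRing R'] {B : CDGAlgebra R} {B' : CDGAlgebra R'}

/-- Restriction of scalars along a morphism of cdg algebras. -/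
def res (φ : AlgHom B B') : Mod B' ⥤ Mod B where
  obj M :=
    { X := M.X
      smul := fun h b m => M.smul h (φ.f _ b) m
      smul_add := fun h b m m' => M.smul_add h _ m m'
      add_smul := fun h b b' m => by rw [map_add, M.add_smul]
      one_smul := fun m => by rw [φ.map_one, M.one_smul]
      mul_smul := fun h₁ h₂ h₃ h₄ a b m => by rw [φ.map_mul, M.mul_smul h₁ h₂ h₃ h₄]
      d := M.d
      leibniz := fun h h₁ h₂ b m => by rw [M.leibniz h h₁ h₂, φ.map_d]
      d_d := fun h m => by rw [M.d_d h, φ.map_curv] }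
  map f := ⟨f.f, fun h b m => f.map_smul h _ m, fun m => f.comm m⟩
  map_id _ := rfl
  map_comp _ _ := rfl

/-- `φ` is degreewise surjective, and its kernel annihilates `M`. -/
structure Descends (φ : AlgHom B B') (M : Mod B) : Prop where
  surj : ∀ i, Function.Surjective (φ.f i)
  ker : ∀ {i j k : ℤ} (h : i + j = k) (b : B.X i) (m : M.X j), φ.f i b = 0 → M.smul h b m = 0

lemma Descends.congr {φ : AlgHom B B'} {M : Mod B} (H : Descends φ M) {i j k : ℤ} (h : i + j = k)
    {b b' : B.X i} (hb : φ.f i b = φ.f i b') (m : M.X j) : M.smul h b m = M.smul h b' m := by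
  rw [← sub_eq_zero, ← M.sub_smul]
  exact H.ker h _ m (by rw [map_sub, hb, sub_self])

/-- The module structure over the target of a surjection whose kernel annihilates `M`: the element
`φ b` acts as `b`. -/
def descend (φ : AlgHom B B') (M : Mod B) (H : Descends φ M) : Mod B' where
  X := M.X
  smul {i _ _} h b m := M.smul h (Function.surjInv (H.surj i) b) m
  smul_add h b m m' := M.smul_add h _ m m'
  add_smul h b b' m := by
    rw [← M.add_smul]
    exact H.congr h (by rw [map_add, Function.surjInv_eq (H.surj _), Function.surjInv_eq (H.surj _),
      Function.surjInv_eq (H.surj _)]) m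
  one_smul m := (H.congr _ (by rw [Function.surjInv_eq (H.surj _), φ.map_one]) m).trans (M.one_smul m)
  mul_smul h₁ h₂ h₃ h₄ a b m := by
    rw [← M.mul_smul h₁ h₂ h₃ h₄]
    exact H.congr _ (by simp only [φ.map_mul, Function.surjInv_eq]) m
  d := M.d
  leibniz h h₁ h₂ b m := by
    rw [M.leibniz h h₁ h₂]
    congr 1
    exact H.congr _ (by simp only [φ.map_d, Function.surjInv_eq]) m
  d_d h m := by
    rw [M.d_d h]
    exact H.congr _ (by simp only [φ.map_curv, Function.surjInv_eq]) m

lemma descend_smul (φ : AlgHom B B') (M : Mod B) (H : Descends φ M) {i j k : ℤ} (h : i + j = k)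
    (b : B.X i) (m : M.X j) : (descend φ M H).smul h (φ.f i b) m = M.smul h b m :=
  H.congr h (Function.surjInv_eq _ _) m

/-- Descent of scalars for a functor with values in modules annihilated by the kernel. -/
def descendF {C : Type*} [Category* C] (φ : AlgHom B B') (F : C ⥤ Mod B)
    (H : ∀ M, Descends φ (F.obj M)) : C ⥤ Mod B' where
  obj M := descend φ (F.obj M) (H M)
  map f := ⟨(F.map f).f, fun h b m => f_smul (F.map f) h _ m, fun m => f_d (F.map f) m⟩
  map_id M := by
    ext i m
    change Hom.f (F.map (𝟙 M)) i m = m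
    rw [F.map_id]
    rfl
  map_comp f g := by
    ext i m
    change Hom.f (F.map (f ≫ g)) i m = Hom.f (F.map g) i (Hom.f (F.map f) i m)
    rw [F.map_comp]
    rfl

end Scalars

section Quot

variable {R : Type u} [CommRing R] {B : CDGAlgebra R}

lemma descends_proj {r : R} {M : Mod B} (h : ∀ i (m : M.X i), M.act r i m = 0) :
    Descends (B.proj r) M where
  surj i := Submodule.mkQ_surjective _
  ker {i j k} e b m hb := by
    obtain ⟨b, rfl⟩ := (Submodule.Quotient.mk_eq_zero _).1 hb
    exact (smul_smul_eq_act r e b m).trans (h _ _)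

/-- The functor `Ker r` from `B`-modules to `B/rB`-modules. -/
def kerF (B : CDGAlgebra R) (r : R) : Mod B ⥤ Mod (B.quot r) :=
  descendF (B.proj r) (kernelF B r) (fun _ => descends_proj (fun _ m => Subtype.ext m.2))

/-- The functor `Coker r : M ↦ M / rM` from `B`-modules to `B/rB`-modules. -/
def cokF (B : CDGAlgebra R) (r : R) : Mod B ⥤ Mod (B.quot r) :=
  descendF (B.proj r) (cokerF B r) (fun M => descends_proj (fun i m => by
    obtain ⟨m, rfl⟩ := QuotientAddGroup.mk_surjective m
    exact (QuotientAddGroup.eq_zero_iff _).2 (act_mem_im r m)))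

end Quot

end Mod
/-! ### Deformations over `k[t]/(t^{n+1})` -/

section Deformation

open Polynomial TensorProduct

/-- The ring `R_n = k[t]/(t^{n+1})`. -/
abbrev Rn (k : Type u) [CommRing k] (n : ℕ) : Type u := AdjoinRoot (X ^ (n + 1) : k[X])

variable (k : Type u) [CommRing k] (n : ℕ)

/-- The class of `t` in `R_n`. -/
def tt : Rn k n := AdjoinRoot.root _

lemma tt_pow : tt k n ^ (n + 1) = 0 := by
  have h := AdjoinRoot.mk_self (f := (X ^ (n + 1) : k[X]))
  rwa [map_pow, AdjoinRoot.mk_X] at h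

/-- The augmentation `R_n → k`, `t ↦ 0`. -/
def eps : Rn k n →ₐ[k] k := AdjoinRoot.liftAlgHom _ (AlgHom.id k k) 0 (by simp)

lemma exact_tt_eps : Function.Exact (LinearMap.mulLeft k (tt k n)) (eps k n).toLinearMap := by
  intro r
  obtain ⟨p, rfl⟩ := AdjoinRoot.mk_surjective r
  have h : (eps k n).toLinearMap (AdjoinRoot.mk _ p) = p.coeff 0 := by
    change eval₂ _ 0 p = _
    rw [eval₂_at_zero]
    rfl
  rw [h, ← X_dvd_iff]
  constructor
  · rintro ⟨q, rfl⟩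
    exact ⟨AdjoinRoot.mk _ q, by rw [map_mul, AdjoinRoot.mk_X]; rfl⟩
  · rintro ⟨s, hs⟩
    obtain ⟨q, rfl⟩ := AdjoinRoot.mk_surjective s
    have hs' : AdjoinRoot.mk (X ^ (n + 1) : k[X]) (X * q) = AdjoinRoot.mk _ p := by
      rw [map_mul, AdjoinRoot.mk_X]; exact hs
    rw [AdjoinRoot.mk_eq_mk] at hs'
    have h₁ : X ∣ X * q - p := (dvd_pow_self X n.succ_ne_zero).trans hs'
    exact (dvd_sub_right (Dvd.intro q rfl)).1 h₁

lemma eps_surjective : Function.Surjective (eps k n).toLinearMap := fun a =>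
  ⟨algebraMap k _ a, (eps k n).commutes a⟩

/-- The exactness of `t^n, t : R_n → R_n`, split over `k`. -/
lemma exists_split : ∃ σ μ : Rn k n →ₗ[k] Rn k n, ∀ r, r = σ (tt k n * r) + tt k n ^ n * μ r := by
  have hX : (X ^ (n + 1) : k[X]).Monic := monic_X_pow _
  let m := AdjoinRoot.modByMonicHom hX
  let mk' : k[X] →ₗ[k] Rn k n := (AdjoinRoot.mkₐ (X ^ (n + 1) : k[X])).toLinearMap
  let dv : k[X] →ₗ[k] k[X] :=
    { toFun := divX, map_add' := fun _ _ => divX_add, map_smul' := fun a p => by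
        ext i; simp [coeff_divX] }
  refine ⟨mk' ∘ₗ dv ∘ₗ m, Algebra.linearMap k _ ∘ₗ lcoeff k n ∘ₗ m, fun r => ?_⟩
  rcases subsingleton_or_nontrivial k with hk | hk
  · have : Subsingleton (Rn k n) := (algebraMap k (Rn k n)).codomain_trivial
    exact Subsingleton.elim _ _
  have hr : AdjoinRoot.mk _ (m r) = r := AdjoinRoot.mk_leftInverse hX r
  obtain ⟨p, hp⟩ : ∃ p, p = m r := ⟨_, rfl⟩
  have hdeg : ∀ j, n < j → p.coeff j = 0 := by
    have : p.degree < ((n + 1 : ℕ) : WithBot ℕ) := by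
      obtain ⟨q, rfl⟩ := AdjoinRoot.mk_surjective r
      rw [hp]
      exact (degree_modByMonic_lt q hX).trans_eq (degree_X_pow (n + 1))
    exact fun j hj => (degree_lt_iff_coeff_zero _ _).1 this j hj
  have hm : m (tt k n * r) = X * (p - C (p.coeff n) * X ^ n) := by
    have e : tt k n * r = AdjoinRoot.mk _ (X * p) := by
      rw [map_mul, AdjoinRoot.mk_X, hp, hr]; rfl
    have e₂ : X * p = X * (p - C (p.coeff n) * X ^ n) + p.coeff n • X ^ (n + 1) := by
      rw [smul_eq_C_mul]; ring
    rw [e, AdjoinRoot.modByMonicHom_mk, e₂, add_modByMonic, smul_modByMonic,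
      modByMonic_self hX, smul_zero, add_zero, modByMonic_eq_self_iff hX, degree_X_pow,
      degree_lt_iff_coeff_zero]
    rintro (_ | j) hj
    · omega
    · rw [coeff_X_mul, coeff_sub, coeff_C_mul, coeff_X_pow]
      by_cases hjn : j = n
      · simp [hjn]
      · rw [hdeg j (by omega)]; simp [hjn]
  change r = AdjoinRoot.mk _ (divX (m (tt k n * r))) +
    tt k n ^ n * algebraMap k _ ((m r).coeff n)
  have hd : divX (m (tt k n * r)) = p - C (p.coeff n) * X ^ n := by
    rw [hm]; ext j; rw [coeff_divX, coeff_X_mul]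
  rw [hd, map_sub, map_mul, map_pow, AdjoinRoot.mk_X, hp, hr]
  change r = r - AdjoinRoot.of _ _ * tt k n ^ n + tt k n ^ n * AdjoinRoot.of _ _
  ring

variable {k} {n}

/-- A cdg deformation of the dg algebra `A` of order `n`: a cdg algebra structure over `R_n` on the
graded `R_n`-module `R_n ⊗ A`, whose reduction modulo `t` is the dg algebra `A`. -/
structure CDGDeformation (A : DGAlgebra k) (n : ℕ) where
  alg : CDGAlgebra (Rn k n)
  iso : ∀ i, alg.X i ≃ₗ[Rn k n] (Rn k n ⊗[k] A.X i)
  /-- The reduction modulo `t`. -/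
  red : AlgHom alg A.toCDGAlgebra
  red_eq : ∀ i (x : alg.X i), red.f i x =
    TensorProduct.lid k (A.X i) ((eps k n).toLinearMap.rTensor (A.X i) (iso i x))

namespace CDGDeformation

variable {A : DGAlgebra k} (An : CDGDeformation A n)

lemma red_surjective (i : ℤ) : Function.Surjective (An.red.f i) := by
  intro a
  obtain ⟨x, hx⟩ := LinearMap.rTensor_surjective (A.X i) (eps_surjective k n)
    ((TensorProduct.lid k (A.X i)).symm a)
  exact ⟨(An.iso i).symm x, by rw [An.red_eq, LinearEquiv.apply_symm_apply, hx,
    LinearEquiv.apply_symm_apply]⟩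

lemma rTensor_mulLeft (r : Rn k n) (M : Type u) [AddCommGroup M] [Module k M]
    (x : Rn k n ⊗[k] M) : (LinearMap.mulLeft k r).rTensor M x = r • x := by
  induction x with
  | zero => simp
  | add x y hx hy => rw [map_add, hx, hy, smul_add]
  | tmul s m => rfl

lemma exists_of_red_eq_zero {i : ℤ} (x : An.alg.X i) (hx : An.red.f i x = 0) :
    ∃ y, tt k n • y = x := by
  rw [An.red_eq, LinearEquiv.map_eq_zero_iff] at hx
  obtain ⟨y, hy⟩ := (rTensor_exact (A.X i) (exact_tt_eps k n) (eps_surjective k n) _).1 hx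
  rw [rTensor_mulLeft] at hy
  exact ⟨(An.iso i).symm y, by rw [← map_smul, hy, LinearEquiv.symm_apply_apply]⟩

lemma red_smul (i : ℤ) (x : An.alg.X i) : An.red.f i (tt k n • x) = 0 := by
  rw [An.red_eq, map_smul, ← rTensor_mulLeft, ← LinearMap.comp_apply, ← LinearMap.rTensor_comp]
  have h : (eps k n).toLinearMap ∘ₗ LinearMap.mulLeft k (tt k n) = 0 :=
    (exact_tt_eps k n).linearMap_comp_eq_zero
  rw [h]
  simp

/-- `Ker t = t^n A_n`. -/
lemma exists_of_smul_eq_zero {i : ℤ} (x : An.alg.X i) (hx : tt k n • x = 0) :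
    ∃ y, tt k n ^ n • y = x := by
  obtain ⟨σ, μ, h⟩ := exists_split k n
  have e : LinearMap.id = σ ∘ₗ LinearMap.mulLeft k (tt k n) +
      LinearMap.mulLeft k (tt k n ^ n) ∘ₗ μ := LinearMap.ext h
  have hx' : (LinearMap.mulLeft k (tt k n)).rTensor (A.X i) (An.iso i x) = 0 := by
    rw [rTensor_mulLeft, ← map_smul, hx, map_zero]
  have e' := congrArg (fun f => LinearMap.rTensor (A.X i) f (An.iso i x)) e
  simp only [LinearMap.rTensor_id, LinearMap.id_apply, LinearMap.rTensor_add, LinearMap.rTensor_comp,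
    LinearMap.add_apply, LinearMap.comp_apply, hx', map_zero, zero_add, rTensor_mulLeft] at e'
  exact ⟨(An.iso i).symm _, by rw [← map_smul, ← e', LinearEquiv.symm_apply_apply]⟩

end CDGDeformation

end Deformation
/-! ### The functors `ι_n` and `Im t^n` -/

namespace CDGDeformation

open CDG.Mod

variable {k : Type u} [CommRing k] {n : ℕ} {A : DGAlgebra k} (An : CDGDeformation A n)

/-- The truncation `A_{n-1} = A_n / t^n A_n`. Its base ring is still `R_n`, which plays no role for
its modules and their morphisms. For `n = 0` this is the zero algebra. -/
abbrev trunc : CDGAlgebra (Rn k n) := An.alg.quot (tt k n ^ n)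

/-- The `n`-derived category `D^n(A_n)`: the quotient of `Hot(A_n)` by the modules for which
`Gr_t^p` is acyclic for `p = 0, …, n`. -/
abbrev Dn := Der An.alg (tt k n) (n + 1)

/-- The `(n-1)`-derived category `D^{n-1}(A_{n-1})`: the quotient of `Hot(A_{n-1})` by the modules
for which `Gr_t^p` is acyclic for `p = 0, …, n - 1`. It is zero for `n = 0`. -/
abbrev DnPred := Der An.trunc (tt k n) n

end CDGDeformation

/-- The derived category `D(A)` of a dg algebra: the quotient of `Hot(A)` by the acyclic modules. -/
abbrev DA {k : Type u} [CommRing k] (A : DGAlgebra k) := Der A.toCDGAlgebra (0 : k) 1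

namespace CDGDeformation

open CDG.Mod

variable {k : Type u} [CommRing k] {n : ℕ} {A : DGAlgebra k} (An : CDGDeformation A n)

lemma res_isNAcyclic {R : Type u} [CommRing R] {B : CDGAlgebra R} {t : R} {m : ℕ}
    {M : Mod (B.quot (t ^ m))} (h : IsNAcyclic t m M) :
    IsNAcyclic t (m + 1) ((res (B.proj (t ^ m))).obj M) := by
  intro p hp
  rcases Nat.lt_succ_iff_lt_or_eq.1 hp with hp | rfl
  · exact h p hp
  · intro i x hx _
    obtain ⟨y, rfl⟩ := hx
    have h0 : (t ^ p) • (B.quot (t ^ p)).one = 0 :=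
      (Submodule.Quotient.mk_eq_zero _).2 ⟨B.one, rfl⟩
    have e : ((res (B.proj (t ^ p))).obj M).act (t ^ p) (i + 1) y = 0 := by
      exact (congrArg (fun b => M.smul (zero_add (i + 1)) b y) h0).trans (M.zero_smul _ _)
    exact ⟨0, zero_mem _, by rw [e, map_zero, sub_zero]; exact zero_mem _⟩

/-- The functor `ι_n : D^{n-1}(A_{n-1}) ⥤ D^n(A_n)` induced by restriction of scalars. -/
def iota : An.DnPred ⥤ An.Dn :=
  derMap (res (An.alg.proj (tt k n ^ n)))
    (fun _ _ _ _ ⟨H⟩ => ⟨⟨H.h, fun e e' _ m => H.h_smul e e' _ m, H.comm⟩⟩)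
    (fun _ _ _ h => res_isNAcyclic h)

lemma descends_image (M : Mod An.alg) : Descends An.red ((imageF An.alg (tt k n ^ n)).obj M) where
  surj := An.red_surjective
  ker h b m hb := by
    obtain ⟨b, rfl⟩ := An.exists_of_red_eq_zero b hb
    obtain ⟨_, m, rfl⟩ := m
    refine Subtype.ext ?_
    change M.smul h (tt k n • b) (M.act _ _ m) = 0
    rw [smul_smul_eq_act, smul_act, ← act_mul, ← pow_succ', tt_pow, act_zero]

/-- The functor `M ↦ t^n M` from `A_n`-modules to `A`-modules. -/
def imF : Mod An.alg ⥤ Mod A.toCDGAlgebra :=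
  descendF An.red (imageF An.alg (tt k n ^ n)) An.descends_image

lemma imF_isAcyclic_cone {M N : Mod An.alg} (f : M ⟶ N)
    (h : IsNAcyclic (tt k n) (n + 1) (cone f)) : IsAcyclic (cone (An.imF.map f)) := by
  rintro i ⟨⟨x, hx⟩, ⟨y, hy⟩⟩ hxy
  have h₁ : N.d (i + 1) x + f.f _ y = 0 := congrArg (fun z => (Prod.fst z).1) hxy
  have h₂ : -M.d _ y = 0 := congrArg (fun z => (Prod.snd z).1) hxy
  obtain ⟨⟨x', y'⟩, hz, hz'⟩ := h n n.lt_succ_self i ((x, y) : N.X (i + 1) × M.X (i + 1 + 1))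
    ((mem_cone_im _ _ _ _).2 ⟨hx, hy⟩) (by
      have e : (cone f).d (i + 1) ((x, y) : N.X (i + 1) × M.X (i + 1 + 1)) = 0 :=
        cone_ext h₁ h₂
      rw [e]
      exact zero_mem _)
  rw [tt_pow, mem_im_zero] at hz'
  replace hz' := sub_eq_zero.1 hz'
  replace hz := (mem_cone_im _ _ _ _).1 hz
  refine ⟨((⟨x', hz.1⟩, ⟨y', hz.2⟩) : (N.image (tt k n ^ n)).X i × (M.image (tt k n ^ n)).X (i + 1)),
    cone_ext (Subtype.ext ?_) (Subtype.ext ?_)⟩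
  · exact (congrArg Prod.fst hz').symm
  · exact (congrArg Prod.snd hz').symm

/-- The functor `Im t^n : D^n(A_n) ⥤ D(A)`, `M ↦ t^n M`. -/
def imT : An.Dn ⥤ DA A :=
  derMap An.imF
    (fun M N _ _ ⟨H⟩ => ⟨⟨fun i => ((H.h i).comp (M.im (tt k n ^ n) (i + 1)).subtype).codRestrict
        (N.im (tt k n ^ n) i) (fun m => H.h_mem_im m.2),
      fun e e' _ m => Subtype.ext (H.h_smul e e' _ m.1), fun i m => Subtype.ext (H.comm i m.1)⟩⟩)
    (fun _ _ f h => (isNAcyclic_zero_one_iff _).2 (An.imF_isAcyclic_cone f h))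

/-! ### The module `Γ_n` and the subcategory `T_n` -/

/-- Multiplication by `t`, as a map `A_{n-1} → A_n`. -/
def mulT (i : ℤ) : An.trunc.X i →+ An.alg.X i :=
  ((An.alg.ideal (tt k n ^ n) i).liftQ (LinearMap.lsmul _ _ (tt k n)) (by
    rintro _ ⟨x, rfl⟩
    change tt k n • (tt k n ^ n • x) = 0
    rw [smul_smul, ← pow_succ', tt_pow, zero_smul])).toAddMonoidHom

/-- The projection `A_n → A_{n-1}`. -/
abbrev pr (i : ℤ) : An.alg.X i →+ An.trunc.X i := (An.alg.proj (tt k n ^ n)).f i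

lemma mulT_pr {i : ℤ} (x : An.alg.X i) : An.mulT i (An.pr i x) = tt k n • x := rfl

/-- The curvature of a deformation is divisible by `t`. -/
lemma exists_curv_div : ∃ e : An.alg.X 2, tt k n • e = An.alg.curv :=
  An.exists_of_red_eq_zero _ (by rw [An.red.map_curv, A.curv_eq_zero])

lemma pr_d_curv_div (e : An.alg.X 2) (he : tt k n • e = An.alg.curv) :
    An.pr _ (An.alg.d 2 e) = 0 := by
  obtain ⟨y, hy⟩ := An.exists_of_smul_eq_zero (An.alg.d 2 e) (by
    rw [← map_smul, he, An.alg.d_curv])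
  exact (Submodule.Quotient.mk_eq_zero _).2 ⟨y, hy⟩

/-- The cdg module `Γ_n`: the graded module `A_n ⊕ A_{n-1}[1]` with the differential
`(α, a) ↦ (d α + t a, -d a + π(α (c/t)))`, where `c/t` is an element `e` with `t e = c`. -/
def gamma (e : An.alg.X 2) (he : tt k n • e = An.alg.curv) : Mod An.alg where
  X i := An.alg.X i × An.trunc.X (i + 1)
  smul {i j k} h b x := (An.alg.mul h b x.1, sgn i • An.trunc.mul (by omega) (An.pr i b) x.2)
  smul_add h b x y := by simp
  add_smul h b b' x := by simp
  one_smul x := by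
    refine Prod.ext (An.alg.one_mul _) ?_
    simp only [sgn_zero, one_zsmul]
    exact An.trunc.one_mul _
  mul_smul {i j l ij jl ijl} h₁ h₂ h₃ h₄ a b x := by
    subst h₁
    refine Prod.ext (An.alg.mul_assoc _ _ _ _ _ _ _) ?_
    simp only [AlgHom.map_mul]
    rw [An.trunc.mul_assoc rfl _ (show j + (l + 1) = jl + 1 by omega) (by omega), map_zsmul,
      smul_smul, sgn_add]
  d i := ((An.alg.d i).toAddMonoidHom.comp (AddMonoidHom.fst _ (An.trunc.X (i + 1))) +
      (An.mulT (i + 1)).comp (AddMonoidHom.snd (An.alg.X i) _)).prod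
    (-(An.trunc.d (i + 1)).toAddMonoidHom.comp (AddMonoidHom.snd (An.alg.X i) _) +
      ((An.pr (i + 1 + 1)).comp ((An.alg.mul (show i + 2 = i + 1 + 1 by omega)).flip
        e).toAddMonoidHom).comp (AddMonoidHom.fst _ (An.trunc.X (i + 1))))
  leibniz {i j l} h h₁ h₂ b x := by
    obtain ⟨α, a⟩ := x
    obtain ⟨a, rfl⟩ := Submodule.mkQ_surjective _ a
    refine Prod.ext ?_ ?_
    · change An.alg.d l (An.alg.mul h b α) + An.mulT _ (sgn i • An.pr _ (An.alg.mul _ b a)) =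
        An.alg.mul h₁ (An.alg.d i b) α +
          sgn i • An.alg.mul h₂ b (An.alg.d j α + An.mulT _ (An.pr _ a))
      rw [An.alg.leibniz h h₁ h₂]
      simp only [map_zsmul, mulT_pr, map_add, map_smul, _root_.smul_add]
      abel
    · change -An.trunc.d _ (sgn i • An.pr _ (An.alg.mul _ b a)) +
          An.pr _ (An.alg.mul _ (An.alg.mul h b α) e) =
        sgn (i + 1) • An.pr _ (An.alg.mul (show i + 1 + (j + 1) = l + 1 + 1 by omega)
          (An.alg.d i b) a) +
          sgn i • sgn i • An.trunc.mul (show i + (j + 1 + 1) = l + 1 + 1 by omega) (An.pr _ b)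
            (-An.pr _ (An.alg.d _ a) + An.pr _ (An.alg.mul _ α e))
      have h₃ : An.pr _ (An.alg.d (l + 1) (An.alg.mul (show i + (j + 1) = l + 1 by omega) b a)) =
          An.trunc.d _ (An.pr _ (An.alg.mul (show i + (j + 1) = l + 1 by omega) b a)) := rfl
      have h₄ : ∀ z, An.trunc.mul (show i + (j + 1 + 1) = l + 1 + 1 by omega) (An.pr _ b)
          (An.pr _ z) = An.pr _ (An.alg.mul (show i + (j + 1 + 1) = l + 1 + 1 by omega) b z) :=
        fun _ => rfl
      rw [map_zsmul, ← h₃, An.alg.leibniz _ (show i + 1 + (j + 1) = l + 1 + 1 by omega)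
        (show i + (j + 1 + 1) = l + 1 + 1 by omega), An.alg.mul_assoc h _
        (show j + 2 = j + 1 + 1 by omega) (show i + (j + 1 + 1) = l + 1 + 1 by omega),
        smul_smul, sgn_sq, one_zsmul, map_add, map_add (An.trunc.mul _ _), map_neg (An.trunc.mul _ _),
        h₄, h₄, map_zsmul, sgn_succ, _root_.smul_add, smul_smul, sgn_sq, one_zsmul]
      module
  d_d {i} h x := by
    obtain ⟨α, a⟩ := x
    obtain ⟨a, rfl⟩ := Submodule.mkQ_surjective _ a
    refine Prod.ext ?_ ?_
    · change An.alg.d _ (An.alg.d _ α + An.mulT _ (An.pr _ a)) +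
        An.mulT _ (-An.pr _ (An.alg.d _ a) + An.pr _ (An.alg.mul _ α e)) = An.alg.mul h An.alg.curv α
      rw [map_add (An.mulT _), map_neg]
      simp only [map_add, mulT_pr, map_smul]
      rw [An.alg.d_d h (show i + 2 = i + 1 + 1 by omega), ← he, map_smul (An.alg.mul _ α)]
      abel
    · change -An.trunc.d _ (-An.pr _ (An.alg.d _ a) + An.pr _ (An.alg.mul _ α e)) +
        An.pr _ (An.alg.mul _ (An.alg.d _ α + An.mulT _ (An.pr _ a)) e) =
        sgn 2 • An.pr _ (An.alg.mul (show 2 + (i + 1) = i + 1 + 1 + 1 by omega) An.alg.curv a)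
      have h₃ : ∀ {p : ℤ} (z : An.alg.X p), An.trunc.d _ (An.pr _ z) = An.pr _ (An.alg.d _ z) :=
        fun _ => rfl
      have h₄ : An.pr _ (An.alg.mul (show i + (2 + 1) = i + 1 + 1 + 1 by omega) α
          (An.alg.d 2 e)) = 0 := by
        change An.trunc.mul _ (An.pr _ α) (An.pr _ (An.alg.d 2 e)) = 0
        rw [An.pr_d_curv_div e he, map_zero]
      rw [map_add, map_neg, h₃, h₃, An.alg.d_d (show 2 + (i + 1) = i + 1 + 1 + 1 by omega)
        (show i + 1 + 2 = i + 1 + 1 + 1 by omega), An.alg.leibniz _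
        (show i + 1 + 2 = i + 1 + 1 + 1 by omega) (show i + (2 + 1) = i + 1 + 1 + 1 by omega),
        mulT_pr]
      simp only [map_add, map_sub, map_zsmul, h₄, LinearMap.add_apply, map_smul,
        LinearMap.smul_apply, sgn_two, one_zsmul, _root_.smul_zero, ← he]
      abel

/-- `G_n`, the cocone of the projection `Γ_n ⟶ Γ_n / t^n Γ_n`. -/
def G (e : An.alg.X 2) (he : tt k n • e = An.alg.curv) : Mod An.alg :=
  (cone ((An.gamma e he).toCoker (tt k n ^ n)))⟦(-1 : ℤ)⟧

/-- The subcategory `T_n` of `D^n(A_n)`: the modules `M` such that the `A_{n-1}`-module `M / t^n M`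
is `(n-1)`-acyclic. -/
def T : ObjectProperty An.Dn := fun X =>
  ∃ M : Mod An.alg, IsNAcyclic (tt k n) n ((cokF An.alg (tt k n ^ n)).obj M) ∧
    Nonempty ((toDer An.alg (tt k n) (n + 1)).obj M ≅ X)

end CDGDeformation

/-! ### Localizing subcategories and recollements -/

section Triangulated

/-- A localizing subcategory: a strictly full triangulated subcategory closed under small
coproducts. -/
structure IsLocalizing {C : Type*} [Category* C] [Preadditive C] [HasZeroObject C] [HasShift C ℤ]
    [∀ a : ℤ, (shiftFunctor C a).Additive] [Pretriangulated C] (P : ObjectProperty C) : Prop where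
  iso : P.IsClosedUnderIsomorphisms
  triangulated : P.IsTriangulated
  coproduct : ∀ J : Type u, P.IsClosedUnderColimitsOfShape (Discrete J)

/-- A recollement of `C` by `C'` and `C''` with given functors `i : C' ⥤ C` (usually written `i_*`)
and `j : C ⥤ C''` (usually written `j^*`). -/
structure Recollement {C' C C'' : Type*} [Category* C'] [Category* C] [Category* C'']
    [Preadditive C'] [HasZeroObject C'] [HasShift C' ℤ] [∀ a : ℤ, (shiftFunctor C' a).Additive]
    [Pretriangulated C'] [Preadditive C] [HasZeroObject C] [HasShift C ℤ]
    [∀ a : ℤ, (shiftFunctor C a).Additive] [Pretriangulated C] [Preadditive C'']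
    [HasZeroObject C''] [HasShift C'' ℤ] [∀ a : ℤ, (shiftFunctor C'' a).Additive]
    [Pretriangulated C''] (i : C' ⥤ C) (j : C ⥤ C'') where
  i_triangulated : ∃ _ : i.CommShift ℤ, i.IsTriangulated
  j_triangulated : ∃ _ : j.CommShift ℤ, j.IsTriangulated
  /-- the left adjoint `i^*` of `i` -/
  iL : C ⥤ C'
  /-- the right adjoint `i^!` of `i` -/
  iR : C ⥤ C'
  /-- the left adjoint `j_!` of `j` -/
  jL : C'' ⥤ C
  /-- the right adjoint `j_*` of `j` -/
  jR : C'' ⥤ C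
  adjIL : iL ⊣ i
  adjIR : i ⊣ iR
  adjJL : jL ⊣ j
  adjJR : j ⊣ jR
  i_full : i.Full
  i_faithful : i.Faithful
  jL_full : jL.Full
  jL_faithful : jL.Faithful
  jR_full : jR.Full
  jR_faithful : jR.Faithful
  isZero : ∀ X : C', IsZero (j.obj (i.obj X))
  /-- the triangle `j_! j^* X ⟶ X ⟶ i_* i^* X ⟶` -/
  triangleL : ∀ X : C, ∃ δ : i.obj (iL.obj X) ⟶ (jL.obj (j.obj X))⟦(1 : ℤ)⟧,
    Triangle.mk (adjJL.counit.app X) (adjIL.unit.app X) δ ∈ distTriang C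
  /-- the triangle `i_* i^! X ⟶ X ⟶ j_* j^* X ⟶` -/
  triangleR : ∀ X : C, ∃ δ : jR.obj (j.obj X) ⟶ (i.obj (iR.obj X))⟦(1 : ℤ)⟧,
    Triangle.mk (adjIR.counit.app X) (adjJR.unit.app X) δ ∈ distTriang C

end Triangulated

end CDG

end

/-! Everything rests on one module representing the cohomology of `t^n M`. Left multiplication on
`A_n` does not give a cdg module over itself, since `d^2` is the commutator with the curvature `c`.
The summand `A_{n-1}[1]` of `Γ_n` repairs this: the detour through it adds `t π(α c/t) = α c` and
cancels right multiplication by `c`. As `t^n` annihilates this summand, `t^n Γ_n` only sees `A_n`.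
Passing to the cone of `Γ_n → Γ_n/t^n Γ_n`, which is `G_n[1]`, makes `Gr^p` acyclic for `p < n` and
keeps `t^n Γ_n`, shifted. The outcome (`isRep_gammaCone`) is that morphisms `G_n[1] → M` up to
homotopy are the classes in `H^{-1}(t^n M)`. Moreover `t^n G_n[1]` is the free `A`-module on one
closed generator (`isRep_im`).

If `M` is `n`-acyclic, then `t^n M = Gr^n M` is acyclic, so `G_n[1]` is left orthogonal to the
`n`-acyclic modules. Its morphisms in `D^n(A_n)` are therefore those of the homotopy category, it is
small with respect to countable coproducts, and `Im t^n` is bijective on the morphisms out of it: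
both sides are `H^{-1}(t^n M)` (`bijective_imT`).

On the other side, `Coker t^n` and `Ker t^n` are adjoint to restriction of scalars already on
modules, and both descend to the derived categories. For `Coker` this holds because `M` and `M/t^n
M` have the same `Gr^p` for `p < n`. For `Ker` it is a correction argument using that `c` is
divisible by `t` (`IsNAcyclic.kerF`). Hence `ι_n` is fully faithful with both adjoints, and `T_n` is
the kernel of its left adjoint, so it is localizing. An object of `T_n` killed by `Im t^n` has all
its graded pieces acyclic and is zero. So `G_n[1]` detects the zero objects of `T_n`, just as `t^n
G_n[1]` does in `D(A)`.

A small object detecting the zero objects of a localizing subcategory generates it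
(`le_of_isLocalizing`): one kills the maps from shifts of the object again and again, and compares
the resulting telescope, which vanishes, with the constant one. Consequently `T_n` is generated by
`G_n`. Dévissage extends the bijectivity of `Im t^n` from `G_n[1]` to every source in `T_n`
(`bijective_of_T`), and shows that `T_n` maps onto all of `D(A)` up to isomorphism (`exists_T`).

The rest is formal and is the criterion of `RecollementCriterion`. Suppose `i` is fully faithful
with both adjoints, `F` kills its image, `F` is bijective on morphisms out of objects killed by the
left adjoint of `i`, and such objects hit everything up to isomorphism. Then `F` has both adjoints,
is the Verdier quotient by the image of `i`, and one gets a recollement. -/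

set_option linter.unusedSectionVars false

/-! ### A criterion for recollements -/

noncomputable section

namespace CDG

namespace RecollementCriterion

variable {C' C D : Type*} [Category* C'] [Category* C] [Category* D]
  [Preadditive C'] [HasZeroObject C'] [HasShift C' ℤ] [∀ a : ℤ, (shiftFunctor C' a).Additive]
  [Pretriangulated C'] [Preadditive C] [HasZeroObject C] [HasShift C ℤ]
  [∀ a : ℤ, (shiftFunctor C a).Additive] [Pretriangulated C] [Preadditive D]
  [HasZeroObject D] [HasShift D ℤ] [∀ a : ℤ, (shiftFunctor D a).Additive]
  [Pretriangulated D] {i : C' ⥤ C} {F : C ⥤ D} [i.CommShift ℤ] [i.IsTriangulated]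
  [F.CommShift ℤ] [F.IsTriangulated] [i.Full] [i.Faithful] {iL iR : C ⥤ C'}

/-- The first vertex of a triangle over the unit of a reflection is killed by the reflection. -/
lemma exists_triangle_unit (adjL : iL ⊣ i) (X : C) :
    ∃ (Z : C) (g : Z ⟶ X) (h : i.obj (iL.obj X) ⟶ Z⟦(1 : ℤ)⟧), IsZero (iL.obj Z) ∧
      Triangle.mk g (adjL.unit.app X) h ∈ distTriang C := by
  obtain ⟨Z, g, h, mem⟩ := distinguished_cocone_triangle₁ (adjL.unit.app X)
  let := adjL.leftAdjointCommShift ℤ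
  have := adjL.commShift_of_rightAdjoint ℤ
  have : iL.IsTriangulated := adjL.isTriangulated_leftAdjoint
  refine ⟨Z, g, h, ?_, mem⟩
  exact Triangle.isZero₁_of_isIso₂ _ (iL.map_distinguished _ mem)
    (inferInstanceAs (IsIso (iL.map (adjL.unit.app X))))

/-- The third vertex of a triangle over the counit of a coreflection is killed by the
coreflection. -/
lemma exists_triangle_counit (adjR : i ⊣ iR) (X : C) :
    ∃ (Z : C) (g : X ⟶ Z) (h : Z ⟶ (i.obj (iR.obj X))⟦(1 : ℤ)⟧), IsZero (iR.obj Z) ∧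
      Triangle.mk (adjR.counit.app X) g h ∈ distTriang C := by
  obtain ⟨Z, g, h, mem⟩ := distinguished_cocone_triangle (adjR.counit.app X)
  let := adjR.rightAdjointCommShift ℤ
  have := adjR.commShift_of_leftAdjoint ℤ
  have : iR.IsTriangulated := adjR.isTriangulated_rightAdjoint
  refine ⟨Z, g, h, ?_, mem⟩
  exact Triangle.isZero₃_of_isIso₁ _ (iR.map_distinguished _ mem)
    (inferInstanceAs (IsIso (iR.map (adjR.counit.app X))))

/-! ### The left adjoint of `F`, from objects killed by the left adjoint of `i`. -/

section

variable (hE : ∀ Z : D, ∃ X : C, IsZero (iL.obj X) ∧ Nonempty (F.obj X ≅ Z))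

/-- An object in the kernel of the reflection with prescribed image. -/
def lObj (Z : D) : C := (hE Z).choose

lemma isZero_lObj (Z : D) : IsZero (iL.obj (lObj hE Z)) := (hE Z).choose_spec.1

/-- The defining isomorphism of `lObj`. -/
def lIso (Z : D) : F.obj (lObj hE Z) ≅ Z := (hE Z).choose_spec.2.some

variable (hF : ∀ X Y : C, IsZero (iL.obj X) → Function.Bijective (F.map : (X ⟶ Y) → _))

/-- The bijection defining the left adjoint. -/
def lEquiv (Z : D) (Y : C) : (lObj hE Z ⟶ Y) ≃ (Z ⟶ F.obj Y) :=
  (Equiv.ofBijective _ (hF _ Y (isZero_lObj hE Z))).trans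
    ((lIso hE Z).homCongr (Iso.refl (F.obj Y)))

lemma lEquiv_apply (Z : D) (Y : C) (f : lObj hE Z ⟶ Y) :
    lEquiv hE hF Z Y f = (lIso hE Z).inv ≫ F.map f := by
  simp [lEquiv, Iso.homCongr]

/-- The left adjoint of `F`. -/
def jL : D ⥤ C := Adjunction.leftAdjointOfEquiv (G := F) (lEquiv hE hF) (by
  intro Z Y Y' g h
  simp [lEquiv_apply])

/-- The adjunction between `jL` and `F`. -/
def adjJL : jL hE hF ⊣ F := Adjunction.adjunctionOfEquivLeft _ _

/-- The unit corresponds to the identity of `lObj hE Z`, so it is the inverse of the chosen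
isomorphism `lIso hE Z`. This is what makes `jL` fully faithful. -/
instance (Z : D) : IsIso ((adjJL hE hF).unit.app Z) := by
  have : (adjJL hE hF).unit.app Z = (lIso hE Z).inv := by
    refine (Adjunction.adjunctionOfEquivLeft_unit_app _ _ Z).trans ?_
    refine (lEquiv_apply hE hF Z (lObj hE Z) (𝟙 _)).trans ?_
    rw [F.map_id]
    exact Category.comp_id _
  rw [this]
  exact inferInstanceAs (IsIso (lIso hE Z).inv)

instance : IsIso (adjJL hE hF).unit := NatIso.isIso_of_isIso_app _

lemma jL_full : (jL hE hF).Full := (adjJL hE hF).fullyFaithfulLOfIsIsoUnit.full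

lemma jL_faithful : (jL hE hF).Faithful := (adjJL hE hF).fullyFaithfulLOfIsIsoUnit.faithful

lemma isZero_jL (Z : D) : IsZero (iL.obj ((jL hE hF).obj Z)) := isZero_lObj hE Z

instance isIso_map_counit (X : C) : IsIso (F.map ((adjJL hE hF).counit.app X)) := by
  have h := (adjJL hE hF).right_triangle_components X
  exact IsIso.of_isIso_fac_left h

-- The inverse lifts along `F`, and injectivity on morphisms checks the two identities. It is
-- applied to the counit, which `F` always turns into an isomorphism.
include hF in
lemma isIso_of_isIso_map {X Y : C} (hX : IsZero (iL.obj X)) (hY : IsZero (iL.obj Y)) (f : X ⟶ Y)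
    [IsIso (F.map f)] : IsIso f := by
  obtain ⟨g, hg⟩ := (hF Y X hY).2 (inv (F.map f))
  refine ⟨g, (hF _ _ hX).1 ?_, (hF _ _ hY).1 ?_⟩
  · rw [F.map_comp, hg, IsIso.hom_inv_id, F.map_id]
  · rw [F.map_comp, hg, IsIso.inv_hom_id, F.map_id]

lemma isIso_counit {X : C} (hX : IsZero (iL.obj X)) : IsIso ((adjJL hE hF).counit.app X) :=
  isIso_of_isIso_map hF (isZero_jL hE hF _) hX _

variable (adjL : iL ⊣ i) (h0 : ∀ X : C', IsZero (F.obj (i.obj X)))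

-- The cocone `Z` of the unit is killed by `iL`, so `jL F Z ≅ Z`. Since `F` kills the image of `i`,
-- it turns `Z ⟶ X` into an isomorphism, and therefore `Z ≅ jL F X` compatibly with the maps to `X`.
include h0 in
lemma triangleL (X : C) : ∃ δ : i.obj (iL.obj X) ⟶ ((jL hE hF).obj (F.obj X))⟦(1 : ℤ)⟧,
    Triangle.mk ((adjJL hE hF).counit.app X) (adjL.unit.app X) δ ∈ distTriang C := by
  obtain ⟨Z, g, h, hZ, mem⟩ := exists_triangle_unit adjL X
  have := isIso_counit hE hF hZ
  have : IsIso (F.map g) :=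
    (Triangle.isZero₃_iff_isIso₁ _ (F.map_distinguished _ mem)).1 (h0 _)
  let e : (jL hE hF).obj (F.obj X) ≅ Z :=
    (asIso ((jL hE hF).map (F.map g))).symm ≪≫ asIso ((adjJL hE hF).counit.app Z)
  have he : e.hom ≫ g = (adjJL hE hF).counit.app X := by
    have := (adjJL hE hF).counit.naturality g
    simp only [Functor.comp_map, Functor.id_map] at this
    simp only [e, Iso.trans_hom, Iso.symm_hom, asIso_inv, asIso_hom, Category.assoc]
    rw [IsIso.inv_comp_eq]
    exact this.symm
  refine ⟨h ≫ e.inv⟦(1 : ℤ)⟧', isomorphic_distinguished _ mem _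
    (Triangle.isoMk _ _ e (Iso.refl _) (Iso.refl _) ?_ ?_ ?_)⟩
  · exact (Category.comp_id _).trans he.symm
  · exact (Category.comp_id _).trans (Category.id_comp _).symm
  · change (h ≫ e.inv⟦(1 : ℤ)⟧') ≫ e.hom⟦(1 : ℤ)⟧' = 𝟙 _ ≫ h
    rw [Category.assoc, ← Functor.map_comp, e.inv_hom_id, CategoryTheory.Functor.map_id]
    exact (Category.comp_id _).trans (Category.id_comp _).symm

include adjL hE hF h0 in
/-- `F` is bijective on morphisms to objects which are right orthogonal to the image of `i`. -/
lemma bijective_of_rightOrthogonal (X Y : C) (hY : ∀ (Z : C') (f : i.obj Z ⟶ Y), f = 0) :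
    Function.Bijective (F.map : (X ⟶ Y) → _) := by
  -- The cone of the counit `c` lies in the image of `i`. Seen from `Y` the counit is thus an
  -- isomorphism, and `X` may be replaced by `jL F X`, to which `hF` applies.
  obtain ⟨δ, mem⟩ := triangleL hE hF adjL h0 X
  have hX := isZero_jL hE hF (F.obj X)
  let c := (adjJL hE hF).counit.app X
  have h₁ : ∀ f : X ⟶ Y, c ≫ f = 0 → f = 0 := fun f hf => by
    obtain ⟨g, hg⟩ := Triangle.yoneda_exact₂ _ mem f hf
    exact hg.trans ((congrArg (adjL.unit.app X ≫ ·) (hY _ g)).trans comp_zero)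
  have : IsIso (F.map c) := isIso_map_counit hE hF X
  constructor
  · intro f g hfg
    rw [← sub_eq_zero]
    refine h₁ _ ((hF _ _ hX).1 ?_)
    rw [F.map_comp, F.map_sub, hfg, sub_self, comp_zero, F.map_zero]
  · intro φ
    obtain ⟨f, hf⟩ := (hF _ Y hX).2 (F.map c ≫ φ)
    -- The obstruction to extending `f` along `c` lives on a shift by `-1` of an object of the
    -- image, which is again in the image.
    have h₂ : ∀ (Z : C') (f : (i.obj Z)⟦(-1 : ℤ)⟧ ⟶ Y), f = 0 := fun Z f => by
      rw [← cancel_epi ((i.commShiftIso (-1 : ℤ)).hom.app Z), comp_zero]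
      exact hY _ _
    obtain ⟨g, hg⟩ := Triangle.yoneda_exact₂ _ (inv_rot_of_distTriang _ mem) f (h₂ _ _)
    refine ⟨g, ?_⟩
    rw [← cancel_epi (F.map c), ← hf, hg]
    exact (F.map_comp _ _).symm

/-! ### The right adjoint of `F`, from objects killed by the right adjoint of `i`. -/

variable (adjR : i ⊣ iR)

include adjR in
lemma rightOrthogonal_of_isZero {Y : C} (hY : IsZero (iR.obj Y)) (Z : C') (f : i.obj Z ⟶ Y) :
    f = 0 :=
  (adjR.homEquiv _ _).injective (hY.eq_of_tgt _ _)

-- Replacing `X` by the cone of the counit `i iR X ⟶ X` kills `iR` and leaves `F X` unchanged,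
-- because `F` vanishes on the image of `i`.
include adjR hE h0 in
lemma exists_rObj (Z : D) : ∃ X : C, IsZero (iR.obj X) ∧ Nonempty (F.obj X ≅ Z) := by
  obtain ⟨X, _, ⟨e⟩⟩ := hE Z
  obtain ⟨Y, g, h, hY, mem⟩ := exists_triangle_counit adjR X
  have : IsIso (F.map g) :=
    (Triangle.isZero₁_iff_isIso₂ _ (F.map_distinguished _ mem)).1 (h0 _)
  exact ⟨Y, hY, ⟨(asIso (F.map g)).symm ≪≫ e⟩⟩

/-- An object in the kernel of the coreflection with prescribed image. -/
def rObj (Z : D) : C := (exists_rObj hE h0 adjR Z).choose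

lemma isZero_rObj (Z : D) : IsZero (iR.obj (rObj hE h0 adjR Z)) :=
  (exists_rObj hE h0 adjR Z).choose_spec.1

/-- The defining isomorphism of `rObj`. -/
def rIso (Z : D) : F.obj (rObj hE h0 adjR Z) ≅ Z := (exists_rObj hE h0 adjR Z).choose_spec.2.some

include adjL hE hF h0 adjR in
lemma bijective_of_isZero (X Y : C) (hY : IsZero (iR.obj Y)) :
    Function.Bijective (F.map : (X ⟶ Y) → _) :=
  bijective_of_rightOrthogonal hE hF adjL h0 X Y (rightOrthogonal_of_isZero adjR hY)

/-- The bijection defining the right adjoint. -/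
def rEquiv (X : C) (Z : D) : (F.obj X ⟶ Z) ≃ (X ⟶ rObj hE h0 adjR Z) :=
  ((Iso.refl (F.obj X)).homCongr (rIso hE h0 adjR Z).symm).trans
    (Equiv.ofBijective _ (bijective_of_isZero hE hF adjL h0 adjR X _
      (isZero_rObj hE h0 adjR Z))).symm

lemma map_rEquiv (X : C) (Z : D) (f : F.obj X ⟶ Z) :
    F.map (rEquiv hE hF adjL h0 adjR X Z f) = f ≫ (rIso hE h0 adjR Z).inv := by
  refine (Equiv.ofBijective_apply_symm_apply (F.map : (X ⟶ rObj hE h0 adjR Z) → _)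
    (bijective_of_isZero hE hF adjL h0 adjR X _ (isZero_rObj hE h0 adjR Z)) _).trans ?_
  simp [Iso.homCongr]

/-- The right adjoint of `F`. -/
def jR : D ⥤ C := Adjunction.rightAdjointOfEquiv (F := F) (rEquiv hE hF adjL h0 adjR) (by
  intro X' X Y f g
  apply (bijective_of_isZero hE hF adjL h0 adjR _ _ (isZero_rObj hE h0 adjR Y)).1
  simp [map_rEquiv])

/-- The adjunction between `F` and `jR`. -/
def adjJR : F ⊣ jR hE hF adjL h0 adjR := Adjunction.adjunctionOfEquivRight _ _

lemma isZero_jR (Z : D) : IsZero (iR.obj ((jR hE hF adjL h0 adjR).obj Z)) :=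
  isZero_rObj hE h0 adjR Z

instance (Z : D) : IsIso ((adjJR hE hF adjL h0 adjR).counit.app Z) := by
  have : (adjJR hE hF adjL h0 adjR).counit.app Z = (rIso hE h0 adjR Z).hom := by
    refine (Adjunction.adjunctionOfEquivRight_counit_app _ _ Z).trans ((Equiv.symm_apply_eq _).2 ?_)
    apply (bijective_of_isZero hE hF adjL h0 adjR _ _ (isZero_rObj hE h0 adjR Z)).1
    refine Eq.trans ?_ (map_rEquiv hE hF adjL h0 adjR (rObj hE h0 adjR Z) Z
      (rIso hE h0 adjR Z).hom).symm
    rw [Iso.hom_inv_id]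
    exact F.map_id _
  rw [this]
  exact inferInstanceAs (IsIso (rIso hE h0 adjR Z).hom)

instance : IsIso (adjJR hE hF adjL h0 adjR).counit := NatIso.isIso_of_isIso_app _

/-- `F` sends the unit to an isomorphism by the triangle identity, and it is bijective on morphisms
into objects killed by `iR`. So the inverse lifts. -/
lemma isIso_unit {Y : C} (hY : IsZero (iR.obj Y)) :
    IsIso ((adjJR hE hF adjL h0 adjR).unit.app Y) := by
  let η := (adjJR hE hF adjL h0 adjR).unit.app Y
  have : IsIso (𝟙 (F.obj Y)) := inferInstance
  have hη : IsIso (F.map η) :=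
    IsIso.of_isIso_fac_right (h := 𝟙 (F.obj Y)) ((adjJR hE hF adjL h0 adjR).left_triangle_components Y)
  have b₁ := bijective_of_isZero hE hF adjL h0 adjR
    ((jR hE hF adjL h0 adjR).obj (F.obj Y)) Y hY
  obtain ⟨g, hg⟩ := b₁.2 (inv (F.map η))
  refine ⟨g, (bijective_of_isZero hE hF adjL h0 adjR _ _ hY).1 ?_,
    (bijective_of_isZero hE hF adjL h0 adjR _ _ (isZero_jR hE hF adjL h0 adjR _)).1 ?_⟩
  · rw [F.map_comp, hg, F.map_id]; exact IsIso.hom_inv_id _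
  · rw [F.map_comp, hg, F.map_id]; exact IsIso.inv_hom_id _

/-- Dual to `triangleL`: the cone `Z` of the counit is killed by `iR`, hence equal to `jR F Z`, and
`F X ≅ F Z`. -/
lemma triangleR (X : C) : ∃ δ : (jR hE hF adjL h0 adjR).obj (F.obj X) ⟶
      (i.obj (iR.obj X))⟦(1 : ℤ)⟧,
    Triangle.mk (adjR.counit.app X) ((adjJR hE hF adjL h0 adjR).unit.app X) δ ∈
      distTriang C := by
  obtain ⟨Z, g, h, hZ, mem⟩ := exists_triangle_counit adjR X
  have := isIso_unit hE hF adjL h0 adjR hZ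
  have : IsIso (F.map g) :=
    (Triangle.isZero₁_iff_isIso₂ _ (F.map_distinguished _ mem)).1 (h0 _)
  let e : (jR hE hF adjL h0 adjR).obj (F.obj X) ≅ Z :=
    asIso ((jR hE hF adjL h0 adjR).map (F.map g)) ≪≫
      (asIso ((adjJR hE hF adjL h0 adjR).unit.app Z)).symm
  have he : (adjJR hE hF adjL h0 adjR).unit.app X ≫ e.hom = g := by
    have := (adjJR hE hF adjL h0 adjR).unit.naturality g
    simp only [Functor.comp_map, Functor.id_map] at this
    simp only [e, Iso.trans_hom, Iso.symm_hom, asIso_inv, asIso_hom]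
    rw [← Category.assoc, IsIso.comp_inv_eq]
    exact this.symm
  refine ⟨e.hom ≫ h, isomorphic_distinguished _ mem _
    (Triangle.isoMk _ _ (Iso.refl _) (Iso.refl _) e ?_ ?_ ?_)⟩
  · exact (Category.comp_id _).trans (Category.id_comp _).symm
  · exact he.trans (Category.id_comp _).symm
  · change (e.hom ≫ h) ≫ (𝟙 _)⟦(1 : ℤ)⟧' = e.hom ≫ h
    rw [CategoryTheory.Functor.map_id]
    exact Category.comp_id _

/-- A recollement from a fully faithful functor `i` with both adjoints and a functor `F` killing
the image of `i` which is an equivalence on the left orthogonal of that image. -/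
def recollement : Recollement i F where
  i_triangulated := ⟨inferInstance, inferInstance⟩
  j_triangulated := ⟨inferInstance, inferInstance⟩
  iL := iL
  iR := iR
  jL := jL hE hF
  jR := jR hE hF adjL h0 adjR
  adjIL := adjL
  adjIR := adjR
  adjJL := adjJL hE hF
  adjJR := adjJR hE hF adjL h0 adjR
  i_full := inferInstance
  i_faithful := inferInstance
  jL_full := jL_full hE hF
  jL_faithful := jL_faithful hE hF
  jR_full := (adjJR hE hF adjL h0 adjR).fullyFaithfulROfIsIsoCounit.full
  jR_faithful := (adjJR hE hF adjL h0 adjR).fullyFaithfulROfIsIsoCounit.faithful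
  isZero := h0
  triangleL := triangleL hE hF adjL h0
  triangleR := triangleR hE hF adjL h0 adjR

include hE hF adjL h0 in
/-- The essential image of `i` is the kernel of `F`. -/
lemma essImage_iff (X : C) : i.essImage X ↔ IsZero (F.obj X) := by
  constructor
  · rintro ⟨Y, ⟨e⟩⟩
    exact (h0 Y).of_iso (F.mapIso e).symm
  · intro hX
    obtain ⟨δ, mem⟩ := triangleL hE hF adjL h0 X
    have hz : IsZero ((jL hE hF).obj (F.obj X)) := by
      have : (jL hE hF).IsLeftAdjoint := (adjJL hE hF).isLeftAdjoint
      exact Functor.map_isZero _ hX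
    have : IsIso (adjL.unit.app X) := (Triangle.isZero₁_iff_isIso₂ _ mem).1 hz
    exact ⟨_, ⟨(asIso (adjL.unit.app X)).symm⟩⟩

include hE hF adjL h0 in
/-- `F` is the Verdier quotient by the essential image of `i`. -/
lemma isLocalization : F.IsLocalization i.essImage.trW := by
  have := jL_full hE hF
  have := jL_faithful hE hF
  -- Having a fully faithful left adjoint, `F` is the localization at the morphisms it inverts.
  -- These are the morphisms whose cone is killed by `F`, and this kernel is the essential image of
  -- `i`.
  have h := (adjJL hE hF).isLocalization'
  convert h using 1
  ext X Y f
  obtain ⟨Z, g, k, mem⟩ := distinguished_cocone_triangle f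
  have : i.essImage.IsStableUnderShift ℤ := inferInstance
  refine (i.essImage.trW_iff_of_distinguished _ mem).trans
    ((essImage_iff hE hF adjL h0 _).trans ?_)
  exact Triangle.isZero₃_iff_isIso₁ _ (F.map_distinguished _ mem)

include hE hF in
lemma isEquivalence (P : ObjectProperty C) (hP : ∀ X, P X ↔ IsZero (iL.obj X)) :
    (P.ι ⋙ F).IsEquivalence where
  faithful := ⟨fun {X Y} f g hfg => by
    ext
    exact (hF _ _ ((hP _).1 X.2)).1 hfg⟩
  full := ⟨fun {X Y} f => by
    obtain ⟨g, hg⟩ := (hF X.obj Y.obj ((hP _).1 X.2)).2 f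
    exact ⟨P.homMk g, hg⟩⟩
  essSurj := ⟨fun Z => by
    obtain ⟨X, hX, e⟩ := hE Z
    exact ⟨⟨X, (hP X).2 hX⟩, e⟩⟩

end

end RecollementCriterion

end CDG

end

/-! ### Coproducts in triangulated categories -/

noncomputable section

namespace CDG

namespace Coproducts

variable {C : Type*} [Category* C] [Preadditive C] [HasZeroObject C] [HasShift C ℤ]
  [∀ a : ℤ, (shiftFunctor C a).Additive] [Pretriangulated C] {J : Type*}

/-- The shift of a coproduct cofan. -/
def isColimitShift {X : J → C} {A : C} {a : ∀ j, X j ⟶ A} (hA : IsColimit (Cofan.mk A a)) (i : ℤ) :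
    IsColimit (Cofan.mk (A⟦i⟧) (fun j => (a j)⟦i⟧')) :=
  isColimitCofanMkObjOfIsColimit (shiftFunctor C i) X a hA

/-- The third vertices of a coproduct of distinguished triangles form a coproduct. -/
lemma exists_isColimit₃ (T : J → Triangle C) (hT : ∀ j, T j ∈ distTriang C) {A B W : C}
    {a : ∀ j, (T j).obj₁ ⟶ A} (hA : IsColimit (Cofan.mk A a)) {b : ∀ j, (T j).obj₂ ⟶ B}
    (hB : IsColimit (Cofan.mk B b)) {f : A ⟶ B} {g : B ⟶ W} {h : W ⟶ A⟦(1 : ℤ)⟧}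
    (hf : ∀ j, a j ≫ f = (T j).mor₁ ≫ b j) (mem : Triangle.mk f g h ∈ distTriang C) :
    ∃ c : ∀ j, (T j).obj₃ ⟶ W, (∀ j, (T j).mor₂ ≫ c j = b j ≫ g) ∧
      (∀ j, (T j).mor₃ ≫ (a j)⟦(1 : ℤ)⟧' = c j ≫ h) ∧ Nonempty (IsColimit (Cofan.mk W c)) := by
  -- The fillers are chosen arbitrarily, without any functoriality of cones. The universal property
  -- follows for every choice by a diagram chase in the long exact sequences of `Hom(-, Y)`.
  have H : ∀ j, ∃ c : (T j).obj₃ ⟶ W, (T j).mor₂ ≫ c = b j ≫ g ∧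
      (T j).mor₃ ≫ (a j)⟦(1 : ℤ)⟧' = c ≫ h := fun j =>
    complete_distinguished_triangle_morphism (T j) _ (hT j) mem (a j) (b j) (hf j).symm
  choose c hc₂ hc₃ using H
  refine ⟨c, hc₂, hc₃, ?_⟩
  have hA' := isColimitShift hA 1
  have hB' := isColimitShift hB 1
  have ex : ∀ {Y : C} (z : ∀ j, (T j).obj₃ ⟶ Y), ∃ w : W ⟶ Y, ∀ j, c j ≫ w = z j := by
    intro Y z
    let y : B ⟶ Y := Cofan.IsColimit.desc hB (fun j => (T j).mor₂ ≫ z j)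
    have hy : ∀ j, b j ≫ y = (T j).mor₂ ≫ z j := fun j => Cofan.IsColimit.fac hB _ j
    have hfy : f ≫ y = 0 := Cofan.IsColimit.hom_ext hA _ _ (fun j => by
      change a j ≫ f ≫ y = a j ≫ 0
      rw [← Category.assoc, hf, Category.assoc, hy, ← Category.assoc,
        comp_distTriang_mor_zero₁₂ _ (hT j), zero_comp, comp_zero])
    obtain ⟨w, hw⟩ : ∃ w : W ⟶ Y, y = g ≫ w := Triangle.yoneda_exact₂ _ mem y hfy
    -- So far `w` is only correct after restriction to the second vertices. The defect factors
    -- through the third maps and is removed by a morphism out of `A⟦1⟧`.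
    have hx : ∀ j, ∃ x : (T j).obj₁⟦(1 : ℤ)⟧ ⟶ Y, z j - c j ≫ w = (T j).mor₃ ≫ x := fun j => by
      apply Triangle.yoneda_exact₃ _ (hT j)
      rw [Preadditive.comp_sub, ← Category.assoc, hc₂, Category.assoc, ← hw, hy, sub_self]
    choose x hx using hx
    let x' : A⟦(1 : ℤ)⟧ ⟶ Y := Cofan.IsColimit.desc hA' x
    have hx' : ∀ j, (a j)⟦(1 : ℤ)⟧' ≫ x' = x j := fun j => Cofan.IsColimit.fac hA' _ j
    refine ⟨w + h ≫ x', fun j => ?_⟩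
    rw [Preadditive.comp_add, ← Category.assoc, ← hc₃, Category.assoc, hx', ← hx]
    abel
  have uniq : ∀ {Y : C} (w : W ⟶ Y), (∀ j, c j ≫ w = 0) → w = 0 := by
    intro Y w hw
    have h₁ : g ≫ w = 0 := Cofan.IsColimit.hom_ext hB _ _ (fun j => by
      change b j ≫ g ≫ w = b j ≫ 0
      rw [← Category.assoc, ← hc₂, Category.assoc, hw, comp_zero, comp_zero])
    obtain ⟨x, hx⟩ : ∃ x : A⟦(1 : ℤ)⟧ ⟶ Y, w = h ≫ x := Triangle.yoneda_exact₃ _ mem w h₁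
    -- `w` factors as `h ≫ x`. Componentwise `x` comes from the shifted first map, so globally `x`
    -- factors through `f⟦1⟧'`, which `h` annihilates.
    have hy : ∀ j, ∃ y : (T j).obj₂⟦(1 : ℤ)⟧ ⟶ Y, (a j)⟦(1 : ℤ)⟧' ≫ x =
        (-(T j).mor₁⟦(1 : ℤ)⟧') ≫ y := fun j => by
      apply Triangle.yoneda_exact₃ _ (rot_of_distTriang _ (hT j))
      change (T j).mor₃ ≫ _ = 0
      rw [← Category.assoc, hc₃, Category.assoc, ← hx, hw]
    choose y hy using hy
    let y' : B⟦(1 : ℤ)⟧ ⟶ Y := Cofan.IsColimit.desc hB' y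
    have hy' : ∀ j, (b j)⟦(1 : ℤ)⟧' ≫ y' = y j := fun j => Cofan.IsColimit.fac hB' _ j
    have hxy : x = (-f⟦(1 : ℤ)⟧') ≫ y' := Cofan.IsColimit.hom_ext hA' _ _ (fun j => by
      change (a j)⟦(1 : ℤ)⟧' ≫ x = (a j)⟦(1 : ℤ)⟧' ≫ (-f⟦(1 : ℤ)⟧') ≫ y'
      rw [hy, Preadditive.neg_comp, Preadditive.neg_comp, Preadditive.comp_neg, ← Category.assoc,
        ← Functor.map_comp, hf, Functor.map_comp, Category.assoc, hy'])
    rw [hx, hxy, Preadditive.neg_comp, Preadditive.comp_neg, ← Category.assoc,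
      show h ≫ f⟦(1 : ℤ)⟧' = 0 from comp_distTriang_mor_zero₃₁ _ mem, zero_comp, neg_zero]
  exact ⟨Cofan.IsColimit.mk _ (fun t => (ex t.inj).choose) (fun t j => (ex t.inj).choose_spec j)
    (fun t m hm => sub_eq_zero.1 (uniq (Y := t.pt) _ (fun j => (Preadditive.comp_sub _ _ _).trans
      (sub_eq_zero.2 ((hm j).trans ((ex t.inj).choose_spec j).symm)))))⟩

/-- A coproduct of morphisms with cone in `L` has its cone in `L`, if `L` is closed under
coproducts. -/
lemma trW_of_isColimit (L : ObjectProperty C) [L.IsClosedUnderIsomorphisms]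
    [L.IsClosedUnderColimitsOfShape (Discrete J)] {X Y : J → C} (s : ∀ j, X j ⟶ Y j)
    (hs : ∀ j, L.trW (s j)) {A B : C}
    {a : ∀ j, X j ⟶ A} (hA : IsColimit (Cofan.mk A a)) {b : ∀ j, Y j ⟶ B}
    (hB : IsColimit (Cofan.mk B b)) {f : A ⟶ B} (hf : ∀ j, a j ≫ f = s j ≫ b j) : L.trW f := by
  choose Z g h mem hZ using hs
  obtain ⟨W, g', h', mem'⟩ := distinguished_cocone_triangle f
  obtain ⟨c, -, -, ⟨hc⟩⟩ := exists_isColimit₃ (fun j => Triangle.mk (s j) (g j) (h j)) mem hA hB hf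
    mem'
  exact ⟨W, g', h', mem', L.prop_of_isColimit hc (fun j => hZ j.as)⟩

/-- Left cancellation for the class of morphisms with cone in a triangulated subcategory. -/
lemma trW_of_comp [IsTriangulated C] (L : ObjectProperty C) [L.IsTriangulated]
    [L.IsClosedUnderIsomorphisms] {X Y Z : C} (f : X ⟶ Y) (g : Y ⟶ Z) (hg : L.trW g)
    (hfg : L.trW (f ≫ g)) : L.trW f := by
  obtain ⟨U, a, a', mem⟩ := distinguished_cocone_triangle f
  obtain ⟨V, b, b', mem', hV⟩ := hg
  obtain ⟨W, c, c', mem'', hW⟩ := hfg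
  -- The octahedron makes the cone of `f` the first vertex of a triangle whose other vertices are
  -- the cones of `f ≫ g` and of `g`.
  have H := Triangulated.someOctahedron rfl mem mem' mem''
  exact ⟨U, a, a', mem, L.ext_of_isTriangulatedClosed₁ _ H.mem hW hV⟩

end Coproducts

end CDG

end

/-! ### Generation of triangulated categories by compact objects -/

noncomputable section

namespace CDG

namespace Generation

open Coproducts

variable {C : Type*} [Category* C] [Preadditive C] [HasZeroObject C] [HasShift C ℤ]
  [∀ a : ℤ, (shiftFunctor C a).Additive] [Pretriangulated C] (G : C)

/-- Morphisms which are invisible to the shifts of `G`. -/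
def IsGhost {M N : C} (ψ : M ⟶ N) : Prop := ∀ (i : ℤ) (h : G ⟶ M⟦i⟧), h ≫ ψ⟦i⟧' = 0

/-- Morphisms out of a countable coproduct are invisible to `G` as soon as their components are. -/
def IsSmall : Prop := ∀ (N : ℕ → C) (S : C) (ι : ∀ m, N m ⟶ S)
  (_ : IsColimit (Cofan.mk S ι)) (A : C) (s : S ⟶ A),
  (∀ m (h : G ⟶ N m), h ≫ ι m ≫ s = 0) → ∀ g : G ⟶ S, g ≫ s = 0

variable {G}

/-- Smallness only concerns maps in degree zero. The other degrees follow because shifts preserve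
coproduct cofans. -/
lemma IsSmall.isGhost (hG : IsSmall G) {N : ℕ → C} {S : C} {ι : ∀ m, N m ⟶ S}
    (hS : IsColimit (Cofan.mk S ι)) {A : C} {s : S ⟶ A} (hs : ∀ m, IsGhost G (ι m ≫ s)) :
    IsGhost G s := fun i => hG _ _ _ (isColimitShift hS i) _ _ (fun m h => by
  rw [← Functor.map_comp]
  exact hs m i h)

lemma comp_eq_zero_of_isGhost {M N : C} {ψ : M ⟶ N} (hψ : IsGhost G ψ) (i : ℤ) (h : G⟦i⟧ ⟶ M) :
    h ≫ ψ = 0 := by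
  apply (shiftFunctor C (-i)).map_injective
  rw [← cancel_epi ((shiftFunctorCompIsoId C i (-i) (add_neg_cancel i)).inv.app G),
    Functor.map_comp, Functor.map_zero, comp_zero, ← Category.assoc]
  exact hψ _ _

/-- This moves the shift from the target to the source, so that a ghost can be tested on maps `G⟦-i⟧
⟶ M`. -/
lemma comp_eq_zero_of_shift {M N : C} {ψ : M ⟶ N} (i : ℤ) (h : G ⟶ M⟦i⟧)
    (H : (h⟦-i⟧' ≫ (shiftFunctorCompIsoId C i (-i) (add_neg_cancel i)).hom.app M) ≫ ψ = 0) :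
    h ≫ ψ⟦i⟧' = 0 := by
  apply (shiftFunctor C (-i)).map_injective
  rw [← cancel_mono ((shiftFunctorCompIsoId C i (-i) (add_neg_cancel i)).hom.app N),
    Functor.map_comp, Functor.map_zero, zero_comp, Category.assoc]
  refine Eq.trans ?_ H
  rw [Category.assoc]
  exact congrArg (h⟦-i⟧' ≫ ·)
    ((shiftFunctorCompIsoId C i (-i) (add_neg_cancel i)).hom.naturality ψ)

lemma IsGhost.shift {M N : C} {ψ : M ⟶ N} (hψ : IsGhost G ψ) (a : ℤ) : IsGhost G (ψ⟦a⟧') := by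
  intro i h
  rw [← cancel_mono ((shiftFunctorAdd C a i).inv.app N), zero_comp, Category.assoc]
  refine (congrArg (h ≫ ·) ((shiftFunctorAdd C a i).inv.naturality ψ)).trans ?_
  rw [← Category.assoc]
  exact hψ _ _

/-- A ghost out of `M`, with fibre a coproduct of shifts of `G`. -/
lemma exists_isGhost [HasCoproducts.{u} C] [∀ M, Small.{u} (G ⟶ M)] (M : C) :
    ∃ (S N : C) (f : S ⟶ M) (ψ : M ⟶ N) (h : N ⟶ S⟦(1 : ℤ)⟧),
      Triangle.mk f ψ h ∈ distTriang C ∧ (∀ P, IsLocalizing.{u} P → P G → P S) ∧ IsGhost G ψ := by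
  -- One summand for each map from a shift of `G` to `M`. `ULift` and `Shrink` bring the index type
  -- into the universe in which coproducts are available.
  let J : Type u := Σ i : ULift.{u} ℤ, Shrink.{u} (G ⟶ M⟦i.down⟧)
  let X : J → C := fun j => G⟦-j.1.down⟧
  let φ : ∀ j : J, X j ⟶ M := fun j => ((equivShrink _).symm j.2)⟦-j.1.down⟧' ≫
    (shiftFunctorCompIsoId C j.1.down (-j.1.down) (add_neg_cancel j.1.down)).hom.app M
  obtain ⟨N, ψ, h, mem⟩ := distinguished_cocone_triangle (Sigma.desc φ)
  refine ⟨∐ X, N, Sigma.desc φ, ψ, h, mem, fun P hP hG => ?_, fun i g => ?_⟩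
  · have := hP.coproduct J
    have := hP.triangulated
    exact P.prop_of_isColimit (coproductIsCoproduct X) (fun j => P.le_shift _ _ hG)
  · apply comp_eq_zero_of_shift
    -- Each map is, by the choice of `J`, a component of the first map of the triangle, so its
    -- composite with `ψ` vanishes.
    have e : g⟦-i⟧' ≫ (shiftFunctorCompIsoId C i (-i) (add_neg_cancel i)).hom.app M =
        φ ⟨⟨i⟩, equivShrink _ g⟩ := by
      simp only [φ, Equiv.symm_apply_apply]
    rw [e, ← Sigma.ι_desc φ ⟨⟨i⟩, equivShrink _ g⟩, Category.assoc]
    exact (congrArg (Sigma.ι X _ ≫ ·) (comp_distTriang_mor_zero₁₂ _ mem)).trans comp_zero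

/-- The cone of an endomorphism which is the identity up to a ghost is invisible to `G`. -/
lemma isGhost_id_of_triangle {S Z : C} {s : S ⟶ S} (hs : IsGhost G s) {g : S ⟶ Z}
    {h : Z ⟶ S⟦(1 : ℤ)⟧} (mem : Triangle.mk (𝟙 S - s) g h ∈ distTriang C) : IsGhost G (𝟙 Z) := by
  intro i f
  apply comp_eq_zero_of_shift
  refine (Category.comp_id _).trans ?_
  generalize f⟦-i⟧' ≫ (shiftFunctorCompIsoId C i (-i) (add_neg_cancel i)).hom.app Z = k
  -- `h` equalizes the identity and `s⟦1⟧'`. So `k ≫ h` equals its composite with a ghost, which is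
  -- zero.
  have h₁ : k ≫ h = 0 := by
    have e := comp_eq_zero_of_isGhost (hs.shift 1) _ (k ≫ h)
    have e' : h ≫ (𝟙 S - s)⟦(1 : ℤ)⟧' = 0 := comp_distTriang_mor_zero₃₁ _ mem
    rw [Functor.map_sub, CategoryTheory.Functor.map_id, Preadditive.comp_sub, Category.comp_id,
      sub_eq_zero] at e'
    rw [Category.assoc, ← e'] at e
    exact e
  obtain ⟨l, hl⟩ : ∃ l : G⟦-i⟧ ⟶ S, k = l ≫ g := Triangle.coyoneda_exact₃ _ mem k h₁
  -- Likewise `g = s ≫ g`, and the lift `l` of `k` dies on composing with the ghost `s`.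
  have e' : (𝟙 S - s) ≫ g = 0 := comp_distTriang_mor_zero₁₂ _ mem
  rw [Preadditive.sub_comp, Category.id_comp, sub_eq_zero] at e'
  rw [hl, e', ← Category.assoc, comp_eq_zero_of_isGhost hs, zero_comp]

/-- The telescope of a constant sequence. -/
lemma nonempty_iso_of_triangle {M S Z : C} {ι : ℕ → (M ⟶ S)}
    (hS : IsColimit (Cofan.mk (f := fun _ : ℕ => M) S ι)) {s : S ⟶ S}
    (hs : ∀ m, ι m ≫ s = ι (m + 1)) {g : S ⟶ Z} {h : Z ⟶ S⟦(1 : ℤ)⟧}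
    (mem : Triangle.mk (𝟙 S - s) g h ∈ distTriang C) : Nonempty (M ≅ Z) := by
  have ext : ∀ {A : C} (x y : S ⟶ A), (∀ m, ι m ≫ x = ι m ≫ y) → x = y :=
    fun x y hxy => Cofan.IsColimit.hom_ext hS x y hxy
  have desc : ∀ {A : C} (x : ℕ → (M ⟶ A)), ∃ y : S ⟶ A, ∀ m, ι m ≫ y = x m :=
    fun x => ⟨Cofan.IsColimit.desc hS x, fun m => Cofan.IsColimit.fac hS x m⟩
  -- A retraction of `1 - s`: two consecutive values of `ρ` differ by exactly `ι m`. With the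
  -- codiagonal `v` below, the triangle splits and its third vertex is one copy of `M`.
  obtain ⟨ρ, hρ⟩ := desc (fun m => -∑ k ∈ Finset.range m, ι k)
  obtain ⟨v, hv⟩ := desc (fun _ => 𝟙 M)
  have h₁ : (𝟙 S - s) ≫ ρ = 𝟙 S := ext _ _ (fun m => by
    rw [← Category.assoc, Preadditive.comp_sub, Category.comp_id, hs, Preadditive.sub_comp, hρ, hρ,
      Finset.sum_range_succ]
    abel)
  have hmono : Mono (𝟙 S - s) := (SplitMono.mk ρ h₁).mono
  have hepi : Epi g := Triangle.epi₂ _ mem (Triangle.mor₃_eq_zero_of_mono₁ _ mem hmono)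
  have e : (𝟙 S - s) ≫ g = 0 := comp_distTriang_mor_zero₁₂ _ mem
  have h₂ : ∀ m, ι m ≫ g = ι 0 ≫ g := fun m => by
    induction m with
    | zero => rfl
    | succ m ih =>
      have := congrArg (ι m ≫ ·) e
      simp only [Preadditive.sub_comp, Preadditive.comp_sub, Category.id_comp, comp_zero,
        ← Category.assoc, hs, sub_eq_zero] at this
      rw [← this, ih]
  obtain ⟨w, hw⟩ : ∃ w : Z ⟶ M, v = g ≫ w := Triangle.yoneda_exact₂ _ mem v (ext _ _ (fun m => by
    change ι m ≫ (𝟙 S - s) ≫ v = _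
    rw [← Category.assoc, Preadditive.comp_sub, Category.comp_id, hs, Preadditive.sub_comp, hv, hv,
      sub_self]
    exact comp_zero.symm))
  refine ⟨⟨ι 0 ≫ g, w, ?_, ?_⟩⟩
  · rw [Category.assoc, ← hw, hv]
  · rw [← cancel_epi g, ← Category.assoc, ← hw, Category.comp_id]
    exact ext _ _ (fun m => by rw [← Category.assoc, hv, Category.id_comp, ← h₂ m])

/-- An object with a sequence of ghosts starting at it, with cones in `L`, belongs to `L`. -/
lemma prop_of_ghost_sequence [IsTriangulated C] [HasCoproductsOfShape ℕ C] (hsm : IsSmall G)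
    (L P : ObjectProperty C) [L.IsTriangulated] [L.IsClosedUnderIsomorphisms]
    [L.IsClosedUnderColimitsOfShape (Discrete ℕ)] [P.IsTriangulated]
    [P.IsClosedUnderIsomorphisms] [P.IsClosedUnderColimitsOfShape (Discrete ℕ)]
    (hcons : ∀ M, P M → IsGhost G (𝟙 M) → IsZero M) (N : ℕ → C) (ψ : ∀ m, N m ⟶ N (m + 1))
    (hP : ∀ m, P (N m)) (hL : ∀ m, L.trW (ψ m)) (hψ : ∀ m, IsGhost G (ψ m)) : L (N 0) := by
  let a : ∀ m, N 0 ⟶ N m := fun m => Nat.rec (𝟙 _) (fun m f => f ≫ ψ m) m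
  have ha : ∀ m, L.trW (a m) := fun m => by
    induction m with
    | zero => exact L.trW.id_mem _
    | succ m ih => exact L.trW.comp_mem _ _ ih (hL m)
  -- The cone `Z` of `1 - s` is the telescope of the sequence. Its components being ghosts, `s` is a
  -- ghost by smallness, so `G` does not see `Z` and `hcons` forces `Z = 0`.
  let s : ∐ N ⟶ ∐ N := Sigma.desc (fun m => ψ m ≫ Sigma.ι N (m + 1))
  have hs : ∀ m, Sigma.ι N m ≫ s = ψ m ≫ Sigma.ι N (m + 1) := fun m => Sigma.ι_desc _ _
  let s' : ∐ (fun _ : ℕ => N 0) ⟶ ∐ (fun _ : ℕ => N 0) :=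
    Sigma.desc (fun m => Sigma.ι (fun _ : ℕ => N 0) (m + 1))
  have hs' : ∀ m, Sigma.ι (fun _ : ℕ => N 0) m ≫ s' = Sigma.ι (fun _ : ℕ => N 0) (m + 1) :=
    fun m => Sigma.ι_desc _ _
  have hsg : IsGhost G s := hsm.isGhost (coproductIsCoproduct N) (fun m i h => by
    rw [hs, Functor.map_comp, ← Category.assoc, hψ m i h, zero_comp])
  obtain ⟨Z, g, h, mem⟩ := distinguished_cocone_triangle (𝟙 _ - s)
  have hPN : P (∐ N) := P.prop_of_isColimit (coproductIsCoproduct N) (fun m => hP m.as)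
  have hZ : IsZero Z := hcons Z (P.ext_of_isTriangulatedClosed₃ _ mem hPN hPN)
    (isGhost_id_of_triangle hsg mem)
  have h₁ : L.trW (𝟙 _ - s) := ⟨Z, g, h, mem, L.prop_of_isZero hZ⟩
  -- Comparison with the constant sequence on `N 0`. Its cone is in `L`, since each `a m` is a
  -- composite of morphisms with cone in `L`.
  let A : ∐ (fun _ : ℕ => N 0) ⟶ ∐ N := Sigma.desc (fun m => a m ≫ Sigma.ι N m)
  have hA : ∀ m, Sigma.ι (fun _ : ℕ => N 0) m ≫ A = a m ≫ Sigma.ι N m := fun m => Sigma.ι_desc _ _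
  have hAL : L.trW A := trW_of_isColimit L a ha (coproductIsCoproduct (fun _ : ℕ => N 0))
    (coproductIsCoproduct N) hA
  have comm : (𝟙 _ - s') ≫ A = A ≫ (𝟙 _ - s) := Sigma.hom_ext _ _ (fun m => by
    have e₁ : Sigma.ι (fun _ : ℕ => N 0) m ≫ s' ≫ A = a m ≫ ψ m ≫ Sigma.ι N (m + 1) := by
      rw [← Category.assoc, hs', hA, ← Category.assoc]
    have e₂ : Sigma.ι (fun _ : ℕ => N 0) m ≫ A ≫ s = a m ≫ ψ m ≫ Sigma.ι N (m + 1) := by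
      rw [← Category.assoc, hA, Category.assoc, hs]
    rw [Preadditive.sub_comp, Preadditive.comp_sub, Category.id_comp, Preadditive.comp_sub A,
      Preadditive.comp_sub, e₁, e₂, Category.comp_id])
  -- Modulo `L`, both `A` and `1 - s` are invertible, hence so is `1 - s'`. The cone of the latter
  -- is `N 0` itself.
  have h₂ : L.trW (𝟙 _ - s') := trW_of_comp L _ A hAL (by
    rw [comm]
    exact L.trW.comp_mem _ _ hAL h₁)
  obtain ⟨Z', g', h', mem', hZ'⟩ := h₂
  obtain ⟨e⟩ := nonempty_iso_of_triangle (coproductIsCoproduct (fun _ : ℕ => N 0)) hs' mem'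
  exact L.prop_of_iso e.symm hZ'

/-- A localizing subcategory `P` with a small object `G` which detects the zero objects of `P` is
contained in every localizing subcategory containing `G`. -/
lemma le_of_isLocalizing [IsTriangulated C] [HasCoproducts.{u} C] [∀ M, Small.{u} (G ⟶ M)]
    (hsm : IsSmall G) {L P : ObjectProperty C} (hL : IsLocalizing.{u} L) (hP : IsLocalizing.{u} P)
    (hLG : L G) (hPG : P G) (hcons : ∀ M, P M → IsGhost G (𝟙 M) → IsZero M) : P ≤ L := by
  have := hL.iso
  have := hP.iso
  have := hL.triangulated
  have := hP.triangulated
  -- Closure under coproducts is known for index types in `Type u`. Countable coproducts are reached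
  -- through `ULift ℕ`.
  have e : Discrete (ULift.{u} ℕ) ≌ Discrete ℕ := Discrete.equivalence Equiv.ulift
  have := hL.coproduct (ULift.{u} ℕ)
  have := hP.coproduct (ULift.{u} ℕ)
  have : L.IsClosedUnderColimitsOfShape (Discrete ℕ) := .of_equivalence e
  have : P.IsClosedUnderColimitsOfShape (Discrete ℕ) := .of_equivalence e
  have : HasCoproductsOfShape ℕ C := hasColimitsOfShape_of_equivalence e
  -- One step of the tower: the cone of a coproduct of shifts of `G` mapping to `M`. It stays in
  -- `P`, and the fibre belongs to `L`.
  have st : ∀ M : {M : C // P M}, ∃ (N : {M : C // P M}) (ψ : M.1 ⟶ N.1),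
      L.trW ψ ∧ IsGhost G ψ := by
    rintro ⟨M, hM⟩
    obtain ⟨S, N, f, ψ, h, mem, hS, hψ⟩ := exists_isGhost.{u} (G := G) M
    refine ⟨⟨N, P.ext_of_isTriangulatedClosed₃ _ mem (hS P hP hPG) hM⟩, ψ, ?_, hψ⟩
    exact (L.trW_iff_of_distinguished' _ mem).2 (hS L hL hLG)
  choose nx ψ hψ using st
  intro M hM
  let N : ℕ → {M : C // P M} := fun m => Nat.rec ⟨M, hM⟩ (fun _ X => nx X) m
  exact prop_of_ghost_sequence hsm L P hcons (fun m => (N m).1) (fun m => ψ (N m))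
    (fun m => (N m).2) (fun m => (hψ (N m)).1) (fun m => (hψ (N m)).2)

end Generation

end CDG

end

/-! ### Functors which preserve coproducts -/

noncomputable section

namespace CDG

namespace Coproducts

section

variable {C D E : Type*} [Category* C] [Category* D] [Category* E] {J : Type*}

/-- A functor preserves coproducts as soon as it preserves one coproduct cofan for each family. -/
lemma preservesColimitsOfShape_of_cofan (L : C ⥤ D)
    (h : ∀ X : J → C, ∃ (S : C) (ι : ∀ j, X j ⟶ S) (_ : IsColimit (Cofan.mk S ι)),
      Nonempty (IsColimit (Cofan.mk (L.obj S) (fun j => L.map (ι j))))) :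
    PreservesColimitsOfShape (Discrete J) L where
  preservesColimit {K} := by
    obtain ⟨S, ι, hS, ⟨hL⟩⟩ := h (K.obj ∘ Discrete.mk)
    have : PreservesColimit (Discrete.functor (K.obj ∘ Discrete.mk)) L :=
      preservesColimit_of_preserves_colimit_cocone hS
        ((isColimitMapCoconeCofanMkEquiv L _ _).symm hL)
    exact preservesColimit_of_iso_diagram L Discrete.natIsoFunctor.symm

/-- The target of an essentially surjective functor which preserves coproducts has coproducts. -/
lemma hasCoproductsOfShape_of_essSurj (L : C ⥤ D) [L.EssSurj] [HasCoproductsOfShape J C]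
    [PreservesColimitsOfShape (Discrete J) L] : HasCoproductsOfShape J D where
  has_colimit K := by
    let K' : Discrete J ⥤ C := Discrete.functor (fun j => L.objPreimage (K.obj ⟨j⟩))
    have : HasColimit (K' ⋙ L) := ⟨_, isColimitOfPreserves L (colimit.isColimit K')⟩
    exact hasColimit_of_iso (F := K' ⋙ L)
      (Discrete.natIso (fun j => (L.objObjPreimageIso (K.obj j)).symm))

/-- A diagram of discrete shape involves no morphisms, so it lifts through `L` objectwise, up to
isomorphism. -/
lemma preservesColimitsOfShape_of_essSurj (L : C ⥤ D) (F : D ⥤ E) [L.EssSurj]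
    [HasCoproductsOfShape J C] [PreservesColimitsOfShape (Discrete J) L]
    [PreservesColimitsOfShape (Discrete J) (L ⋙ F)] : PreservesColimitsOfShape (Discrete J) F where
  preservesColimit {K} := by
    let K' : Discrete J ⥤ C := Discrete.functor (fun j => L.objPreimage (K.obj ⟨j⟩))
    have : PreservesColimit (K' ⋙ L) F :=
      preservesColimit_of_preserves_colimit_cocone
        (isColimitOfPreserves L (colimit.isColimit K'))
        (isColimitOfPreserves (L ⋙ F) (colimit.isColimit K'))
    exact preservesColimit_of_iso_diagram (K₁ := K' ⋙ L) F
      (Discrete.natIso (fun j => L.objObjPreimageIso (K.obj j)))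

end

/-! ### Coproducts in Verdier quotients. -/

section Quotient

variable {C D : Type*} [Category* C] [Category* D] [Preadditive C] [HasZeroObject C]
  [HasShift C ℤ] [∀ a : ℤ, (shiftFunctor C a).Additive] [Pretriangulated C] [IsTriangulated C]
  [Preadditive D] {J : Type*}

/-- A Verdier quotient by a subcategory closed under coproducts preserves coproducts. -/
lemma nonempty_isColimit_of_isLocalization (P : ObjectProperty C) [P.IsTriangulated]
    [P.IsClosedUnderIsomorphisms] [P.IsClosedUnderColimitsOfShape (Discrete J)]
    [HasCoproductsOfShape J C] (L : C ⥤ D) [L.IsLocalization P.trW] [L.Additive] {X : J → C} {S : C}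
    {ι : ∀ j, X j ⟶ S} (hS : IsColimit (Cofan.mk S ι)) :
    Nonempty (IsColimit (Cofan.mk (L.obj S) (fun j => L.map (ι j)))) := by
  have hinv := Localization.inverts L P.trW
  have ex : ∀ {Y : C} (z : ∀ j, L.obj (X j) ⟶ L.obj Y), ∃ w : L.obj S ⟶ L.obj Y,
      ∀ j, L.map (ι j) ≫ w = z j := by
    intro Y z
    -- Each `z j` is a fraction with denominator mapping to `X j`. As `P` is closed under
    -- coproducts, the coproduct of the denominators is again a denominator, and the fractions
    -- assemble into one.
    choose φ hφ using fun j => Localization.exists_rightFraction L P.trW (z j)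
    let ι' := Sigma.ι (fun j => (φ j).X')
    let s : ∐ (fun j => (φ j).X') ⟶ S := Sigma.desc (fun j => (φ j).s ≫ ι j)
    have hs : ∀ j, ι' j ≫ s = (φ j).s ≫ ι j := fun j => Sigma.ι_desc _ _
    let f : ∐ (fun j => (φ j).X') ⟶ Y := Sigma.desc (fun j => (φ j).f)
    have hf : ∀ j, ι' j ≫ f = (φ j).f := fun j => Sigma.ι_desc _ _
    have hsW : P.trW s := trW_of_isColimit P (fun j => (φ j).s) (fun j => (φ j).hs)
      (coproductIsCoproduct _) hS hs
    have : IsIso (L.map s) := hinv s hsW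
    refine ⟨inv (L.map s) ≫ L.map f, fun j => ?_⟩
    have : IsIso (L.map (φ j).s) := hinv _ (φ j).hs
    rw [← cancel_epi (L.map (φ j).s), hφ, MorphismProperty.RightFraction.map_s_comp_map,
      ← Category.assoc, ← L.map_comp, ← hs, L.map_comp, Category.assoc, IsIso.hom_inv_id_assoc,
      ← L.map_comp, hf]
  have uniq : ∀ {Y : C} (w : L.obj S ⟶ L.obj Y), (∀ j, L.map (ι j) ≫ w = 0) → w = 0 := by
    intro Y w hw
    obtain ⟨φ, hφ⟩ := Localization.exists_leftFraction L P.trW w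
    have : IsIso (L.map φ.s) := hinv _ φ.hs
    have hφ' : w ≫ L.map φ.s = L.map φ.f := by
      rw [hφ, MorphismProperty.LeftFraction.map_comp_map_s]
    -- The numerator of `w` is killed on each `X j` by a denominator. The coproduct of these
    -- denominators kills the numerator on the whole of `S`.
    have H : ∀ j, ∃ (X' : C) (s : X' ⟶ X j) (_ : P.trW s), s ≫ ι j ≫ φ.f = s ≫ 0 := fun j => by
      rw [← MorphismProperty.map_eq_iff_precomp L P.trW, L.map_comp, ← hφ', ← Category.assoc, hw,
        zero_comp, L.map_zero]
    choose X' s hs h using H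
    let t : ∐ X' ⟶ S := Sigma.desc (fun j => s j ≫ ι j)
    have ht : ∀ j, Sigma.ι X' j ≫ t = s j ≫ ι j := fun j => Sigma.ι_desc _ _
    have htW : P.trW t := trW_of_isColimit P s hs (coproductIsCoproduct _) hS ht
    have : IsIso (L.map t) := hinv t htW
    have h₀ : t ≫ φ.f = 0 := Sigma.hom_ext _ _ (fun j => by
      rw [← Category.assoc, ht, Category.assoc, h, comp_zero, comp_zero])
    rw [← cancel_mono (L.map φ.s), hφ', zero_comp, ← cancel_epi (L.map t), ← L.map_comp, h₀,
      L.map_zero, comp_zero]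
  have := Localization.essSurj L P.trW
  have ex' : ∀ {Y : D} (z : ∀ j, L.obj (X j) ⟶ Y), ∃ w : L.obj S ⟶ Y,
      ∀ j, L.map (ι j) ≫ w = z j := fun {Y} z => by
    obtain ⟨w, hw⟩ := ex (fun j => z j ≫ (L.objObjPreimageIso Y).inv)
    exact ⟨w ≫ (L.objObjPreimageIso Y).hom, fun j => by
      rw [← Category.assoc, hw, Category.assoc, Iso.inv_hom_id, Category.comp_id]⟩
  have uniq' : ∀ {Y : D} (w : L.obj S ⟶ Y), (∀ j, L.map (ι j) ≫ w = 0) → w = 0 := fun {Y} w hw => by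
    rw [← cancel_mono (L.objObjPreimageIso Y).inv, zero_comp]
    exact uniq _ (fun j => by rw [← Category.assoc, hw, zero_comp])
  exact ⟨Cofan.IsColimit.mk _ (fun t => (ex' t.inj).choose) (fun t j => (ex' t.inj).choose_spec j)
    (fun t m hm => sub_eq_zero.1 (uniq' (Y := t.pt) _ (fun j => (Preadditive.comp_sub _ _ _).trans
      (sub_eq_zero.2 ((hm j).trans ((ex' t.inj).choose_spec j).symm)))))⟩

lemma preservesColimitsOfShape_of_isLocalization (P : ObjectProperty C) [P.IsTriangulated]
    [P.IsClosedUnderIsomorphisms] [P.IsClosedUnderColimitsOfShape (Discrete J)]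
    [HasCoproductsOfShape J C] (L : C ⥤ D) [L.IsLocalization P.trW] [L.Additive] :
    PreservesColimitsOfShape (Discrete J) L :=
  preservesColimitsOfShape_of_cofan L (fun X => ⟨∐ X, Sigma.ι X, coproductIsCoproduct X,
    nonempty_isColimit_of_isLocalization P L (coproductIsCoproduct X)⟩)

end Quotient

/-! ### Dévissage: objects on which a triangulated functor is bijective, and images of localizing
subcategories. -/

section Devissage

variable {C D : Type*} [Category* C] [Category* D]
  [Preadditive C] [HasZeroObject C] [HasShift C ℤ]
  [∀ a : ℤ, (shiftFunctor C a).Additive] [Pretriangulated C] [Preadditive D]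
  [HasZeroObject D] [HasShift D ℤ] [∀ a : ℤ, (shiftFunctor D a).Additive]
  [Pretriangulated D] (F : C ⥤ D) [F.CommShift ℤ] [F.IsTriangulated]

/-- The objects `X` such that `F` is bijective on the morphisms out of `X`. -/
def bijOut : ObjectProperty C := fun X => ∀ Y : C, Function.Bijective (F.map : (X ⟶ Y) → _)

/-- The five lemma for `Hom(-, Y)`. Injectivity needs the term on `T.obj₁⟦1⟧`, surjectivity the one
on `T.obj₃⟦-1⟧`, whence the two shifted hypotheses. -/
lemma bijOut_closed₂ (T : Triangle C) (hT : T ∈ distTriang C) (h₁ : bijOut F T.obj₁)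
    (h₃ : bijOut F T.obj₃) (h₁' : bijOut F (T.obj₁⟦(1 : ℤ)⟧)) (h₃' : bijOut F (T.obj₃⟦(-1 : ℤ)⟧)) :
    bijOut F T.obj₂ := by
  have hFT := F.map_distinguished _ hT
  intro Y
  constructor
  · refine fun f g hfg => sub_eq_zero.1 ?_
    have hk : F.map (f - g) = 0 := by rw [F.map_sub, hfg, sub_self]
    generalize f - g = k at hk
    obtain ⟨l, hl⟩ := Triangle.yoneda_exact₂ _ hT k ((h₁ Y).1 (by
      rw [F.map_comp, hk, comp_zero, F.map_zero]))
    obtain ⟨p, hp⟩ : ∃ p : (F.obj T.obj₁)⟦(1 : ℤ)⟧ ⟶ F.obj Y,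
        F.map l = (F.map T.mor₃ ≫ (F.commShiftIso (1 : ℤ)).hom.app T.obj₁) ≫ p :=
      Triangle.yoneda_exact₃ _ hFT (F.map l) (by
        change F.map T.mor₂ ≫ F.map l = 0
        rw [← F.map_comp, ← hl, hk])
    obtain ⟨q, hq⟩ := (h₁' Y).2 ((F.commShiftIso (1 : ℤ)).hom.app T.obj₁ ≫ p)
    have hlq : l = T.mor₃ ≫ q := (h₃ Y).1 (by
      rw [hp, F.map_comp, hq, Category.assoc])
    rw [hl, hlq, ← Category.assoc, comp_distTriang_mor_zero₂₃ _ hT, zero_comp]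
  · intro φ
    obtain ⟨p, hp⟩ := (h₁ Y).2 (F.map T.mor₁ ≫ φ)
    obtain ⟨f, hf⟩ : ∃ f : T.obj₂ ⟶ Y, p = T.mor₁ ≫ f :=
      Triangle.yoneda_exact₂ _ (inv_rot_of_distTriang _ hT) p ((h₃' Y).1 (by
        have e : ∀ {X : C} (x : X ⟶ T.obj₁), x ≫ T.mor₁ = 0 → F.map (x ≫ p) = F.map 0 :=
          fun x hx => by
            rw [F.map_comp, hp, ← Category.assoc, ← F.map_comp, hx, F.map_zero, zero_comp,
              F.map_zero]
        exact e _ (comp_distTriang_mor_zero₁₂ _ (inv_rot_of_distTriang _ hT))))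
    obtain ⟨q, hq⟩ : ∃ q : F.obj T.obj₃ ⟶ F.obj Y, φ - F.map f = F.map T.mor₂ ≫ q :=
      Triangle.yoneda_exact₂ _ hFT (φ - F.map f) (by
        change F.map T.mor₁ ≫ _ = 0
        rw [Preadditive.comp_sub, ← F.map_comp, ← hf, hp, sub_self])
    obtain ⟨q, rfl⟩ := (h₃ Y).2 q
    exact ⟨f + T.mor₂ ≫ q, by rw [F.map_add, F.map_comp, ← hq, add_sub_cancel]⟩

/-- Morphisms `X⟦a⟧ ⟶ Y` are morphisms `X ⟶ Y⟦-a⟧`, and `Y` ranges over all objects. -/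
lemma bijOut_shift {X : C} (hX : bijOut F X) (a : ℤ) : bijOut F (X⟦a⟧) := by
  intro Y
  let e := (shiftFunctorCompIsoId C a (-a) (add_neg_cancel a)).app X
  have comm : ∀ {U V : C} (f : U ⟶ V), F.map (f⟦-a⟧') =
      (F.commShiftIso (-a)).hom.app U ≫ (F.map f)⟦-a⟧' ≫ (F.commShiftIso (-a)).inv.app V :=
    fun {U V} f => by
      have h := (F.commShiftIso (-a)).hom.naturality f
      rw [← Category.assoc]
      refine Eq.trans ?_ (congrArg (· ≫ (F.commShiftIso (-a)).inv.app V) h)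
      rw [Category.assoc, Iso.hom_inv_id_app]
      exact (Category.comp_id _).symm
  constructor
  · intro f g hfg
    apply (shiftFunctor C (-a)).map_injective
    rw [← cancel_epi e.inv]
    apply (hX _).1
    rw [F.map_comp, F.map_comp, comm, comm, hfg]
  · intro φ
    obtain ⟨p, hp⟩ := (hX (Y⟦-a⟧)).2 (F.map e.inv ≫ (F.commShiftIso (-a)).hom.app _ ≫ φ⟦-a⟧' ≫
      (F.commShiftIso (-a)).inv.app Y)
    obtain ⟨f, hf⟩ := (shiftFunctor C (-a)).map_surjective (e.hom ≫ p)
    refine ⟨f, (shiftFunctor D (-a)).map_injective ?_⟩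
    rw [← cancel_mono ((F.commShiftIso (-a)).inv.app Y),
      ← cancel_epi ((F.commShiftIso (-a)).hom.app _), ← comm, hf, F.map_comp, hp,
      ← Category.assoc, ← F.map_comp, e.hom_inv_id]
    exact (congrArg (· ≫ _) (F.map_id _)).trans (Category.id_comp _)

/-- The objects `X` such that `F` is bijective on the morphisms out of `X` form a localizing
subcategory. -/
lemma isLocalizing_bijOut [∀ J : Type u, PreservesColimitsOfShape (Discrete J) F] :
    IsLocalizing.{u} (bijOut F) := by
  have hiso : (bijOut F).IsClosedUnderIsomorphisms := ⟨fun {X X'} e hX Y => by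
    constructor
    · intro f g hfg
      rw [← cancel_epi e.hom]
      apply (hX Y).1
      rw [F.map_comp, F.map_comp, hfg]
    · intro φ
      obtain ⟨f, hf⟩ := (hX Y).2 (F.map e.hom ≫ φ)
      exact ⟨e.inv ≫ f, by rw [F.map_comp, hf, ← Category.assoc, ← F.map_comp, e.inv_hom_id,
        F.map_id, Category.id_comp]⟩⟩
  refine ⟨hiso, ?_, fun J => ⟨fun X ⟨p⟩ Y => ?_⟩⟩
  · have : (bijOut F).IsStableUnderShift ℤ := ⟨fun a => ⟨fun X hX => bijOut_shift F hX a⟩⟩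
    have : (bijOut F).IsTriangulatedClosed₂ := .mk' (fun T hT h₁ h₃ =>
      bijOut_closed₂ F T hT h₁ h₃ (bijOut_shift F h₁ 1) (bijOut_shift F h₃ (-1)))
    have : (bijOut F).ContainsZero := ⟨⟨_, isZero_zero C, fun Y =>
      ⟨fun f g _ => (isZero_zero C).eq_of_src f g,
        fun φ => ⟨0, (F.map_isZero (isZero_zero C)).eq_of_src _ _⟩⟩⟩⟩
    constructor
  · constructor
    · intro f g hfg
      refine p.isColimit.hom_ext (fun j => (p.prop_diag_obj j Y).1 ?_)
      change F.map (p.ι.app j ≫ f) = F.map (p.ι.app j ≫ g)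
      rw [F.map_comp, F.map_comp, hfg]
    · intro φ
      choose f hf using fun j => (p.prop_diag_obj j Y).2 (F.map (p.ι.app j) ≫ φ)
      let c : Cocone p.diag := ⟨Y, Discrete.natTrans (fun j => f j)⟩
      refine ⟨p.isColimit.desc c, (isColimitOfPreserves F p.isColimit).hom_ext (fun j => ?_)⟩
      change F.map (p.ι.app j) ≫ F.map (p.isColimit.desc c) = F.map (p.ι.app j) ≫ φ
      rw [← hf, ← F.map_comp]
      exact congrArg F.map (p.isColimit.fac c j)

/-- The image of a localizing subcategory on which `F` is full is localizing. -/
lemma isLocalizing_image [HasCoproducts.{u} C] [∀ J : Type u, PreservesColimitsOfShape (Discrete J) F]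
    (P : ObjectProperty C) (hP : IsLocalizing.{u} P)
    (hF : ∀ X Y, P X → Function.Surjective (F.map : (X ⟶ Y) → _)) :
    IsLocalizing.{u} (fun Z : D => ∃ X : C, P X ∧ Nonempty (F.obj X ≅ Z)) := by
  have := hP.iso
  have := hP.triangulated
  let Q : ObjectProperty D := fun Z : D => ∃ X : C, P X ∧ Nonempty (F.obj X ≅ Z)
  change IsLocalizing Q
  have hiso : Q.IsClosedUnderIsomorphisms := ⟨fun {Z Z'} e ⟨X, hX, ⟨e'⟩⟩ => ⟨X, hX, ⟨e' ≪≫ e⟩⟩⟩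
  refine ⟨hiso, ?_, fun J => ⟨fun Z ⟨p⟩ => ?_⟩⟩
  · have : Q.IsStableUnderShift ℤ := ⟨fun a => ⟨fun Z ⟨X, hX, ⟨e⟩⟩ =>
      ⟨X⟦a⟧, P.le_shift a _ hX, ⟨(F.commShiftIso a).app X ≪≫ (shiftFunctor D a).mapIso e⟩⟩⟩⟩
    -- Fullness is what lifts the first map of the triangle to `C`. The cone of the lift lies in `P`
    -- and maps to the given third vertex.
    have : Q.IsTriangulatedClosed₃ := .mk' (fun T hT ⟨X₁, h₁, ⟨e₁⟩⟩ ⟨X₂, h₂, ⟨e₂⟩⟩ => by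
      obtain ⟨f, hf⟩ := hF X₁ X₂ h₁ (e₁.hom ≫ T.mor₁ ≫ e₂.inv)
      obtain ⟨X₃, g, h, mem⟩ := distinguished_cocone_triangle f
      obtain ⟨e, -⟩ := exists_iso_of_arrow_iso _ _ (F.map_distinguished _ mem) hT
        (Arrow.isoMk e₁ e₂ (by
          change e₁.hom ≫ T.mor₁ = F.map f ≫ e₂.hom
          rw [hf, Category.assoc, Category.assoc, e₂.inv_hom_id, Category.comp_id]))
      exact ⟨X₃, P.ext_of_isTriangulatedClosed₃ _ mem h₁ h₂, ⟨Triangle.π₃.mapIso e⟩⟩)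
    have : Q.IsTriangulatedClosed₂ := .of_isTriangulatedClosed₃
    have : Q.ContainsZero := by
      obtain ⟨X, hX, h⟩ := P.exists_prop_of_containsZero
      exact ⟨⟨F.obj X, F.map_isZero hX, X, h, ⟨Iso.refl _⟩⟩⟩
    constructor
  · have := hP.coproduct J
    choose X hX e using p.prop_diag_obj
    let K : Discrete J ⥤ C := Discrete.functor (fun j => X ⟨j⟩)
    refine ⟨colimit K, P.prop_of_isColimit (colimit.isColimit K) (fun j => hX _), ⟨?_⟩⟩
    exact (isColimitOfPreserves F (colimit.isColimit K)).coconePointsIsoOfNatIso p.isColimit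
      (Discrete.natIso (fun j => (e j).some))

end Devissage

end Coproducts

end CDG

end

/-! ### Direct sums of cdg modules -/

noncomputable section

namespace CDG

/-- Relations hold componentwise on finitely supported families. -/
lemma exists_dfinsupp {J : Type*} {α β : J → Type*} [∀ j, Zero (α j)] [∀ j, Zero (β j)]
    (x : Π₀ j, α j) (P : ∀ j, α j → β j → Prop) (h : ∀ j, ∃ b, P j (x j) b)
    (h₀ : ∀ j, P j 0 0) : ∃ y : Π₀ j, β j, ∀ j, P j (x j) (y j) := by
  classical
  choose f hf using h
  let g : ∀ j, α j → β j := fun j a => if a = 0 then 0 else f j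
  have hg : ∀ j, g j 0 = 0 := fun j => if_pos rfl
  refine ⟨x.mapRange g hg, fun j => ?_⟩
  rw [DFinsupp.mapRange_apply]
  by_cases hj : x j = 0
  · rw [hj, hg]
    exact h₀ j
  · simp only [g, if_neg hj]
    exact hf j

namespace Mod

variable {R : Type u} [CommRing R] {B : CDGAlgebra R} {J : Type u}

/-- The direct sum of a family of cdg modules. -/
def dsum (M : J → Mod B) : Mod B where
  X i := Π₀ j, (M j).X i
  smul h b := DFinsupp.mapRange.addMonoidHom (fun j => (M j).smulHom h b)
  smul_add h b x y := map_add _ x y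
  add_smul h b b' x := by ext j; exact (M j).add_smul h b b' (x j)
  one_smul x := by ext j; exact (M j).one_smul (x j)
  mul_smul h₁ h₂ h₃ h₄ a b x := by ext j; exact (M j).mul_smul h₁ h₂ h₃ h₄ a b (x j)
  d i := DFinsupp.mapRange.addMonoidHom (fun j => (M j).d i)
  leibniz {i _ _} h h₁ h₂ b x := by
    ext j
    refine ((M j).leibniz h h₁ h₂ b (x j)).trans ?_
    rw [DFinsupp.add_apply, DFinsupp.smul_apply]
    rfl
  d_d h x := by ext j; exact (M j).d_d h (x j)

variable (M : J → Mod B)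

/-- The projections of a direct sum. -/
def dproj (j : J) : dsum M ⟶ M j where
  f i := DFinsupp.evalAddMonoidHom j
  map_smul _ _ _ := rfl
  comm _ := rfl

variable [DecidableEq J]

/-- The inclusions into a direct sum. -/
def dinj (j : J) : M j ⟶ dsum M where
  f i := DFinsupp.singleAddHom (fun j => (M j).X i) j
  map_smul h b m := by
    exact (DFinsupp.mapRange_single (f := fun j => (M j).smulHom h b)
      (hf := fun j => map_zero _)).symm
  comm {i} m := by
    exact (DFinsupp.mapRange_single (f := fun j => (M j).d i) (hf := fun j => map_zero _)).symm

lemma addHom_ext {A : Type*} [AddMonoid A] {i : ℤ} {f g : (dsum M).X i →+ A}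
    (h : ∀ j (m : (M j).X i), f ((dinj M j).f i m) = g ((dinj M j).f i m)) : f = g :=
  DFinsupp.addHom_ext h

variable {M} {N : Mod B}

/-- The morphism out of a direct sum defined by its components. -/
def ddesc (f : ∀ j, M j ⟶ N) : dsum M ⟶ N where
  f i := DFinsupp.liftAddHom (fun j => (f j).f i)
  map_smul {i j k} h b m := by
    refine DFunLike.congr_fun (addHom_ext M (f := (DFinsupp.liftAddHom (fun j => (f j).f k)).comp
      ((dsum M).smulHom h b)) (g := (N.smulHom h b).comp (DFinsupp.liftAddHom (fun j' => (f j').f j)))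
      (fun j' x => ?_)) m
    change DFinsupp.liftAddHom (fun j => (f j).f k) ((dsum M).smul h b ((dinj M j').f j x)) =
      N.smul h b (DFinsupp.liftAddHom (fun j' => (f j').f j) (DFinsupp.single j' x))
    rw [← f_smul, DFinsupp.liftAddHom_apply_single]
    exact (DFinsupp.liftAddHom_apply_single _ _ _).trans (f_smul _ _ _ _)
  comm {i} m := by
    refine DFunLike.congr_fun (addHom_ext M (f := (DFinsupp.liftAddHom
      (fun j => (f j).f (i + 1))).comp ((dsum M).d i)) (g := (N.d i).comp (DFinsupp.liftAddHom
      (fun j => (f j).f i))) (fun j x => ?_)) m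
    change DFinsupp.liftAddHom (fun j => (f j).f (i + 1)) ((dsum M).d i ((dinj M j).f i x)) =
      N.d i (DFinsupp.liftAddHom (fun j => (f j).f i) (DFinsupp.single j x))
    rw [← f_d, DFinsupp.liftAddHom_apply_single]
    exact (DFinsupp.liftAddHom_apply_single _ _ _).trans (f_d _ _)

lemma dinj_ddesc (f : ∀ j, M j ⟶ N) (j : J) : dinj M j ≫ ddesc f = f j := by
  ext i m
  exact DFinsupp.liftAddHom_apply_single (fun j => (f j).f i) j m

lemma dsum_hom_ext {f g : dsum M ⟶ N} (h : ∀ j, dinj M j ≫ f = dinj M j ≫ g) : f = g := by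
  ext i m
  exact DFunLike.congr_fun (addHom_ext M (f := f.f i) (g := g.f i)
    (fun j x => congrArg (fun φ => Hom.f φ i x) (h j))) m

variable (M) in
/-- The direct sum is a coproduct. -/
def isColimitDsum : IsColimit (Cofan.mk (dsum M) (dinj M)) :=
  Cofan.IsColimit.mk _ (fun t => ddesc t.inj) (fun t j => dinj_ddesc t.inj j)
    (fun t m hm => dsum_hom_ext (fun j => (hm j).trans (dinj_ddesc t.inj j).symm))

/-- Morphisms which exhibit their target degreewise as a direct sum of their sources form a
coproduct. -/
lemma nonempty_isColimit_of_bijective (f : ∀ j, M j ⟶ N)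
    (h : ∀ i, Function.Bijective ((ddesc f).f i)) : Nonempty (IsColimit (Cofan.mk N f)) := by
  choose g hg using fun i => Function.bijective_iff_has_inverse.1 (h i)
  let e : dsum M ≅ N := isoMk (ddesc f) g (fun i m => (hg i).1 m) (fun i m => (hg i).2 m)
  refine ⟨(isColimitDsum M).ofIsoColimit (Cocone.ext e (fun ⟨j⟩ => ?_))⟩
  exact dinj_ddesc f j

/-- Homotopies between morphisms out of a direct sum are assembled from their components. -/
lemma homotopic_dsum {f : dsum M ⟶ N} (h : ∀ j, homotopic B (dinj M j ≫ f) 0) :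
    homotopic B f 0 := by
  have H := fun j => (h j).some
  refine ⟨⟨fun i => DFinsupp.liftAddHom (fun j => (H j).h i), fun {i j k} e e' b m => ?_,
    fun i m => ?_⟩⟩
  · refine DFunLike.congr_fun (addHom_ext M (f := (DFinsupp.liftAddHom (fun j => (H j).h k)).comp
      ((dsum M).smulHom e b)) (g := sgn i • (N.smulHom e' b).comp
        (DFinsupp.liftAddHom (fun j' => (H j').h j))) (fun j' x => ?_)) m
    change DFinsupp.liftAddHom (fun j => (H j).h k) ((dsum M).smul e b ((dinj M j').f _ x)) =
      sgn i • N.smul e' b (DFinsupp.liftAddHom (fun j' => (H j').h j) (DFinsupp.single j' x))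
    rw [← f_smul, DFinsupp.liftAddHom_apply_single]
    exact (DFinsupp.liftAddHom_apply_single _ _ _).trans ((H j').h_smul e e' b x)
  · refine DFunLike.congr_fun (addHom_ext M (f := f.f (i + 1) - Hom.f (0 : dsum M ⟶ N) (i + 1))
      (g := ((N.d i).comp (DFinsupp.liftAddHom (fun j => (H j).h i)) :
        (dsum M).X (i + 1) →+ N.X (i + 1)) + (DFinsupp.liftAddHom (fun j => (H j).h (i + 1))).comp ((dsum M).d (i + 1)))
        (fun j x => ?_)) m
    change f.f (i + 1) ((dinj M j).f (i + 1) x) - 0 =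
      N.d i (DFinsupp.liftAddHom (fun j => (H j).h i) (DFinsupp.single j x)) +
        DFinsupp.liftAddHom (fun j => (H j).h (i + 1)) ((dsum M).d (i + 1) ((dinj M j).f _ x))
    rw [← f_d, DFinsupp.liftAddHom_apply_single]
    refine ((H j).comm i x).trans (congrArg _ ?_)
    exact (DFinsupp.liftAddHom_apply_single (fun j => (H j).h (i + 1)) j
      ((M j).d (i + 1) x)).symm

omit [DecidableEq J] in
lemma mem_im_dsum {r : R} {i : ℤ} (x : (dsum M).X i) :
    x ∈ (dsum M).im r i ↔ ∀ j, (dproj M j).f i x ∈ (M j).im r i := by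
  constructor
  · exact fun h j => f_mem_im _ h
  · intro h
    obtain ⟨y, hy⟩ := exists_dfinsupp x (fun j a b => (M j).act r i b = a) h
      (fun j => map_zero _)
    exact ⟨y, DFinsupp.ext hy⟩

omit [DecidableEq J] in
lemma isNAcyclic_dsum {t : R} {n : ℕ} (h : ∀ j, IsNAcyclic t n (M j)) : IsNAcyclic t n (dsum M) := by
  intro p hp i x hx hdx
  obtain ⟨y, hy⟩ := exists_dfinsupp x (fun j a b => b ∈ (M j).im (t ^ p) i ∧
      a - (M j).d i b ∈ (M j).im (t ^ (p + 1)) (i + 1))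
    (fun j => h j p hp i _ ((mem_im_dsum _).1 hx j) ((mem_im_dsum _).1 hdx j))
    (fun j => ⟨zero_mem _, by rw [map_zero, sub_zero]; exact zero_mem _⟩)
  exact ⟨y, (mem_im_dsum _).2 (fun j => (hy j).1), (mem_im_dsum _).2 (fun j => (hy j).2)⟩

omit [DecidableEq J] in
lemma hasCoproductsOfShape : HasCoproductsOfShape J (Mod B) where
  has_colimit K := by
    classical
    have : HasColimit (Discrete.functor (K.obj ∘ Discrete.mk)) := ⟨_, isColimitDsum _⟩
    exact hasColimit_of_iso Discrete.natIsoFunctor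

end Mod

/-! ### Coproducts in the homotopy and derived categories. -/

section

variable {R : Type u} [CommRing R] {B : CDGAlgebra R} {J : Type u}

open Coproducts Mod

instance : HasCoproducts.{u} (Mod B) := fun _ => hasCoproductsOfShape

/-- The image of a direct sum in the homotopy category is a coproduct. -/
lemma nonempty_isColimit_hot [DecidableEq J] (M : J → Mod B) :
    Nonempty (IsColimit (Cofan.mk ((Hot.Q B).obj (dsum M)) (fun j => (Hot.Q B).map (dinj M j)))) := by
  have ex : ∀ {N : Hot B} (z : ∀ j, (Hot.Q B).obj (M j) ⟶ N),
      ∃ w : (Hot.Q B).obj (dsum M) ⟶ N, ∀ j, (Hot.Q B).map (dinj M j) ≫ w = z j := by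
    rintro ⟨N⟩ z
    choose f hf using fun j => (Hot.Q B).map_surjective (X := M j) (Y := N) (z j)
    exact ⟨(Hot.Q B).map (ddesc f), fun j => by
      rw [← hf]
      exact ((Hot.Q B).map_comp _ _).symm.trans (congrArg _ (dinj_ddesc f j))⟩
  have uniq : ∀ {N : Hot B} (w : (Hot.Q B).obj (dsum M) ⟶ N),
      (∀ j, (Hot.Q B).map (dinj M j) ≫ w = 0) → w = 0 := by
    rintro ⟨N⟩ w hw
    obtain ⟨f, rfl⟩ := (Hot.Q B).map_surjective (X := dsum M) (Y := N) w
    refine ((Hot.map_eq_iff f 0).2 (homotopic_dsum (fun j => (Hot.map_eq_iff _ _).1 ?_))).trans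
      ((Hot.Q B).map_zero _ _)
    exact ((Hot.Q B).map_comp _ _).trans ((hw j).trans ((Hot.Q B).map_zero _ _).symm)
  exact ⟨Cofan.IsColimit.mk _ (fun t => (ex t.inj).choose) (fun t j => (ex t.inj).choose_spec j)
    (fun t m hm => sub_eq_zero.1 (uniq (N := t.pt) _ (fun j => (Preadditive.comp_sub _ _ _).trans
      (sub_eq_zero.2 ((hm j).trans ((ex t.inj).choose_spec j).symm)))))⟩

instance : PreservesColimitsOfShape (Discrete J) (Hot.Q B) := by
  classical
  exact preservesColimitsOfShape_of_cofan _ (fun M => ⟨dsum M, dinj M, isColimitDsum M,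
    nonempty_isColimit_hot M⟩)

instance : HasCoproducts.{u} (Hot B) := fun J => hasCoproductsOfShape_of_essSurj (J := J) (Hot.Q B)

instance (t : R) (n : ℕ) : (acyclics B t n).IsClosedUnderColimitsOfShape (Discrete J) where
  colimitsOfShape_le := by
    rintro X ⟨p⟩
    classical
    let M : J → Mod B := fun j => (p.diag.obj ⟨j⟩).as
    have hM : acyclics B t n ((Hot.Q B).obj (dsum M)) :=
      isNAcyclic_dsum (M := M) (fun j => p.prop_diag_obj ⟨j⟩)
    exact (acyclics B t n).prop_of_iso ((nonempty_isColimit_hot M).some.coconePointsIsoOfNatIso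
      p.isColimit (Discrete.natIso (fun j => Iso.refl _))) hM

instance (t : R) (n : ℕ) : PreservesColimitsOfShape (Discrete J) (acyclics B t n).trW.Q :=
  preservesColimitsOfShape_of_isLocalization (acyclics B t n) _

instance (t : R) (n : ℕ) : PreservesColimitsOfShape (Discrete J) (toDer B t n) :=
  inferInstanceAs (PreservesColimitsOfShape (Discrete J) (Hot.Q B ⋙ (acyclics B t n).trW.Q))

instance (t : R) (n : ℕ) : (toDer B t n).EssSurj := by
  have := Localization.essSurj (acyclics B t n).trW.Q (acyclics B t n).trW
  exact inferInstanceAs (Hot.Q B ⋙ (acyclics B t n).trW.Q).EssSurj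

instance (t : R) (n : ℕ) : HasCoproducts.{u} (Der B t n) :=
  fun J => hasCoproductsOfShape_of_essSurj (J := J) (toDer B t n)

end

namespace CDGDeformation

open CDG.Mod

variable {k : Type u} [CommRing k] {n : ℕ} {A : DGAlgebra k} (An : CDGDeformation A n) {J : Type u}

/-- `t^n` of a direct sum is the direct sum of the `t^n M_j`: divisibility by `t^n` is tested
componentwise, with preimages chosen to be zero outside the support. -/
instance : PreservesColimitsOfShape (Discrete J) An.imF := by
  classical
  refine Coproducts.preservesColimitsOfShape_of_cofan _ (fun M => ⟨dsum M, dinj M, isColimitDsum M,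
    nonempty_isColimit_of_bijective _ (fun i => ?_)⟩)
  have key : ∀ (x : Π₀ j, (M j).im (tt k n ^ n) i) (j : J),
      (dproj M j).f i ((ddesc (fun j => An.imF.map (dinj M j))).f i x).1 = (x j).1 := by
    intro x j
    let φ : (Π₀ j, (M j).im (tt k n ^ n) i) →+ (M j).X i :=
      (Hom.f (dproj M j) i).comp (((dsum M).im (tt k n ^ n) i).subtype.comp
        ((ddesc (fun j => An.imF.map (dinj M j))).f i))
    let ψ : (Π₀ j, (M j).im (tt k n ^ n) i) →+ (M j).X i :=
      ((M j).im (tt k n ^ n) i).subtype.comp (DFinsupp.evalAddMonoidHom j)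
    refine DFunLike.congr_fun (f := φ) (g := ψ) (DFinsupp.addHom_ext (fun j' y => ?_)) x
    have e : (ddesc (fun j => An.imF.map (dinj M j))).f i (DFinsupp.single j' y) =
        (An.imF.map (dinj M j')).f i y := DFinsupp.liftAddHom_apply_single _ _ _
    change (dproj M j).f i ((ddesc (fun j => An.imF.map (dinj M j))).f i (DFinsupp.single j' y)).1 =
      ((DFinsupp.single j' y : Π₀ j, (M j).im (tt k n ^ n) i) j).1
    rw [e]
    change (DFinsupp.single j' y.1 : Π₀ j, (M j).X i) j = _
    by_cases h : j' = j
    · subst h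
      rw [DFinsupp.single_eq_same, DFinsupp.single_eq_same]
    · rw [DFinsupp.single_eq_of_ne (Ne.symm h), DFinsupp.single_eq_of_ne (Ne.symm h)]
      rfl
  constructor
  · intro x y hxy
    refine DFinsupp.ext (fun j => Subtype.ext ?_)
    have h := key x j
    rw [hxy, key y j] at h
    exact h.symm
  · rintro ⟨y, hy⟩
    obtain ⟨x, hx⟩ := exists_dfinsupp (β := fun j => (M j).im (tt k n ^ n) i) y
      (fun j a b => b.1 = a) (fun j => ⟨⟨(dproj M j).f i y, (mem_im_dsum y).1 hy j⟩, rfl⟩) (fun j => rfl)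
    exact ⟨x, Subtype.ext (DFinsupp.ext (fun j => (key x j).trans (hx j)))⟩

end CDGDeformation

end CDG

end

/-! ### Functors between derived categories -/

noncomputable section

namespace CDG

section Functors

variable {R R' : Type u} [CommRing R] [CommRing R'] {B : CDGAlgebra R} {B' : CDGAlgebra R'}
  {t : R} {t' : R'} {N N' : ℕ} (F : Mod B ⥤ Mod B')
  (hF : ∀ (M M' : Mod B) (f g : M ⟶ M'), Mod.homotopic B f g →
    Mod.homotopic B' (F.map f) (F.map g))
  (hc : ∀ (M M' : Mod B) (f : M ⟶ M'), Mod.IsNAcyclic t N (Mod.cone f) →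
    Mod.IsNAcyclic t' N' (Mod.cone (F.map f)))

/-- The compatibility of `hotMap` with the projection from modules. -/
def hotMapFac : Hot.Q B ⋙ hotMap F hF ≅ F ⋙ Hot.Q B' := Quotient.lift.isLift _ _ _

/-- The compatibility of `derMap` with the projection from the homotopy category. -/
def derMapFac : (acyclics B t N).trW.Q ⋙ derMap F hF hc ≅
    hotMap F hF ⋙ (acyclics B' t' N').trW.Q :=
  Localization.fac _ _ _

/-- The compatibility of `derMap` with the projection from modules. -/
def toDerFac : toDer B t N ⋙ derMap F hF hc ≅ F ⋙ toDer B' t' N' :=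
  Functor.associator _ _ _ ≪≫ Functor.isoWhiskerLeft (Hot.Q B) (derMapFac F hF hc) ≪≫
    (Functor.associator _ _ _).symm ≪≫ Functor.isoWhiskerRight (hotMapFac F hF) _ ≪≫
    Functor.associator _ _ _

instance : Localization.Lifting (acyclics B t N).trW.Q (acyclics B t N).trW
    (hotMap F hF ⋙ (acyclics B' t' N').trW.Q) (derMap F hF hc) := ⟨derMapFac F hF hc⟩

instance : CatCommSq (hotMap F hF) (acyclics B t N).trW.Q (acyclics B' t' N').trW.Q
    (derMap F hF hc) := ⟨(derMapFac F hF hc).symm⟩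

section

variable [F.CommShift ℤ]

instance : (hotMap F hF).CommShift ℤ :=
  inferInstanceAs ((CategoryTheory.Quotient.lift _ (F ⋙ Hot.Q B') _).CommShift ℤ)

instance : NatTrans.CommShift (hotMapFac F hF).hom ℤ :=
  Quotient.liftCommShift_compatibility _ _ _ _

instance derMapCommShift : (derMap F hF hc).CommShift ℤ :=
  Functor.commShiftOfLocalization (acyclics B t N).trW.Q (acyclics B t N).trW ℤ
    (hotMap F hF ⋙ (acyclics B' t' N').trW.Q) (derMap F hF hc)

instance : NatTrans.CommShift (derMapFac F hF hc).hom ℤ :=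
  NatTrans.commShift_iso_hom_of_localization (acyclics B t N).trW.Q (acyclics B t N).trW ℤ
    (hotMap F hF ⋙ (acyclics B' t' N').trW.Q) (derMap F hF hc)

/-- Distinguished triangles are by definition isomorphic to images of cone triangles, so
compatibility with cones at the level of modules is enough. -/
lemma hotMap_isTriangulated (h : ∀ (M M' : Mod B) (f : M ⟶ M'),
    Nonempty (F.mapTriangle.obj (Mod.coneTriangle f) ≅ Mod.coneTriangle (F.map f))) :
    (hotMap F hF).IsTriangulated where
  map_distinguished := by
    rintro T ⟨M, M', f, ⟨e⟩⟩
    refine ⟨F.obj M, F.obj M', F.map f, ⟨(hotMap F hF).mapTriangle.mapIso e ≪≫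
      ((Functor.mapTriangleCompIso (Hot.Q B) (hotMap F hF)).app (Mod.coneTriangle f)).symm ≪≫
      (Functor.mapTriangleIso (hotMapFac F hF)).app (Mod.coneTriangle f) ≪≫
      (Functor.mapTriangleCompIso F (Hot.Q B')).app (Mod.coneTriangle f) ≪≫
      (Hot.Q B').mapTriangle.mapIso (h M M' f).some⟩⟩

/-- Every arrow of the quotient comes, up to isomorphism, from an arrow of the homotopy category.
Exactness can thus be checked after composing with the quotient functor. -/
lemma derMap_isTriangulated (h : ∀ (M M' : Mod B) (f : M ⟶ M'),
    Nonempty (F.mapTriangle.obj (Mod.coneTriangle f) ≅ Mod.coneTriangle (F.map f))) :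
    (derMap F hF hc).IsTriangulated := by
  have := hotMap_isTriangulated F hF h
  have : (acyclics B t N).trW.Q.mapArrow.EssSurj :=
    Localization.essSurj_mapArrow _ (acyclics B t N).trW
  exact Functor.isTriangulated_of_precomp_iso (derMapFac F hF hc)

end

/-! ### Adjunctions on modules induce adjunctions on derived categories. -/

section Adjunction

variable {F} {G : Mod B' ⥤ Mod B} (adj : F ⊣ G)
  (hG : ∀ (M M' : Mod B') (f g : M ⟶ M'), Mod.homotopic B' f g →
    Mod.homotopic B (G.map f) (G.map g))
  (hd : ∀ (M M' : Mod B') (f : M ⟶ M'), Mod.IsNAcyclic t' N' (Mod.cone f) →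
    Mod.IsNAcyclic t N (Mod.cone (G.map f)))

/-- An adjunction between functors preserving homotopies descends to the homotopy categories. -/
def hotAdj : hotMap F hF ⊣ hotMap G hG :=
  Adjunction.mkOfUnitCounit
    { unit := Quotient.natTransLift _ (F := 𝟭 _) (G := hotMap F hF ⋙ hotMap G hG)
        { app := fun M => (Hot.Q B).map (adj.unit.app M)
          naturality := fun M M' f => by
            have := congrArg (Hot.Q B).map (adj.unit.naturality f)
            rw [Functor.map_comp, Functor.map_comp] at this
            exact this }
      counit := Quotient.natTransLift _ (F := hotMap G hG ⋙ hotMap F hF) (G := 𝟭 _)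
        { app := fun M => (Hot.Q B').map (adj.counit.app M)
          naturality := fun M M' f => by
            have := congrArg (Hot.Q B').map (adj.counit.naturality f)
            rw [Functor.map_comp, Functor.map_comp] at this
            exact this }
      left_triangle := by
        ext ⟨M⟩
        have := congrArg (Hot.Q B').map (adj.left_triangle_components M)
        rw [Functor.map_comp] at this
        refine Eq.trans ?_ this
        exact congrArg (_ ≫ ·) (Category.id_comp _)
      right_triangle := by
        ext ⟨M⟩
        have := congrArg (Hot.Q B).map (adj.right_triangle_components M)
        rw [Functor.map_comp] at this
        refine Eq.trans ?_ this
        exact congrArg (_ ≫ ·) (Category.id_comp _) }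

/-- An adjunction descends to the derived categories. -/
def derAdj : derMap F hF hc ⊣ derMap G hG hd :=
  (hotAdj hF adj hG).localization (acyclics B t N).trW.Q (acyclics B t N).trW
    (acyclics B' t' N').trW.Q (acyclics B' t' N').trW (derMap F hF hc) (derMap G hG hd)

-- The counit of the derived adjunction is, on objects coming from modules, the image of the counit
-- on modules. These objects exhaust the category up to isomorphism.
include hF hc adj in
lemma derMap_full_faithful (h : ∀ M, IsIso (adj.counit.app M)) :
    (derMap G hG hd).Full ∧ (derMap G hG hd).Faithful := by
  have h₁ : ∀ M : Hot B', IsIso ((derAdj hF hc adj hG hd).counit.app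
      ((acyclics B' t' N').trW.Q.obj M)) := by
    rintro ⟨M⟩
    have : IsIso ((hotAdj hF adj hG).counit.app ((Hot.Q B').obj M)) := by
      have := h M
      exact Functor.map_isIso (Hot.Q B') (adj.counit.app M)
    have e := Adjunction.localization_counit_app (hotAdj hF adj hG) (acyclics B t N).trW.Q
      (acyclics B t N).trW (acyclics B' t' N').trW.Q (acyclics B' t' N').trW (derMap F hF hc)
      (derMap G hG hd) ((Hot.Q B').obj M)
    exact (congrArg (fun f => IsIso f) e).mpr inferInstance
  have := Localization.essSurj (acyclics B' t' N').trW.Q (acyclics B' t' N').trW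
  have h₂ : IsIso (derAdj hF hc adj hG hd).counit := by
    have : ∀ X, IsIso ((derAdj hF hc adj hG hd).counit.app X) := fun X =>
      (NatTrans.isIso_app_iff_of_iso _ ((acyclics B' t' N').trW.Q.objObjPreimageIso X)).1 (h₁ _)
    exact NatIso.isIso_of_isIso_app _
  exact ⟨(derAdj hF hc adj hG hd).fullyFaithfulROfIsIsoCounit.full,
    (derAdj hF hc adj hG hd).fullyFaithfulROfIsIsoCounit.faithful⟩

end Adjunction

lemma preservesColimitsOfShape_derMap {J : Type u} [PreservesColimitsOfShape (Discrete J) F] :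
    PreservesColimitsOfShape (Discrete J) (derMap F hF hc) := by
  have : PreservesColimitsOfShape (Discrete J) (toDer B t N ⋙ derMap F hF hc) :=
    preservesColimitsOfShape_of_natIso (toDerFac F hF hc).symm
  exact Coproducts.preservesColimitsOfShape_of_essSurj (toDer B t N) _

end Functors

/-! ### Zero objects of the derived categories. -/

section toDer

variable {R : Type u} [CommRing R] {B : CDGAlgebra R} {t : R} {N : ℕ}

instance : (toDer B t N).CommShift ℤ :=
  inferInstanceAs ((Hot.Q B ⋙ (acyclics B t N).trW.Q).CommShift ℤ)

instance : (toDer B t N).Additive :=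
  inferInstanceAs ((Hot.Q B ⋙ (acyclics B t N).trW.Q).Additive)

open ZeroObject in
/-- The objects which become zero in the derived category. -/
lemma isZero_toDer_iff (M : Mod B) : IsZero ((toDer B t N).obj M) ↔ Mod.IsNAcyclic t N M := by
  constructor
  · intro h
    have h₀ : (acyclics B t N).trW.Q.map (𝟙 ((Hot.Q B).obj M)) =
        (acyclics B t N).trW.Q.map 0 := h.eq_of_src _ _
    -- The identity of `M` is killed by a denominator `s`, that is, `s = 0`. The triangle over a
    -- zero map splits, so `M` is a homotopy retract of the cone of `s`, which is acyclic;
    -- acyclicity passes to such retracts.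
    obtain ⟨X, s, hs, e⟩ := (MorphismProperty.map_eq_iff_precomp _ (acyclics B t N).trW _ _).1 h₀
    rw [comp_zero, Category.comp_id] at e
    subst e
    obtain ⟨Z, g, h', mem, hZ⟩ := hs
    have : Mono g := Triangle.mono₂ _ mem rfl
    obtain ⟨k, hk⟩ : ∃ k : Z ⟶ (Hot.Q B).obj M, 𝟙 _ = g ≫ k :=
      Triangle.yoneda_exact₂ _ mem (𝟙 _) (by exact zero_comp)
    obtain ⟨Z⟩ := Z
    obtain ⟨u, rfl⟩ := (Hot.Q B).map_surjective (X := M) (Y := Z) g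
    obtain ⟨v, rfl⟩ := (Hot.Q B).map_surjective (X := Z) (Y := M) k
    exact Mod.IsNAcyclic.of_homotopic (M := Z) hZ u v ((Hot.map_eq_iff _ _).1
      (((Hot.Q B).map_comp _ _).trans (hk.symm.trans ((Hot.Q B).map_id _).symm)))
  · intro h
    obtain ⟨z, hz⟩ : ∃ z : (Hot.Q B).obj M ⟶ 0, (acyclics B t N).trW z := by
      obtain ⟨Z, g, h', mem⟩ := distinguished_cocone_triangle (0 : (Hot.Q B).obj M ⟶ 0)
      exact ⟨0, Z, g, h', mem, (acyclics B t N).ext_of_isTriangulatedClosed₃ _ mem h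
        ((acyclics B t N).prop_of_isZero (isZero_zero _))⟩
    exact ((acyclics B t N).trW.Q.map_isZero (isZero_zero _)).of_iso
      (Localization.isoOfHom (acyclics B t N).trW.Q (acyclics B t N).trW z hz)

end toDer

end CDG

end

/-! ### Restriction of scalars and `Im t^n` commute with shifts and cones -/

noncomputable section

namespace CDG

namespace Mod

section Res

variable {R R' : Type u} [CommRing R] [CommRing R'] {B : CDGAlgebra R} {B' : CDGAlgebra R'}
  (φ : AlgHom B B')

lemma res_tr (M : Mod B') {i j : ℤ} (h : i = j) (m : M.X i) :
    ((res φ).obj M).tr h m = M.tr h m := by subst h; rfl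

/-- Restriction of scalars commutes with shifts. -/
def resShift (a : ℤ) :
    shiftFunctor (Mod B') a ⋙ res φ ≅ res φ ⋙ shiftFunctor (Mod B) a :=
  NatIso.ofComponents (fun M => isoMk (M := (res φ).obj (M⟦a⟧)) (N := ((res φ).obj M)⟦a⟧)
    ⟨fun i => AddMonoidHom.id (M.X (i + a)), fun _ _ _ => rfl, fun {i} m => by
      change sgn a • M.tr _ (M.d (i + a) m) = sgn a • ((res φ).obj M).tr _ (M.d (i + a) m)
      rw [res_tr]
      rfl⟩
    (fun _ m => m) (fun _ _ => rfl) (fun _ _ => rfl)) (fun _ => rfl)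

instance : (res φ).CommShift ℤ where
  commShiftIso := resShift φ
  commShiftIso_zero := by
    ext M i m
    exact ((res_tr φ M _ _).trans (M.tr_tr (show i + 0 = i by omega)
      (show i = i + 0 by omega) m)).symm
  commShiftIso_add a b := by
    ext M i m
    rw [Functor.CommShift.isoAdd_hom_app]
    exact ((res_tr φ M (show i + b + a = i + (a + b) by omega) _).trans
      (M.tr_tr (show i + (a + b) = i + b + a by omega) (show i + b + a = i + (a + b) by omega) m)).symm

/-- Restriction of scalars commutes with cones. -/
def resCone {M N : Mod B'} (f : M ⟶ N) : (res φ).obj (cone f) ≅ cone ((res φ).map f) :=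
  isoMk ⟨fun i => AddMonoidHom.id (N.X i × M.X (i + 1)), fun _ _ _ => rfl, fun _ => rfl⟩
    (fun _ m => m) (fun _ _ => rfl) (fun _ _ => rfl)

lemma res_coneTriangle {M N : Mod B'} (f : M ⟶ N) :
    Nonempty ((res φ).mapTriangle.obj (coneTriangle f) ≅ coneTriangle ((res φ).map f)) :=
  ⟨Triangle.isoMk _ _ (Iso.refl _) (Iso.refl _) (resCone φ f) rfl rfl rfl⟩

end Res

end Mod

namespace CDGDeformation

open CDG.Mod

variable {k : Type u} [CommRing k] {n : ℕ} {A : DGAlgebra k} (An : CDGDeformation A n)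

lemma imF_tr_val (M : Mod An.alg) {i j : ℤ} (h : i = j) (m : M.im (tt k n ^ n) i) :
    ((An.imF.obj M).tr h m : M.im (tt k n ^ n) j).1 = M.tr h m.1 := by subst h; rfl

/-- `Im t^n` commutes with shifts. -/
def imShift (a : ℤ) :
    shiftFunctor (Mod An.alg) a ⋙ An.imF ≅ An.imF ⋙ shiftFunctor (Mod A.toCDGAlgebra) a :=
  NatIso.ofComponents (fun M => isoMk (M := An.imF.obj (M⟦a⟧)) (N := (An.imF.obj M)⟦a⟧)
    ⟨fun i => AddMonoidHom.mk' (fun m : (M⟦a⟧).im (tt k n ^ n) i =>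
        (⟨m.1, by rw [← shift_im]; exact m.2⟩ : M.im (tt k n ^ n) (i + a))) (fun _ _ => rfl),
      fun h b m => Subtype.ext rfl, fun {i} m => Subtype.ext (by
        refine Eq.symm ((AddSubgroup.coe_zsmul (M.im (tt k n ^ n) (i + 1 + a)) _ _).trans ?_)
        exact congrArg (sgn a • ·) (imF_tr_val An M _ _))⟩
    (fun i (m : M.im (tt k n ^ n) (i + a)) =>
      (⟨m.1, by rw [shift_im]; exact m.2⟩ : (M⟦a⟧).im (tt k n ^ n) i))
    (fun _ _ => rfl) (fun _ _ => rfl)) (fun _ => rfl)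

instance : An.imF.CommShift ℤ where
  commShiftIso := An.imShift
  commShiftIso_zero := by
    ext M i m
    exact Subtype.ext ((imF_tr_val An M (show i = i + 0 by omega) _).trans
      (M.tr_tr (show i + 0 = i by omega) (show i = i + 0 by omega) m.1)).symm
  commShiftIso_add a b := by
    ext M i m
    rw [Functor.CommShift.isoAdd_hom_app]
    exact Subtype.ext ((imF_tr_val An M (show i + b + a = i + (a + b) by omega) _).trans
      (M.tr_tr (show i + (a + b) = i + b + a by omega)
        (show i + b + a = i + (a + b) by omega) m.1)).symm

/-- `Im t^n` commutes with cones. -/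
def imCone {M N : Mod An.alg} (f : M ⟶ N) : An.imF.obj (cone f) ≅ cone (An.imF.map f) :=
  isoMk
    ⟨fun i => AddMonoidHom.mk' (fun x : (cone f).im (tt k n ^ n) i =>
        ((⟨x.1.1, ((mem_cone_im f _ x.1.1 x.1.2).1 x.2).1⟩,
          ⟨x.1.2, ((mem_cone_im f _ x.1.1 x.1.2).1 x.2).2⟩) :
          N.im (tt k n ^ n) i × M.im (tt k n ^ n) (i + 1))) (fun _ _ => rfl),
      fun _ _ _ => cone_ext (Subtype.ext rfl) (Subtype.ext rfl),
      fun _ => cone_ext (Subtype.ext rfl) (Subtype.ext rfl)⟩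
    (fun i (x : N.im (tt k n ^ n) i × M.im (tt k n ^ n) (i + 1)) =>
      (⟨(x.1.1, x.2.1), (mem_cone_im f _ _ _).2 ⟨x.1.2, x.2.2⟩⟩ : (cone f).im (tt k n ^ n) i))
    (fun _ _ => rfl) (fun _ _ => rfl)

lemma im_coneTriangle {M N : Mod An.alg} (f : M ⟶ N) :
    Nonempty (An.imF.mapTriangle.obj (coneTriangle f) ≅ coneTriangle (An.imF.map f)) :=
  ⟨Triangle.isoMk _ _ (Iso.refl _) (Iso.refl _) (An.imCone f) rfl rfl rfl⟩

instance : An.iota.CommShift ℤ :=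
  derMapCommShift (B := An.trunc) (B' := An.alg) (t := tt k n) (t' := tt k n) (N := n)
    (N' := n + 1) (res (An.alg.proj (tt k n ^ n))) _ _

instance : An.iota.IsTriangulated :=
  derMap_isTriangulated _ _ _ (fun _ _ f => res_coneTriangle _ f)

instance : An.imT.CommShift ℤ := by unfold imT; infer_instance

instance : An.imT.IsTriangulated :=
  derMap_isTriangulated _ _ _ (fun _ _ f => An.im_coneTriangle f)

end CDGDeformation

end CDG

end

/-! ### The functors `Coker r` and `Ker r` -/

noncomputable section

namespace CDG

namespace Mod

variable {R : Type u} [CommRing R] {B : CDGAlgebra R} (r : R)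

/-- The class of an element in `Coker r`. -/
def cokMk (M : Mod B) (i : ℤ) : M.X i →+ ((cokF B r).obj M).X i := QuotientAddGroup.mk' (M.im r i)

lemma cokMk_surjective (M : Mod B) (i : ℤ) : Function.Surjective (cokMk r M i) :=
  QuotientAddGroup.mk_surjective

lemma cokMk_eq_zero_iff (M : Mod B) {i : ℤ} (m : M.X i) : cokMk r M i m = 0 ↔ m ∈ M.im r i :=
  QuotientAddGroup.eq_zero_iff m

lemma cokMk_smul (M : Mod B) {i j l : ℤ} (h : i + j = l) (b : B.X i) (m : M.X j) :
    ((cokF B r).obj M).smul h ((B.proj r).f i b) (cokMk r M j m) = cokMk r M l (M.smul h b m) :=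
  descend_smul (B.proj r) (M.coker r) (descends_proj (fun i m => by
    obtain ⟨m, rfl⟩ := QuotientAddGroup.mk_surjective m
    exact (QuotientAddGroup.eq_zero_iff _).2 (act_mem_im r m))) h b (cokMk r M j m)

lemma cokMk_act (M : Mod B) (s : R) {i : ℤ} (m : M.X i) :
    ((cokF B r).obj M).act s i (cokMk r M i m) = cokMk r M i (M.act s i m) :=
  cokMk_smul r M (zero_add i) (s • B.one) m

lemma cok_hom_ext {M : Mod B} {N : Mod (B.quot r)} {f g : (cokF B r).obj M ⟶ N}
    (h : ∀ i (m : M.X i), f.f i (cokMk r M i m) = g.f i (cokMk r M i m)) : f = g := by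
  ext i m
  obtain ⟨m, rfl⟩ := cokMk_surjective r M i m
  exact h i m

lemma res_act (N : Mod (B.quot r)) {i : ℤ} (m : N.X i) :
    ((res (B.proj r)).obj N).act r i m = 0 :=
  (congrArg (fun b => N.smul (zero_add i) b m)
    ((Submodule.Quotient.mk_eq_zero _).2 ⟨B.one, rfl⟩ : (B.proj r).f 0 (r • B.one) = 0)).trans
    (N.zero_smul _ _)

/-- `Coker r` is left adjoint to restriction of scalars. -/
def cokAdj : cokF B r ⊣ res (B.proj r) :=
  Adjunction.mkOfUnitCounit
    { unit :=
        { app := fun M => ⟨cokMk r M, fun h b m => (cokMk_smul r M h b m).symm, fun _ => rfl⟩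
          naturality := fun _ _ _ => rfl }
      counit :=
        { app := fun N =>
            ⟨fun i => QuotientAddGroup.lift (((res (B.proj r)).obj N).im r i) (AddMonoidHom.id (N.X i))
              (by rintro _ ⟨m, rfl⟩; exact res_act r N m),
            fun {i j l} h b m => by
              obtain ⟨b, rfl⟩ := Submodule.mkQ_surjective _ b
              obtain ⟨m, rfl⟩ := cokMk_surjective r _ j m
              exact congrArg _ (cokMk_smul r ((res (B.proj r)).obj N) h b m),
            fun {i} m => by
              obtain ⟨m, rfl⟩ := cokMk_surjective r _ i m
              rfl⟩
          naturality := fun M N f => cok_hom_ext r (fun i m => rfl) }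
      left_triangle := by
        ext M : 2
        exact cok_hom_ext r (fun i m => rfl)
      right_triangle := by
        ext N i m
        rfl }

instance isIso_cokAdj_counit (N : Mod (B.quot r)) : IsIso ((cokAdj r).counit.app N) :=
  (isoMk ((cokAdj r).counit.app N) (fun i m => cokMk r ((res (B.proj r)).obj N) i m)
    (fun i m => by
      obtain ⟨m, rfl⟩ := cokMk_surjective r _ i m
      rfl) (fun _ _ => rfl)).isIso_hom

lemma kerF_smul_val (M : Mod B) {i j l : ℤ} (h : i + j = l) (b : B.X i) (m : (M.act r j).ker) :
    (((kerF B r).obj M).smul h ((B.proj r).f i b) m : (M.act r l).ker).1 = M.smul h b m.1 :=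
  congrArg Subtype.val (descend_smul (B.proj r) (M.kernel r)
    (descends_proj (fun _ m => Subtype.ext m.2)) h b m)

lemma kerF_act_val (M : Mod B) (s : R) {i : ℤ} (m : (M.act r i).ker) :
    (((kerF B r).obj M).act s i m : (M.act r i).ker).1 = M.act s i m.1 :=
  kerF_smul_val r M (zero_add i) (s • B.one) m

/-- `Ker r` is right adjoint to restriction of scalars. -/
def kerAdj : res (B.proj r) ⊣ kerF B r :=
  Adjunction.mkOfUnitCounit
    { unit :=
        { app := fun N =>
            ⟨fun i => AddMonoidHom.mk' (fun m : N.X i =>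
              (⟨m, res_act r N m⟩ : (((res (B.proj r)).obj N).act r i).ker)) (fun _ _ => rfl),
            fun {i j l} h b m => by
              obtain ⟨b, rfl⟩ := Submodule.mkQ_surjective _ b
              exact Subtype.ext (kerF_smul_val r ((res (B.proj r)).obj N) h b
                ⟨m, res_act r N m⟩).symm,
            fun _ => rfl⟩
          naturality := fun _ _ _ => rfl }
      counit :=
        { app := fun M => ⟨fun i => (M.act r i).ker.subtype,
            fun h b m => kerF_smul_val r M h b m, fun _ => rfl⟩
          naturality := fun _ _ _ => rfl }
      left_triangle := rfl
      right_triangle := rfl }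

lemma homotopic_cokF (M M' : Mod B) (f g : M ⟶ M') (h : homotopic B f g) :
    homotopic (B.quot r) ((cokF B r).map f) ((cokF B r).map g) := by
  obtain ⟨H⟩ := h
  refine ⟨⟨fun i => QuotientAddGroup.map (M.im r (i + 1)) (M'.im r i) (H.h i)
    (fun _ hm => H.h_mem_im hm), fun {i j l} e e' b m => ?_, fun i m => ?_⟩⟩
  · obtain ⟨b, rfl⟩ := Submodule.mkQ_surjective _ b
    obtain ⟨m, rfl⟩ := cokMk_surjective r M _ m
    have h₁ := congrArg (QuotientAddGroup.map (M.im r (l + 1)) (M'.im r l) (H.h l)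
      (fun _ hm => H.h_mem_im hm)) (cokMk_smul r M e b m)
    refine h₁.trans ((congrArg (cokMk r M' l) (H.h_smul e e' b m)).trans ?_)
    rw [map_zsmul]
    exact congrArg (sgn i • ·) (cokMk_smul r M' e' b (H.h j m)).symm
  · obtain ⟨m, rfl⟩ := cokMk_surjective r M _ m
    exact congrArg (cokMk r M' (i + 1)) (H.comm i m)

lemma homotopic_kerF (M M' : Mod B) (f g : M ⟶ M') (h : homotopic B f g) :
    homotopic (B.quot r) ((kerF B r).map f) ((kerF B r).map g) := by
  obtain ⟨H⟩ := h
  refine ⟨⟨fun i => ((H.h i).comp (M.act r (i + 1)).ker.subtype).codRestrict (M'.act r i).ker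
    (fun m => by
      have hm : M.act r (i + 1) m.1 = 0 := m.2
      change M'.act r i (H.h i m.1) = 0
      rw [← H.h_act, hm, map_zero]), fun {i j l} e e' b m => ?_, fun i m => ?_⟩⟩
  · obtain ⟨b, rfl⟩ := Submodule.mkQ_surjective _ b
    refine Subtype.ext ((congrArg (H.h l) (kerF_smul_val r M e b m)).trans
      ((H.h_smul e e' b m.1).trans ?_))
    refine Eq.trans ?_ (AddSubgroup.coe_zsmul (M'.act r l).ker _ _).symm
    have hm : M'.act r j (H.h j m.1) = 0 := by
      have hm : M.act r (j + 1) m.1 = 0 := m.2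
      rw [← H.h_act, hm, map_zero]
    exact congrArg (sgn i • ·) (kerF_smul_val r M' e' b ⟨H.h j m.1, hm⟩).symm
  · exact Subtype.ext (H.comm i m.1)

/-- `Coker r` commutes with cones. -/
lemma exists_cone_cokF {M N : Mod B} (f : M ⟶ N) :
    Nonempty ((cokF B r).obj (cone f) ≅ cone ((cokF B r).map f)) := by
  let g (i : ℤ) : N.X i × M.X (i + 1) →+
      ((cokF B r).obj N).X i × ((cokF B r).obj M).X (i + 1) :=
    AddMonoidHom.prodMap (cokMk r N i) (cokMk r M (i + 1))
  have hg (i : ℤ) (x : N.X i × M.X (i + 1)) : g i x = 0 ↔ x ∈ (cone f).im r i := by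
    obtain ⟨x, y⟩ := x
    rw [mem_cone_im, ← cokMk_eq_zero_iff, ← cokMk_eq_zero_iff]
    exact Prod.ext_iff
  let u : (cokF B r).obj (cone f) ⟶ cone ((cokF B r).map f) :=
    ⟨fun i => QuotientAddGroup.lift ((cone f).im r i) (g i) (fun x hx => (hg i x).2 hx),
    fun {i j l} h b m => by
      obtain ⟨b, rfl⟩ := Submodule.mkQ_surjective _ b
      obtain ⟨⟨x, y⟩, rfl⟩ := cokMk_surjective r _ j m
      have h₁ := congrArg (QuotientAddGroup.lift ((cone f).im r l) (g l) (fun x hx => (hg l x).2 hx))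
        (cokMk_smul r (cone f) h b ((x, y) : N.X j × M.X (j + 1)))
      refine h₁.trans (cone_ext (cokMk_smul r N h b x).symm ?_)
      refine (map_zsmul (cokMk r M (l + 1)) _ _).trans ?_
      exact congrArg (sgn i • ·) (cokMk_smul r M _ b y).symm,
    fun {i} m => by
      obtain ⟨⟨x, y⟩, rfl⟩ := cokMk_surjective r _ i m
      exact cone_ext (map_add (cokMk r N (i + 1)) _ _) (map_neg (cokMk r M (i + 1 + 1)) _)⟩
  have hu (i : ℤ) : Function.Bijective (u.f i) := by
    constructor
    · refine (injective_iff_map_eq_zero (u.f i)).2 (fun m hm => ?_)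
      obtain ⟨x, rfl⟩ := cokMk_surjective r _ i m
      exact (cokMk_eq_zero_iff r _ _).2 ((hg i x).1 hm)
    · rintro ⟨x, y⟩
      obtain ⟨x, rfl⟩ := cokMk_surjective r _ _ x
      obtain ⟨y, rfl⟩ := cokMk_surjective r _ _ y
      exact ⟨cokMk r (cone f) i ((x, y) : N.X i × M.X (i + 1)), rfl⟩
  exact ⟨isoMk u (fun i => (Equiv.ofBijective _ (hu i)).symm)
    (fun i => (Equiv.ofBijective _ (hu i)).symm_apply_apply)
    (fun i => (Equiv.ofBijective _ (hu i)).apply_symm_apply)⟩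

lemma cone_act {M N : Mod B} (f : M ⟶ N) {i : ℤ} (x : N.X i) (y : M.X (i + 1)) :
    (cone f).act r i ((x, y) : N.X i × M.X (i + 1)) =
      ((N.act r i x, M.act r (i + 1) y) : N.X i × M.X (i + 1)) :=
  cone_ext rfl (show sgn 0 • M.act r (i + 1) y = _ by simp)

/-- `Ker r` commutes with cones. -/
lemma exists_cone_kerF {M N : Mod B} (f : M ⟶ N) :
    Nonempty ((kerF B r).obj (cone f) ≅ cone ((kerF B r).map f)) := by
  have h₁ (i : ℤ) (x : ((cone f).act r i).ker) : N.act r i x.1.1 = 0 ∧ M.act r (i + 1) x.1.2 = 0 :=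
    Prod.ext_iff.1 ((cone_act r f x.1.1 x.1.2).symm.trans x.2)
  exact ⟨isoMk
    ⟨fun i => AddMonoidHom.mk' (fun x : ((cone f).act r i).ker =>
        ((⟨x.1.1, (h₁ i x).1⟩, ⟨x.1.2, (h₁ i x).2⟩) :
          (N.act r i).ker × (M.act r (i + 1)).ker)) (fun _ _ => rfl),
      fun _ _ _ => cone_ext (Subtype.ext rfl) (Subtype.ext rfl),
      fun _ => cone_ext (Subtype.ext rfl) (Subtype.ext rfl)⟩
    (fun i (x : (N.act r i).ker × (M.act r (i + 1)).ker) =>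
      (⟨(x.1.1, x.2.1), (cone_act r f _ _).trans (Prod.ext x.1.2 x.2.2)⟩ : ((cone f).act r i).ker))
    (fun _ _ => rfl) (fun _ _ => rfl)⟩

end Mod

end CDG

end

/-! ### Acyclicity of `Coker t^n`, `Ker t^n` and `Im t^n` -/

noncomputable section

namespace CDG

/-- The kernel of a triangulated functor preserving coproducts is localizing. -/
lemma isLocalizing_isZero {C D : Type*} [Category* C] [Category* D] [Preadditive C]
    [HasZeroObject C] [HasShift C ℤ] [∀ a : ℤ, (shiftFunctor C a).Additive] [Pretriangulated C]
    [Preadditive D] [HasZeroObject D] [HasShift D ℤ] [∀ a : ℤ, (shiftFunctor D a).Additive]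
    [Pretriangulated D] (F : C ⥤ D) [F.CommShift ℤ] [F.IsTriangulated]
    [∀ J : Type u, PreservesColimitsOfShape (Discrete J) F] :
    IsLocalizing.{u} (fun X => IsZero (F.obj X)) := by
  let P : ObjectProperty C := fun X => IsZero (F.obj X)
  change IsLocalizing P
  have hiso : P.IsClosedUnderIsomorphisms := ⟨fun e hX => hX.of_iso (F.mapIso e.symm)⟩
  refine ⟨hiso, ?_, fun J => ⟨fun X ⟨p⟩ => ?_⟩⟩
  · have : P.IsStableUnderShift ℤ := ⟨fun a => ⟨fun X hX =>
      ((shiftFunctor D a).map_isZero hX).of_iso ((F.commShiftIso a).app X)⟩⟩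
    have : P.IsTriangulatedClosed₂ := .mk' (fun T hT h₁ h₃ =>
      Triangle.isZero₂_of_isZero₁₃ _ (F.map_distinguished _ hT) h₁ h₃)
    have : P.ContainsZero := ⟨⟨_, isZero_zero C, F.map_isZero (isZero_zero C)⟩⟩
    constructor
  · refine (IsZero.iff_id_eq_zero (F.obj X)).2 ?_
    refine (isColimitOfPreserves F p.isColimit).hom_ext (fun j => ?_)
    exact IsZero.eq_of_src (p.prop_diag_obj j) _ _

/-! ### Graded pieces of `Coker t^n` and `Ker t^n`. -/

namespace Mod

variable {R : Type u} [CommRing R] {B : CDGAlgebra R} {t : R} {n : ℕ}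

lemma IsNAcyclic.of_iso {N : ℕ} {M M' : Mod B} (h : IsNAcyclic t N M) (e : M ≅ M') :
    IsNAcyclic t N M' :=
  h.of_homotopic e.inv e.hom (by rw [e.inv_hom_id]; exact homotopic_refl _)

/-- For `p ≤ n` one has `t^n M ⊆ t^p M`, so membership in `t^p M` is not affected by dividing out
`t^n M`. -/
lemma cokMk_mem_im (M : Mod B) {p : ℕ} (hp : p ≤ n) {i : ℤ} (m : M.X i) :
    cokMk (t ^ n) M i m ∈ ((cokF B (t ^ n)).obj M).im (t ^ p) i ↔ m ∈ M.im (t ^ p) i := by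
  constructor
  · rintro ⟨m', hm⟩
    obtain ⟨m', rfl⟩ := cokMk_surjective (t ^ n) M i m'
    have h₁ : m - M.act (t ^ p) i m' ∈ M.im (t ^ n) i := by
      rw [← cokMk_eq_zero_iff (t ^ n), map_sub, ← cokMk_act, sub_eq_zero]
      exact hm.symm
    simpa using add_mem (im_anti t hp i h₁) (act_mem_im (t ^ p) m')
  · rintro ⟨m', rfl⟩
    rw [← cokMk_act]
    exact act_mem_im _ _

/-- `Coker t^n` detects the acyclicity of the first `n` graded pieces. -/
lemma isNAcyclic_cokF_iff (M : Mod B) :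
    IsNAcyclic t n ((cokF B (t ^ n)).obj M) ↔ IsNAcyclic t n M := by
  constructor
  · intro h p hp i x hx hdx
    obtain ⟨y, hy, hxy⟩ := h p hp i (cokMk (t ^ n) M _ x)
      ((cokMk_mem_im M hp.le x).2 hx) ((cokMk_mem_im M hp _).2 hdx)
    obtain ⟨y, rfl⟩ := cokMk_surjective (t ^ n) M i y
    exact ⟨y, (cokMk_mem_im M hp.le y).1 hy, (cokMk_mem_im M hp (x - M.d i y)).1 hxy⟩
  · intro h p hp i x hx hdx
    obtain ⟨x, rfl⟩ := cokMk_surjective (t ^ n) M _ x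
    obtain ⟨y, hy, hxy⟩ := h p hp i x ((cokMk_mem_im M hp.le x).1 hx)
      ((cokMk_mem_im M hp (M.d _ x)).1 hdx)
    exact ⟨cokMk (t ^ n) M i y, (cokMk_mem_im M hp.le y).2 hy,
      (cokMk_mem_im M hp (x - M.d i y)).2 hxy⟩

/-- If `m = t^p m'`, then `t^n m' = t^{n-p} m`. The preimage `m'` lies in the kernel of `t^n`
exactly when `m` is killed by `t^{n-p}`. -/
lemma mem_im_kerF (M : Mod B) {p : ℕ} (hp : p ≤ n) {i : ℤ} (m : (M.act (t ^ n) i).ker) :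
    m ∈ ((kerF B (t ^ n)).obj M).im (t ^ p) i ↔
      m.1 ∈ M.im (t ^ p) i ∧ M.act (t ^ (n - p)) i m.1 = 0 := by
  constructor
  · rintro ⟨m', rfl⟩
    have h : M.act (t ^ n) i m'.1 = 0 := m'.2
    have e : (((kerF B (t ^ n)).obj M).act (t ^ p) i m' : (M.act (t ^ n) i).ker).1 =
      M.act (t ^ p) i m'.1 := kerF_act_val _ M _ m'
    refine ⟨⟨m'.1, e.symm⟩, (congrArg (M.act _ i) e).trans ?_⟩
    rw [← act_mul, ← pow_add, Nat.sub_add_cancel hp, h]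
  · rintro ⟨⟨x, hx⟩, h⟩
    rw [← hx, ← act_mul, ← pow_add, Nat.sub_add_cancel hp] at h
    exact ⟨(⟨x, h⟩ : (M.act (t ^ n) i).ker), Subtype.ext ((kerF_act_val _ M _ _).trans hx)⟩

/-- `Ker t^n` preserves acyclicity of the graded pieces, when `t^{n+1} = 0` and the curvature is
divisible by `t`. -/
lemma IsNAcyclic.kerF {M : Mod B} (ht : t ^ (n + 1) = 0) (e : B.X 2) (he : t • e = B.curv)
    (hM : IsNAcyclic t (n + 1) M) : IsNAcyclic t n ((Mod.kerF B (t ^ n)).obj M) := by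
  -- `d^2 w = c w = t w'` with `w' = (c/t) w`: the failure of `d^2 = 0` gains one power of `t`, and
  -- `w'` is killed by every scalar killing `w`.
  have hdd {i : ℤ} (w : M.X i) : ∃ w', ∀ s, M.act s _ (M.d (i + 1) (M.d i w)) = M.act (s * t) _ w' ∧
      ∀ r, M.act r i w = 0 → M.act r (i + 1 + 1) w' = 0 := by
    refine ⟨M.smul (by omega) e w, fun s => ⟨?_, fun r hr => ?_⟩⟩
    · rw [M.d_d (by omega), ← he, smul_smul_eq_act, act_mul]
    · rw [← smul_act, hr, smul_zero]
  intro p hp i x hx hdx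
  -- With `K` the kernel of `t^n`, one has `t^p K = t^p M ∩ Ker t^{q+1}` and `t^{p+1} K = t^{p+1} M
  -- ∩ Ker t^q`. A primitive `y` of `x` modulo `t^{p+1} M` has to be corrected twice to respect both
  -- kernel conditions.
  obtain ⟨q, rfl⟩ : ∃ q, n = p + 1 + q := Nat.exists_eq_add_of_le hp
  have e₁ : p + 1 + q - p = q + 1 := by omega
  have e₂ : p + 1 + q - (p + 1) = q := by omega
  replace hx := (mem_im_kerF M hp.le _).1 hx
  replace hdx := (mem_im_kerF M hp _).1 hdx
  rw [e₁] at hx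
  rw [e₂] at hdx
  obtain ⟨x, hx₀⟩ := x
  obtain ⟨hx₁, hx₂⟩ : x ∈ M.im (t ^ p) (i + 1) ∧ M.act (t ^ (q + 1)) (i + 1) x = 0 := hx
  obtain ⟨hdx₁, hdx₂⟩ : M.d _ x ∈ M.im (t ^ (p + 1)) (i + 1 + 1) ∧
    M.act (t ^ q) (i + 1 + 1) (M.d _ x) = 0 := hdx
  have hzero (l : ℤ) (y : M.X l) : M.act (t ^ (p + 1 + q + 1)) l y = 0 := by rw [ht, act_zero]
  -- Acyclicity of the last piece `Gr^n M = t^n M`, applied to the cycle `t^s y`.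
  have hlast (l : ℤ) (y : M.X (l + 1)) (s : ℕ) (hs : s ≤ p + 1 + q)
      (hy : y ∈ M.im (t ^ (p + 1 + q - s)) (l + 1))
      (hdy : M.act (t ^ s) (l + 1 + 1) (M.d _ y) = 0) :
      ∃ w ∈ M.im (t ^ (p + 1 + q - s)) l, M.act (t ^ s) (l + 1) y = M.act (t ^ s) (l + 1) (M.d l w) := by
    obtain ⟨y, rfl⟩ := hy
    obtain ⟨_, ⟨w, rfl⟩, hw⟩ := hM (p + 1 + q) (Nat.lt_succ_self _) l
      (M.act (t ^ s) _ (M.act (t ^ (p + 1 + q - s)) _ y))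
      (by rw [← act_mul, ← pow_add, Nat.add_sub_cancel' hs]; exact act_mem_im _ _)
      (by rw [d_act, hdy]; exact zero_mem _)
    rw [ht, mem_im_zero, sub_eq_zero] at hw
    exact ⟨M.act (t ^ (p + 1 + q - s)) _ w, act_mem_im _ _, by
      rw [hw, ← d_act, ← act_mul, ← pow_add, Nat.add_sub_cancel' hs]⟩
  obtain ⟨y, hy, hz⟩ := hM p (by omega) i x hx₁ hdx₁
  obtain ⟨i, rfl⟩ : ∃ j, i = j + 1 := ⟨i - 1, by omega⟩
  -- First correction: `t^{q+1} y` is a cycle of `t^n M`, since `dy` is `x` minus a multiple of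
  -- `t^{p+1}` and `t^{n+1} = 0`. Subtracting `dw` makes `t^{q+1}` kill `y'`.
  obtain ⟨w, hw, hyw⟩ := hlast i y (q + 1) (by omega) (by
      rw [show p + 1 + q - (q + 1) = p by omega]; exact hy) (by
    obtain ⟨z, hz⟩ := hz
    have h : M.d _ y = x - M.act (t ^ (p + 1)) _ z := by rw [hz]; abel
    rw [h, map_sub, hx₂, ← act_mul, ← pow_add, show q + 1 + (p + 1) = p + 1 + q + 1 by omega,
      hzero, sub_zero])
  rw [show p + 1 + q - (q + 1) = p by omega] at hw
  obtain ⟨w, rfl⟩ := hw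
  set y' := y - M.d _ (M.act (t ^ p) _ w) with hy'
  have hy₁ : y' ∈ M.im (t ^ p) (i + 1) := sub_mem hy (d_mem_im (act_mem_im _ _))
  have hy₂ : M.act (t ^ (q + 1)) _ y' = 0 := by rw [hy', map_sub, hyw, sub_self]
  -- The correction changes `dy` by `d^2 w`, which is divisible by `t^{p+1}` because `w` is
  -- divisible by `t^p` and `c` by `t`.
  have hz' : x - M.d _ y' ∈ M.im (t ^ (p + 1)) (i + 1 + 1) := by
    obtain ⟨w', hw'⟩ := hdd w
    have h₁ : x - M.d _ y' = x - M.d _ y + M.act (t ^ (p + 1)) _ w' := by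
      rw [hy', map_sub, d_act, d_act, (hw' _).1, pow_succ]
      abel
    rw [h₁]
    exact add_mem hz (act_mem_im _ _)
  -- Second correction: `t^q (x - dy')` is a cycle of `t^n M`, because `t^q d^2 y' = (c/t) t^{q+1}
  -- y' = 0`. Then `v`, being divisible by `t^{p+1}`, does not disturb the first correction.
  obtain ⟨v, hv, hv'⟩ := hlast (i + 1) (x - M.d _ y') q (by omega) (by
      rw [show p + 1 + q - q = p + 1 by omega]; exact hz') (by
    obtain ⟨w', hw'⟩ := hdd y'
    rw [map_sub, map_sub, hdx₂, (hw' _).1, ← pow_succ, (hw' 1).2 _ hy₂, sub_zero])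
  rw [show p + 1 + q - q = p + 1 by omega] at hv
  have hu : M.act (t ^ (q + 1)) _ (y' + v) = 0 := by
    obtain ⟨v, rfl⟩ := hv
    rw [map_add, hy₂, ← act_mul, ← pow_add, show q + 1 + (p + 1) = p + 1 + q + 1 by omega,
      hzero, add_zero]
  have hu' : M.act (t ^ (p + 1 + q)) _ (y' + v) = 0 := by
    rw [show p + 1 + q = p + (q + 1) by omega, pow_add, act_mul, hu, map_zero]
  refine ⟨(⟨y' + v, hu'⟩ : (M.act (t ^ (p + 1 + q)) (i + 1)).ker), ?_, ?_⟩
  · refine (mem_im_kerF M hp.le _).2 ?_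
    rw [e₁]
    exact ⟨add_mem hy₁ (im_anti t (Nat.le_succ p) _ hv), hu⟩
  · refine (mem_im_kerF M hp _).2 ?_
    rw [e₂]
    have h₁ : x - M.d _ (y' + v) = x - M.d _ y' - M.d _ v := by rw [map_add]; abel
    change x - M.d _ (y' + v) ∈ _ ∧ M.act _ _ (x - M.d _ (y' + v)) = 0
    rw [h₁]
    exact ⟨sub_mem hz' (d_mem_im hv), by rw [map_sub, hv', sub_self]⟩

lemma IsNAcyclic.cone_cokF {M N : Mod B} (f : M ⟶ N) (h : IsNAcyclic t (n + 1) (Mod.cone f)) :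
    IsNAcyclic t n (Mod.cone ((cokF B (t ^ n)).map f)) :=
  ((isNAcyclic_cokF_iff _).2 (fun p hp => h p (by omega))).of_iso (exists_cone_cokF _ f).some

lemma IsNAcyclic.cone_kerF {M N : Mod B} (f : M ⟶ N) (ht : t ^ (n + 1) = 0) (e : B.X 2)
    (he : t • e = B.curv) (h : IsNAcyclic t (n + 1) (Mod.cone f)) :
    IsNAcyclic t n (Mod.cone ((Mod.kerF B (t ^ n)).map f)) :=
  (h.kerF ht e he).of_iso (exists_cone_kerF _ f).some

end Mod

/-! ### The adjoints of `ι_n`, and `T_n` as the kernel of the left one. -/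

namespace CDGDeformation

open CDG.Mod

variable {k : Type u} [CommRing k] {n : ℕ} {A : DGAlgebra k} (An : CDGDeformation A n)

/-- The functor `Coker t^n` on derived categories. -/
def iotaL : An.Dn ⥤ An.DnPred :=
  derMap (cokF An.alg (tt k n ^ n)) (homotopic_cokF _) (fun _ _ f h => h.cone_cokF f)

/-- The functor `Ker t^n` on derived categories. -/
def iotaR : An.Dn ⥤ An.DnPred :=
  derMap (kerF An.alg (tt k n ^ n)) (homotopic_kerF _)
    (fun _ _ f h => h.cone_kerF f (tt_pow k n) _ An.exists_curv_div.choose_spec)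

/-- The functor induced by `Coker t^n` is left adjoint to `ι_n`. -/
def iotaLAdj : An.iotaL ⊣ An.iota := derAdj (homotopic_cokF _) (fun _ _ f h => h.cone_cokF f) (cokAdj _) _ _

/-- The functor induced by `Ker t^n` is right adjoint to `ι_n`. -/
def iotaRAdj : An.iota ⊣ An.iotaR := derAdj _ _ (kerAdj _) (homotopic_kerF _)
  (fun _ _ f h => h.cone_kerF f (tt_pow k n) _ An.exists_curv_div.choose_spec)

lemma iota_full_faithful : An.iota.Full ∧ An.iota.Faithful :=
  derMap_full_faithful (homotopic_cokF _) (fun _ _ f h => h.cone_cokF f) (cokAdj _) _ _ (fun _ => inferInstance)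

/-- `Coker t^n` on derived categories is induced by `Coker t^n` on modules. -/
def toDerIotaL : toDer An.alg (tt k n) (n + 1) ⋙ An.iotaL ≅
    cokF An.alg (tt k n ^ n) ⋙ toDer An.trunc (tt k n) n := toDerFac _ _ _

/-- `Ker t^n` on derived categories is induced by `Ker t^n` on modules. -/
def toDerIotaR : toDer An.alg (tt k n) (n + 1) ⋙ An.iotaR ≅
    kerF An.alg (tt k n ^ n) ⋙ toDer An.trunc (tt k n) n := toDerFac _ _ _

/-- `Im t^n` on derived categories is induced by `Im t^n` on modules. -/
def toDerImT : toDer An.alg (tt k n) (n + 1) ⋙ An.imT ≅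
    An.imF ⋙ toDer A.toCDGAlgebra 0 1 := toDerFac _ _ _

/-- `ι_n` on derived categories is induced by restriction of scalars. -/
def toDerIota : toDer An.trunc (tt k n) n ⋙ An.iota ≅
    res (An.alg.proj (tt k n ^ n)) ⋙ toDer An.alg (tt k n) (n + 1) := toDerFac _ _ _

/-- `Coker t^n` vanishes in the quotient category exactly when its value is acyclic. By adjunction
this identifies `T_n` with the left orthogonal of the image of `ι_n`. -/
lemma T_iff (X : An.Dn) : An.T X ↔ IsZero (An.iotaL.obj X) := by
  have h (M : Mod An.alg) : IsZero (An.iotaL.obj ((toDer An.alg (tt k n) (n + 1)).obj M)) ↔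
      IsNAcyclic (tt k n) n ((cokF An.alg (tt k n ^ n)).obj M) := by
    rw [← isZero_toDer_iff]
    exact (An.toDerIotaL.app M).isZero_iff
  constructor
  · rintro ⟨M, hM, ⟨e⟩⟩
    exact ((h M).2 hM).of_iso (An.iotaL.mapIso e.symm)
  · intro hX
    refine ⟨(toDer An.alg (tt k n) (n + 1)).objPreimage X, ?_,
      ⟨(toDer An.alg (tt k n) (n + 1)).objObjPreimageIso X⟩⟩
    rw [← h]
    exact hX.of_iso (An.iotaL.mapIso (Functor.objObjPreimageIso _ X))

/-- `t^n` acts by zero on modules restricted from `A_{n-1}`. -/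
lemma isZero_imT_iota (X : An.DnPred) : IsZero (An.imT.obj (An.iota.obj X)) := by
  refine IsZero.of_iso ?_ ((An.iota ⋙ An.imT).mapIso
    ((toDer An.trunc (tt k n) n).objObjPreimageIso X).symm)
  set M := (toDer An.trunc (tt k n) n).objPreimage X
  refine IsZero.of_iso ?_ (An.imT.mapIso (An.toDerIota.app M) ≪≫ An.toDerImT.app _)
  refine (isZero_toDer_iff _).2 ((isNAcyclic_zero_one_iff _).2 (fun i x _ => ⟨0, ?_⟩))
  obtain ⟨_, x, rfl⟩ := x
  exact (map_zero _).trans (Subtype.ext (res_act _ M x).symm)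

instance (J : Type u) : PreservesColimitsOfShape (Discrete J) An.imT := 
  preservesColimitsOfShape_derMap _ _ _

/-- Since `t^{n+1} = 0`, the last graded piece is `t^n M` itself. -/
lemma isNAcyclic_succ_iff (M : Mod An.alg) : IsNAcyclic (tt k n) (n + 1) M ↔
    IsNAcyclic (tt k n) n M ∧ IsAcyclic (An.imF.obj M) := by
  have h : GrAcyclic (tt k n) M n ↔ IsAcyclic (An.imF.obj M) := by
    constructor
    · rintro h i ⟨x, hx⟩ hdx
      obtain ⟨y, hy, hxy⟩ := h i x hx (by
        rw [show M.d _ x = 0 from congrArg Subtype.val hdx]; exact zero_mem _)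
      rw [tt_pow, mem_im_zero, sub_eq_zero] at hxy
      exact ⟨⟨y, hy⟩, Subtype.ext hxy.symm⟩
    · intro h i x hx hdx
      rw [tt_pow, mem_im_zero] at hdx
      obtain ⟨y, hy⟩ := h i ⟨x, hx⟩ (Subtype.ext hdx)
      refine ⟨y.1, y.2, ?_⟩
      rw [tt_pow, mem_im_zero, sub_eq_zero]
      exact (congrArg Subtype.val hy).symm
  rw [← h]
  exact Nat.forall_lt_succ_right

/-- Membership in `T_n` controls the graded pieces below `n`, and `Im t^n` controls the last one. -/
lemma isZero_of_T {X : An.Dn} (h : An.T X) (h' : IsZero (An.imT.obj X)) : IsZero X := by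
  obtain ⟨M, hM, ⟨e⟩⟩ := h
  refine IsZero.of_iso ?_ e.symm
  refine (isZero_toDer_iff _).2 ((An.isNAcyclic_succ_iff M).2 ⟨(isNAcyclic_cokF_iff M).1 hM, ?_⟩)
  rw [← isNAcyclic_zero_one_iff, ← isZero_toDer_iff]
  exact h'.of_iso ((An.toDerImT.app M).symm ≪≫ An.imT.mapIso e)

/-- It is the kernel of a left adjoint of a triangulated functor, which is triangulated and
preserves coproducts. -/
lemma isLocalizing_T : IsLocalizing.{u} An.T := by
  let := An.iotaLAdj.leftAdjointCommShift ℤ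
  have := An.iotaLAdj.commShift_of_rightAdjoint ℤ
  have : An.iotaL.IsTriangulated := An.iotaLAdj.isTriangulated_leftAdjoint
  have h : An.T = fun X => IsZero (An.iotaL.obj X) := funext fun X => propext (An.T_iff X)
  rw [h]
  have (J : Type u) := An.iotaLAdj.leftAdjoint_preservesColimits.{u, u}.preservesColimitsOfShape
    (J := Discrete J)
  exact isLocalizing_isZero An.iotaL

end CDGDeformation

end CDG

end

/-! ### Modules representing the cohomology of `rM` -/

noncomputable section

namespace CDG

namespace Mod

variable {R : Type u} [CommRing R] {B : CDGAlgebra R} {r : R} {M N : Mod B}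

/-- A degree `-1` linear map defines a closed null homotopic morphism. -/
lemma exists_nullHom (h : ∀ i : ℤ, M.X (i + 1) →+ N.X i)
    (hs : ∀ {i j k : ℤ} (e : i + (j + 1) = k + 1) (e' : i + j = k) (b : B.X i) (m : M.X (j + 1)),
      h k (M.smul e b m) = sgn i • N.smul e' b (h j m)) :
    ∃ u : M ⟶ N, ∀ (i : ℤ) (m : M.X (i + 1)),
      u.f (i + 1) m = N.d i (h i m) + h (i + 1) (M.d (i + 1) m) := by
  let u (i : ℤ) : M.X i →+ N.X i := (N.tr (show i - 1 + 1 = i by omega)).comp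
    ((N.d (i - 1)).comp ((h (i - 1)).comp (M.tr (show i = i - 1 + 1 by omega)))) +
    (h i).comp (M.d i)
  have hu (i : ℤ) (m : M.X (i + 1)) : u (i + 1) m = N.d i (h i m) + h (i + 1) (M.d (i + 1) m) := by
    have key : ∀ (q : ℤ) (e : q + 1 = i + 1),
        N.tr e (N.d q (h q (M.tr e.symm m))) = N.d i (h i m) := by
      intro q e
      obtain rfl : q = i := by omega
      rfl
    exact congrArg (· + h (i + 1) (M.d (i + 1) m)) (key (i + 1 - 1) (by omega))
  refine ⟨⟨u, fun {i j k} e b m => ?_, fun {i} m => ?_⟩, hu⟩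
  · obtain ⟨j, rfl⟩ : ∃ l, j = l + 1 := ⟨j - 1, by omega⟩
    obtain ⟨k, rfl⟩ : ∃ l, k = l + 1 := ⟨k - 1, by omega⟩
    rw [hu, hu, hs e (by omega), map_zsmul, N.leibniz (show i + j = k by omega) (by omega) e,
      M.leibniz e (show i + 1 + (j + 1) = k + 1 + 1 by omega) (by omega), map_add, map_zsmul,
      hs _ (show i + 1 + j = k + 1 by omega), hs _ e, sgn_succ, N.smul_add]
    rw [_root_.smul_add, smul_smul, smul_smul, sgn_sq]
    module
  -- Closedness of `dh + hd` is not automatic in the curved setting. The terms `d^2 h = c h` and `h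
  -- d^2 = h c` agree because `c` has even degree.
  · obtain ⟨i, rfl⟩ : ∃ l, i = l + 1 := ⟨i - 1, by omega⟩
    rw [hu, hu, map_add, M.d_d (by omega), N.d_d (by omega),
      hs (show 2 + (i + 1) = i + 1 + 1 + 1 by omega) (by omega), sgn_two, one_zsmul]
    exact add_comm _ _

lemma exists_cokDesc (u : M ⟶ N) (hu : ∀ i (m : M.X i), u.f i (M.act r i m) = 0) :
    ∃ g : M.coker r ⟶ N, M.toCoker r ≫ g = u :=
  ⟨⟨fun i => QuotientAddGroup.lift (M.im r i) (u.f i) (by rintro _ ⟨m, rfl⟩; exact hu i m),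
    fun h b m => by
      obtain ⟨m, rfl⟩ := QuotientAddGroup.mk_surjective m
      exact f_smul u h b m,
    fun m => by
      obtain ⟨m, rfl⟩ := QuotientAddGroup.mk_surjective m
      exact f_d u m⟩, rfl⟩

/-- Morphisms out of the cone of the projection `M ⟶ M / rM`. -/
lemma exists_hom_cone (h : ∀ i : ℤ, M.X (i + 1) →+ N.X i)
    (hs : ∀ {i j k : ℤ} (e : i + (j + 1) = k + 1) (e' : i + j = k) (b : B.X i) (m : M.X (j + 1)),
      h k (M.smul e b m) = sgn i • N.smul e' b (h j m))
    (hr : ∀ i (m : M.X (i + 1)), N.d i (h i (M.act r _ m)) +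
      h (i + 1) (M.d (i + 1) (M.act r _ m)) = 0) :
    ∃ f : cone (M.toCoker r) ⟶ N, ∀ i (m : M.X (i + 1)),
      f.f i ((0, m) : (M.coker r).X i × M.X (i + 1)) = h i m := by
  -- By `hr` the morphism `dh + hd` kills `rM`, so it descends to `g` on `M / rM`. The sum of `g`
  -- and `h` is then closed on the cone.
  obtain ⟨u, hu⟩ := exists_nullHom h hs
  obtain ⟨g, hg⟩ := exists_cokDesc (r := r) u (fun i m => by
    obtain ⟨i, rfl⟩ : ∃ l, i = l + 1 := ⟨i - 1, by omega⟩
    rw [hu, hr])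
  refine ⟨⟨fun i => AddMonoidHom.coprod (g.f i) (h i), fun {i j k} e b x => ?_, fun {i} x => ?_⟩,
    fun i m => ?_⟩
  · change g.f k ((M.coker r).smul e b x.1) + h k (sgn i • M.smul _ b x.2) =
      N.smul e b (g.f j x.1 + h j x.2)
    rw [map_zsmul, hs _ e, smul_smul, sgn_sq, one_zsmul, N.smul_add, f_smul]
  · have h₁ : g.f (i + 1) ((M.toCoker r).f (i + 1) x.2) = u.f (i + 1) x.2 := by rw [← hg]; rfl
    change g.f (i + 1) ((M.coker r).d i x.1 + (M.toCoker r).f (i + 1) x.2) +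
      h (i + 1) (-M.d (i + 1) x.2) = N.d i (g.f i x.1 + h i x.2)
    rw [map_add, h₁, hu, map_neg, map_add, f_d]
    abel
  · change g.f i 0 + h i m = h i m
    rw [map_zero, zero_add]

/-- Null homotopies of morphisms out of the cone of the projection `M ⟶ M / rM`. -/
lemma homotopic_zero_of_cone (f : cone (M.toCoker r) ⟶ N) (k : ∀ i : ℤ, M.X (i + 1 + 1) →+ N.X i)
    (ks : ∀ {i j l : ℤ} (e : i + (j + 1 + 1) = l + 1 + 1) (e' : i + j = l) (b : B.X i)
      (m : M.X (j + 1 + 1)), k l (M.smul e b m) = N.smul e' b (k j m))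
    (hk : ∀ i (m : M.X (i + 1 + 1)),
      f.f (i + 1) ((0, M.act r _ m) : (M.coker r).X (i + 1) × M.X (i + 1 + 1)) -
        N.d i (k i (M.act r _ m)) + k (i + 1) (M.d _ (M.act r _ m)) = 0) :
    homotopic B f 0 := by
  let φ (i : ℤ) : M.X (i + 1) →+ N.X i := (f.f i).comp (AddMonoidHom.inr ((M.coker r).X i) _)
  have φs {i j l : ℤ} (e : i + (j + 1) = l + 1) (e' : i + j = l) (b : B.X i) (m : M.X (j + 1)) :
      φ l (M.smul e b m) = sgn i • N.smul e' b (φ j m) := by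
    have h₁ := f_smul f e' b ((0, m) : (M.coker r).X j × M.X (j + 1))
    have h₂ : (cone (M.toCoker r)).smul e' b ((0, m) : (M.coker r).X j × M.X (j + 1)) =
        ((0, sgn i • M.smul e b m) : (M.coker r).X l × M.X (l + 1)) :=
      cone_ext ((M.coker r).smul_zero e' b) rfl
    have h₃ : sgn i • φ l (M.smul e b m) = N.smul e' b (φ j m) := by
      rw [← map_zsmul]
      exact (congrArg (f.f l) h₂).symm.trans h₁
    rw [← h₃, smul_smul, sgn_sq, one_zsmul]
  -- If `k` is the homotopy on the summand `M[1]`, the homotopy equation there forces `φ - dk + kd`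
  -- on `M / rM`. The hypothesis `hk` is what lets this map descend to the quotient.
  let v (i : ℤ) : M.X (i + 1) →+ N.X i := φ i - (N.tr (show i - 1 + 1 = i by omega)).comp
    ((N.d (i - 1)).comp ((k (i - 1)).comp (M.tr (show i + 1 = i - 1 + 1 + 1 by omega)))) +
    (k i).comp (M.d (i + 1))
  have hv (i : ℤ) (m : M.X (i + 1 + 1)) :
      v (i + 1) m = φ (i + 1) m - N.d i (k i m) + k (i + 1) (M.d _ m) := by
    have key : ∀ (q : ℤ) (e : q + 1 = i + 1),
        N.tr e (N.d q (k q (M.tr (show i + 1 + 1 = q + 1 + 1 by omega) m))) = N.d i (k i m) := by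
      intro q e
      obtain rfl : q = i := by omega
      rfl
    exact congrArg (fun z => φ (i + 1) m - z + k (i + 1) (M.d _ m)) (key (i + 1 - 1) (by omega))
  have vs {i j l : ℤ} (e : i + (j + 1) = l + 1) (e' : i + j = l) (b : B.X i) (m : M.X (j + 1)) :
      v l (M.smul e b m) = sgn i • N.smul e' b (v j m) := by
    obtain ⟨j, rfl⟩ : ∃ l, j = l + 1 := ⟨j - 1, by omega⟩
    obtain ⟨l, rfl⟩ : ∃ q, l = q + 1 := ⟨l - 1, by omega⟩
    rw [hv, hv, φs e e', ks e (by omega), N.leibniz (show i + j = l by omega) (by omega) e',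
      M.leibniz e (show i + 1 + (j + 1 + 1) = l + 1 + 1 + 1 by omega) (by omega), map_add, map_zsmul,
      ks _ (show i + 1 + j = l + 1 by omega), ks _ e', N.smul_add, N.smul_sub, _root_.smul_add,
      _root_.smul_sub]
    abel
  let V (i : ℤ) : (M.coker r).X (i + 1) →+ N.X i := QuotientAddGroup.lift (M.im r (i + 1)) (v i) (by
    rintro _ ⟨m, rfl⟩
    obtain ⟨i, rfl⟩ : ∃ l, i = l + 1 := ⟨i - 1, by omega⟩
    exact (hv i _).trans (hk i m))
  refine ⟨⟨fun i => AddMonoidHom.coprod (V i) (k i), fun {i j l} e e' b x => ?_, fun i x => ?_⟩⟩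
  · obtain ⟨n, m⟩ := x
    obtain ⟨n, rfl⟩ := QuotientAddGroup.mk_surjective n
    change v l (M.smul e b n) + k l (sgn i • M.smul (by omega) b m) =
      sgn i • N.smul e' b (v j n + k j m)
    rw [vs e e', map_zsmul, ks _ e', N.smul_add, _root_.smul_add]
  · obtain ⟨n, m⟩ := x
    obtain ⟨n, rfl⟩ := QuotientAddGroup.mk_surjective n
    change f.f (i + 1) (((n : M.X (i + 1) ⧸ M.im r (i + 1)), m) :
      (M.coker r).X (i + 1) × M.X (i + 1 + 1)) - 0 = N.d i (v i n + k i m) +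
        (v (i + 1) (M.d (i + 1) n + m) + k (i + 1) (-M.d _ m))
    -- The value of `f` on the summand `M / rM` is recovered from `φ` by closedness of `f` at `(0,
    -- n)`, whose differential is `(n, -dn)`.
    have h₁ : N.d i (φ i n) = f.f (i + 1) (((n : M.X (i + 1) ⧸ M.im r (i + 1)), m) :
        (M.coker r).X (i + 1) × M.X (i + 1 + 1)) - φ (i + 1) m - φ (i + 1) (M.d _ n) := by
      have h₂ : (((n : M.X (i + 1) ⧸ M.im r (i + 1)), m) :
          (M.coker r).X (i + 1) × M.X (i + 1 + 1)) =
          (show (M.coker r).X (i + 1) × M.X (i + 1 + 1) from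
            (cone (M.toCoker r)).d i ((0, n) : (M.coker r).X i × M.X (i + 1))) +
            ((0, m) : (M.coker r).X (i + 1) × M.X (i + 1 + 1)) +
            ((0, M.d _ n) : (M.coker r).X (i + 1) × M.X (i + 1 + 1)) := by
        refine Prod.ext ?_ ?_
        · change (M.toCoker r).f _ n = (M.coker r).d i 0 + (M.toCoker r).f _ n + 0 + 0
          rw [map_zero, add_zero, add_zero, zero_add]
        · change m = -M.d _ n + m + M.d _ n
          abel
      rw [sub_sub, eq_sub_iff_add_eq]
      refine Eq.trans ?_ (congrArg (f.f (i + 1)) h₂).symm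
      refine Eq.trans ?_ (map_add (f.f (i + 1)) _ _).symm
      refine Eq.trans ?_ (congrArg (· + _) (map_add (f.f (i + 1)) _ _).symm)
      refine Eq.trans ?_ (congrArg (· + _ + _) (f_d f _).symm)
      exact (add_assoc _ _ _).symm
    obtain ⟨i, rfl⟩ : ∃ l, i = l + 1 := ⟨i - 1, by omega⟩
    have h₂ : N.d (i + 1) (N.d i (k i n)) = k (i + 1 + 1) (M.d _ (M.d _ n)) := by
      rw [M.d_d (by omega), N.d_d (by omega), ks _ (by omega)]
    rw [hv, hv]
    simp only [map_add, map_sub, map_neg]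
    rw [h₁, h₂]
    abel

end Mod

end CDG

end

/-! ### The modules `Γ_n` and their cones -/

noncomputable section

namespace CDG

namespace Mod

variable {R : Type u} [CommRing R] {B : CDGAlgebra R}

/-- The element `γ` of degree `e + 1` of `G` is universal, up to homotopy, among the elements `x`
of this degree with `r • d x = 0`, considered up to the addition of elements `y` such that
`r • y` is the differential of a multiple of `r`: the morphisms from `G` to `M` up to homotopy are
the cohomology classes of `rM`. -/
structure IsRep (r : R) (G : Mod B) {e : ℤ} (γ : G.X (e + 1)) : Prop where
  closed : G.act r _ (G.d (e + 1) γ) = 0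
  lift : ∀ (M : Mod B) (x : M.X (e + 1)), M.act r _ (M.d _ x) = 0 →
    ∃ f : G ⟶ M, M.act r _ (f.f _ γ) = M.act r _ x
  null : ∀ (M : Mod B) (f : G ⟶ M) (w : M.X e), M.act r _ (f.f _ γ) = M.act r _ (M.d e w) →
    homotopic B f 0

/-- A module which is free on a closed generator represents cohomology. -/
lemma isRep_of_bijective {G : Mod B} {e : ℤ} (γ : G.X (e + 1)) (hγ : G.d _ γ = 0)
    (hb : ∀ {i j : ℤ} (h : i + (e + 1) = j), Function.Bijective (fun b : B.X i => G.smul h b γ)) :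
    IsRep (1 : R) G γ where
  closed := by rw [hγ, map_zero]
  lift M x hx := by
    rw [act_one] at hx
    -- `β` is the coordinate with respect to the generator. The morphism is `b γ ↦ b x`, which
    -- commutes with `d` because both `γ` and `x` are closed.
    choose β hβ using fun (i : ℤ) (m : G.X i) => (hb (show i - (e + 1) + (e + 1) = i by omega)).2 m
    have hβ' {i j : ℤ} (h : i + (e + 1) = j) (b : B.X i) (h' : j - (e + 1) + (e + 1) = j) :
        M.smul h' (β j (G.smul h b γ)) x = M.smul h b x := by
      obtain rfl : i = j - (e + 1) := by omega
      exact congrArg (fun b => M.smul h' b x) ((hb h).1 (hβ j _))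
    refine ⟨⟨fun i => AddMonoidHom.mk' (fun m => M.smul (by omega) (β i m) x) (fun m m' => ?_),
      fun {i j l} h b m => ?_, fun {i} m => ?_⟩, ?_⟩
    · rw [← M.add_smul, ← hβ' (by omega) (β i m + β i m') (by omega), G.add_smul]
      exact congrArg (fun m => M.smul _ (β i m) x)
        (congrArg₂ (· + ·) (hβ i m).symm (hβ i m').symm)
    · obtain ⟨c, rfl⟩ := (hb (show j - (e + 1) + (e + 1) = j by omega)).2 m
      simp only [AddMonoidHom.mk'_apply]
      rw [hβ', ← G.mul_smul (show i + (j - (e + 1)) = l - (e + 1) by omega) (by omega), hβ',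
        M.mul_smul _ _ (by omega) h]
    · obtain ⟨c, rfl⟩ := (hb (show i - (e + 1) + (e + 1) = i by omega)).2 m
      simp only [AddMonoidHom.mk'_apply]
      rw [hβ', G.leibniz _ (show i - (e + 1) + 1 + (e + 1) = i + 1 by omega) (by omega), hγ,
        G.smul_zero, _root_.smul_zero, add_zero, hβ', M.leibniz _ (by omega) (by omega), hx,
        M.smul_zero, _root_.smul_zero, add_zero]
    · rw [act_one, act_one]
      have h₁ := hβ' (zero_add (e + 1)) B.one (by omega)
      rw [G.one_smul, M.one_smul] at h₁
      exact h₁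
  null M f w hw := by
    rw [act_one, act_one] at hw
    choose β hβ using fun (i : ℤ) (m : G.X i) => (hb (show i - (e + 1) + (e + 1) = i by omega)).2 m
    have hβ' {i j l : ℤ} (h : i + (e + 1) = j) (b : B.X i) (h' : j - (e + 1) + e = l) :
        M.smul h' (β j (G.smul h b γ)) w = M.smul (by omega) b w := by
      obtain rfl : i = j - (e + 1) := by omega
      exact congrArg (fun b => M.smul h' b w) ((hb h).1 (hβ j _))
    -- The homotopy is `b γ ↦ ± b w` with the sign of the degree of `b`, here `i - e`. It cancels
    -- the terms in `d b` and leaves `b dw = b f(γ)`.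
    refine ⟨⟨fun i => AddMonoidHom.mk' (fun m => sgn (i - e) •
      M.smul (show i + 1 - (e + 1) + e = i by omega) (β (i + 1) m) w) (fun m m' => ?_),
      fun {i j l} h h' b m => ?_, fun i m => ?_⟩⟩
    · rw [← _root_.smul_add, ← M.add_smul,
        ← hβ' (show i + 1 - (e + 1) + (e + 1) = i + 1 by omega) (β (i + 1) m + β (i + 1) m')
          (by omega), G.add_smul]
      exact congrArg (fun m => sgn (i - e) • M.smul _ (β (i + 1) m) w)
        (congrArg₂ (· + ·) (hβ (i + 1) m).symm (hβ (i + 1) m').symm)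
    · obtain ⟨c, rfl⟩ := (hb (show j + 1 - (e + 1) + (e + 1) = j + 1 by omega)).2 m
      simp only [AddMonoidHom.mk'_apply]
      rw [hβ', ← G.mul_smul (show i + (j + 1 - (e + 1)) = l + 1 - (e + 1) by omega) (by omega), hβ',
        M.mul_smul _ _ (by omega) h', smul_zsmul, smul_smul, ← sgn_add]
      congr 2
      omega
    · obtain ⟨c, rfl⟩ := (hb (show i + 1 - (e + 1) + (e + 1) = i + 1 by omega)).2 m
      simp only [AddMonoidHom.mk'_apply, zero_f, sub_zero]
      rw [f_smul, hβ', G.leibniz _ (show i + 1 - (e + 1) + 1 + (e + 1) = i + 1 + 1 by omega)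
        (by omega), hγ, G.smul_zero, _root_.smul_zero, add_zero, hβ', hw, map_zsmul,
        M.leibniz _ (show i + 1 - (e + 1) + 1 + e = i + 1 by omega)
          (show i + 1 - (e + 1) + (e + 1) = i + 1 by omega),
        show i + 1 - e = i - e + 1 by omega, sgn_succ,
        congrArg sgn (show i + 1 - (e + 1) = i - e by omega), _root_.smul_add, smul_smul, sgn_sq]
      module

end Mod

namespace CDGDeformation

open CDG.Mod

variable {k : Type u} [CommRing k] {n : ℕ} {A : DGAlgebra k} (An : CDGDeformation A n)
  (e : An.alg.X 2) (he : tt k n • e = An.alg.curv)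

/-- The cone of the projection `Γ_n ⟶ Γ_n / t^n Γ_n`, that is, `G_n[1]`. -/
def gammaCone : Mod An.alg := cone ((An.gamma e he).toCoker (tt k n ^ n))

/-- The element `(1, 0)` of `Γ_n`. -/
def gammaOne : (An.gamma e he).X 0 := ((An.alg.one, 0) : An.alg.X 0 × An.trunc.X (0 + 1))

/-- The generator of the cone of `Γ_n ⟶ Γ_n / t^n Γ_n`. -/
def gammaGen : (An.gammaCone e he).X (-2 + 1) :=
  ((0, An.gammaOne e he) : ((An.gamma e he).coker (tt k n ^ n)).X (-1) × (An.gamma e he).X 0)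

lemma trunc_smul_eq_zero {i : ℤ} (a : An.trunc.X i) : tt k n ^ n • a = 0 := by
  obtain ⟨a, rfl⟩ := Submodule.mkQ_surjective _ a
  exact (Submodule.Quotient.mk_eq_zero _).2 ⟨a, rfl⟩

/-- `t^n` annihilates `A_{n-1}`, so only the `A_n`-component of `Γ_n` matters for conditions on `t^n
Γ_n`. -/
lemma gamma_act {i : ℤ} (α : An.alg.X i) (a : An.trunc.X (i + 1)) :
    (An.gamma e he).act (tt k n ^ n) i ((α, a) : An.alg.X i × An.trunc.X (i + 1)) =
      ((tt k n ^ n • α, 0) : An.alg.X i × An.trunc.X (i + 1)) := by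
  obtain ⟨a, rfl⟩ := Submodule.mkQ_surjective _ a
  refine Prod.ext ?_ ?_
  · change An.alg.mul (zero_add i) (tt k n ^ n • An.alg.one) α = _
    rw [map_smul, LinearMap.smul_apply, An.alg.one_mul]
  · change sgn 0 • An.pr _ (An.alg.mul (show 0 + (i + 1) = i + 1 by omega)
      (tt k n ^ n • An.alg.one) a) = 0
    rw [map_smul, LinearMap.smul_apply, An.alg.one_mul, sgn_zero, one_zsmul]
    exact An.trunc_smul_eq_zero (An.pr _ a)

lemma gamma_d_act {i : ℤ} (α : An.alg.X i) (a : An.trunc.X (i + 1)) :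
    ((An.gamma e he).d i ((An.gamma e he).act (tt k n ^ n) i
      ((α, a) : An.alg.X i × An.trunc.X (i + 1)))).1 = tt k n ^ n • An.alg.d i α := by
  refine (congrArg (fun x : An.alg.X i × An.trunc.X (i + 1) => An.alg.d i x.1 + An.mulT _ x.2)
    (An.gamma_act e he α a)).trans ?_
  simp

/-- On `t^n Γ_n` the first component of the differential is that of `A_n`, with `d 1 = 0`. A
morphism out of the cone only has to satisfy its equations on `t^n Γ_n`, where multiplication of `α`
into an element of `M` is enough to define both morphisms and null homotopies. -/
lemma isRep_gammaCone : IsRep (tt k n ^ n) (An.gammaCone e he) (An.gammaGen e he) where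
  closed := by
    have key := cone_act (tt k n ^ n) ((An.gamma e he).toCoker (tt k n ^ n)) (i := -2 + 1 + 1)
      (((An.gamma e he).coker (tt k n ^ n)).d (-2 + 1) 0 +
        ((An.gamma e he).toCoker (tt k n ^ n)).f (-2 + 1 + 1) (An.gammaOne e he))
      (-(An.gamma e he).d (-2 + 1 + 1) (An.gammaOne e he))
    refine key.trans (cone_ext ?_ ?_)
    · refine (congrArg (((An.gamma e he).coker (tt k n ^ n)).act (tt k n ^ n) (-2 + 1 + 1))
        ((congrArg (· + ((An.gamma e he).toCoker (tt k n ^ n)).f (-2 + 1 + 1) (An.gammaOne e he))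
          (map_zero (((An.gamma e he).coker (tt k n ^ n)).d (-2 + 1)))).trans
          (zero_add _))).trans ?_
      refine (f_act _ _ _).symm.trans ?_
      exact (QuotientAddGroup.eq_zero_iff _).2 (act_mem_im _ _)
    · refine (map_neg _ _).trans (neg_eq_zero.2 ?_)
      refine (An.gamma_act e he _ _).trans (Prod.ext ?_ rfl)
      change tt k n ^ n • (An.alg.d 0 An.alg.one + An.mulT _ 0) = 0
      rw [An.alg.d_one, map_zero, add_zero, _root_.smul_zero]
  lift M x hx := by
    -- The map `(α, a) ↦ ± α x`. On `t^n (α, a)` the terms with `d α` cancel in `dh + hd`, and what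
    -- remains is a multiple of `t^n dx = 0`.
    let h (i : ℤ) : (An.gamma e he).X (i + 1) →+ M.X i :=
      sgn (i + 1) • ((M.smulHom (show i + 1 + (-2 + 1) = i by omega)).flip x).comp
        (AddMonoidHom.fst (An.alg.X (i + 1)) (An.trunc.X (i + 1 + 1)))
    obtain ⟨f, hf⟩ := exists_hom_cone (r := tt k n ^ n) (M := An.gamma e he) (N := M) h
      (fun {i j l} e₁ e' b y => by
        change sgn (l + 1) • M.smul _ (An.alg.mul e₁ b y.1) x =
          sgn i • M.smul _ b (sgn (j + 1) • M.smul _ y.1 x)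
        rw [M.mul_smul _ _ (show j + 1 + (-2 + 1) = j by omega) e', smul_zsmul, smul_smul, ← sgn_add,
          ← e₁])
      (fun i y => by
        obtain ⟨α, a⟩ := y
        have e₁ : h i ((An.gamma e he).act (tt k n ^ n) _
            ((α, a) : An.alg.X (i + 1) × An.trunc.X (i + 1 + 1))) =
            sgn (i + 1) • M.smul (by omega) (tt k n ^ n • α) x :=
          congrArg (h i) (An.gamma_act e he α a)
        have e₂ : h (i + 1) ((An.gamma e he).d _ ((An.gamma e he).act (tt k n ^ n) _
            ((α, a) : An.alg.X (i + 1) × An.trunc.X (i + 1 + 1)))) =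
            sgn (i + 1 + 1) • M.smul (by omega) (tt k n ^ n • An.alg.d _ α) x :=
          congrArg (fun z => sgn (i + 1 + 1) • M.smul _ z x) (An.gamma_d_act e he α a)
        refine (congrArg₂ (fun p q => M.d i p + q) e₁ e₂).trans ?_
        rw [smul_smul_eq_act, smul_smul_eq_act, map_zsmul, d_act,
          M.leibniz _ (show i + 1 + 1 + (-2 + 1) = i + 1 by omega)
          (show i + 1 + (-2 + 1 + 1) = i + 1 by omega), map_add, map_zsmul, ← smul_act, ← smul_act,
          hx, M.smul_zero, _root_.smul_zero, add_zero, sgn_succ (i + 1)]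
        module)
    have key := hf (-2 + 1)
    refine ⟨f, congrArg _ ((key (An.gammaOne e he)).trans ?_)⟩
    change sgn 0 • M.smul (zero_add (-2 + 1)) An.alg.one x = x
    rw [M.one_smul, sgn_zero, one_zsmul]
  null M f w hw := by
    -- The degree `-2` map `(α, a) ↦ α w`. The required identity on `t^n Γ_n` reduces to `t^n f(γ) =
    -- t^n dw`.
    refine homotopic_zero_of_cone f (fun i =>
      ((M.smulHom (show i + 1 + 1 + (-2) = i by omega)).flip w).comp
        (AddMonoidHom.fst (An.alg.X (i + 1 + 1)) (An.trunc.X (i + 1 + 1 + 1))))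
      (fun {i j l} e₁ e' b y => ?_) (fun i y => ?_)
    · change M.smul _ (An.alg.mul e₁ b y.1) w = M.smul _ b (M.smul _ y.1 w)
      rw [M.mul_smul _ _ (show j + 1 + 1 + (-2) = j by omega) e']
    · obtain ⟨α, a⟩ := y
      have e₀ : f.f (i + 1) ((0, (An.gamma e he).act (tt k n ^ n) _
            ((α, a) : An.alg.X (i + 1 + 1) × An.trunc.X (i + 1 + 1 + 1))) :
            ((An.gamma e he).coker (tt k n ^ n)).X (i + 1) × (An.gamma e he).X (i + 1 + 1)) =
          sgn (i + 1 + 1) • M.smul (show i + 1 + 1 + (-2 + 1) = i + 1 by omega) (tt k n ^ n • α)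
            (f.f _ (An.gammaGen e he)) := by
        rw [← f_smul, ← map_zsmul]
        refine congrArg (f.f (i + 1)) (cone_ext ?_ ?_)
        · refine Eq.symm ((congrArg (sgn (i + 1 + 1) • ·)
            (((An.gamma e he).coker (tt k n ^ n)).smul_zero
              (show i + 1 + 1 + (-2 + 1) = i + 1 by omega) (tt k n ^ n • α))).trans ?_)
          exact _root_.smul_zero _
        · refine (An.gamma_act e he α a).trans ?_
          change _ = sgn (i + 1 + 1) • (sgn (i + 1 + 1) • (An.gamma e he).smul
            (add_zero (i + 1 + 1)) (tt k n ^ n • α) (An.gammaOne e he))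
          rw [smul_smul, sgn_sq, one_zsmul]
          refine Prod.ext (An.alg.mul_one _).symm ?_
          exact ((congrArg (sgn (i + 1 + 1) • ·) (map_zero _)).trans (_root_.smul_zero _)).symm
      have e₁ : M.smul (show i + 1 + 1 + (-2) = i by omega) ((An.gamma e he).act (tt k n ^ n) _
            ((α, a) : An.alg.X (i + 1 + 1) × An.trunc.X (i + 1 + 1 + 1))).1 w =
            M.smul (by omega) (tt k n ^ n • α) w :=
        congrArg (fun z => M.smul _ (Prod.fst z) w) (An.gamma_act e he α a)
      have e₂ : M.smul (show i + 1 + 1 + 1 + (-2) = i + 1 by omega)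
            ((An.gamma e he).d _ ((An.gamma e he).act (tt k n ^ n) _
            ((α, a) : An.alg.X (i + 1 + 1) × An.trunc.X (i + 1 + 1 + 1)))).1 w =
            M.smul (by omega) (tt k n ^ n • An.alg.d _ α) w :=
        congrArg (fun z => M.smul _ z w) (An.gamma_d_act e he α a)
      refine (congrArg₂ (fun p q => p + q) (congrArg₂ (fun p q => p - M.d i q) e₀ e₁) e₂).trans ?_
      rw [smul_smul_eq_act, smul_smul_eq_act, smul_smul_eq_act, ← smul_act, hw, d_act,
        M.leibniz _ (show i + 1 + 1 + 1 + (-2) = i + 1 by omega)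
          (show i + 1 + 1 + (-2 + 1) = i + 1 by omega), map_add, map_zsmul, smul_act]
      abel

end CDGDeformation

end CDG

end

/-! ### The generators of `T_n` and `D(A)` -/

noncomputable section

namespace CDG

namespace Mod

variable {R : Type u} [CommRing R] {B : CDGAlgebra R}

lemma toCoker_mem_im {t : R} {n p : ℕ} (M : Mod B) (hp : p ≤ n) {i : ℤ} (m : M.X i) :
    (M.toCoker (t ^ n)).f i m ∈ (M.coker (t ^ n)).im (t ^ p) i ↔ m ∈ M.im (t ^ p) i := by
  refine ⟨?_, fun h => f_mem_im _ h⟩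
  rintro ⟨m', hm⟩
  obtain ⟨m', rfl⟩ := QuotientAddGroup.mk_surjective m'
  have h₁ : m - M.act (t ^ p) i m' ∈ M.im (t ^ n) i := by
    refine (QuotientAddGroup.eq_zero_iff (m - M.act (t ^ p) i m')).1 ?_
    refine (map_sub ((M.toCoker (t ^ n)).f i) _ _).trans (sub_eq_zero.2 ?_)
    exact hm.symm.trans (f_act (M.toCoker (t ^ n)) (t ^ p) m').symm
  simpa using add_mem (im_anti t hp i h₁) (act_mem_im (t ^ p) m')

/-- `M ⟶ M / t^n M` is an isomorphism on `Gr^p` for `p < n`, so the corresponding graded pieces of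
its cone are contractible. In particular the cone of `Γ_n ⟶ Γ_n / t^n Γ_n` lies in `T_n`. -/
lemma isNAcyclic_cone_toCoker (t : R) (n : ℕ) (M : Mod B) :
    IsNAcyclic t n (cone (M.toCoker (t ^ n))) := by
  rintro p hp i ⟨x, z⟩ hx hdx
  obtain ⟨x, rfl⟩ := QuotientAddGroup.mk_surjective x
  replace hx := (mem_cone_im _ _ _ _).1 hx
  have hx₁ := (toCoker_mem_im M hp.le x).1 hx.1
  have hdx₁ := ((mem_cone_im _ _ ((M.toCoker (t ^ n)).f _ (M.d _ x + z)) (-M.d _ z)).1 hdx).1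
  rw [toCoker_mem_im M hp] at hdx₁
  refine ⟨((0, x) : (M.coker (t ^ n)).X i × M.X (i + 1)), (mem_cone_im _ _ _ _).2
    ⟨zero_mem _, hx₁⟩, ?_⟩
  have e : (show (M.coker (t ^ n)).X (i + 1) × M.X (i + 1 + 1) from
      (((M.toCoker (t ^ n)).f _ x, z) : (M.coker (t ^ n)).X (i + 1) × M.X (i + 1 + 1)) -
        (((M.coker (t ^ n)).d i 0 + (M.toCoker (t ^ n)).f _ x, -M.d _ x) :
          (M.coker (t ^ n)).X (i + 1) × M.X (i + 1 + 1))) =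
      ((0, M.d _ x + z) : (M.coker (t ^ n)).X (i + 1) × M.X (i + 1 + 1)) := by
    refine Prod.ext ?_ ?_
    · simp
    · simp [add_comm]
  exact (congrArg (· ∈ (cone (M.toCoker (t ^ n))).im (t ^ (p + 1)) (i + 1)) e).mpr
    ((mem_cone_im _ _ _ _).2 ⟨zero_mem _, hdx₁⟩)

end Mod

namespace CDGDeformation

open CDG.Mod

variable {k : Type u} [CommRing k] {n : ℕ} {A : DGAlgebra k} (An : CDGDeformation A n)
  (e : An.alg.X 2) (he : tt k n • e = An.alg.curv)

/-- `Ker t^n ⊆ t A_n`. -/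
lemma exists_of_pow_smul_eq_zero {i : ℤ} (x : An.alg.X i) (hx : tt k n ^ n • x = 0) :
    ∃ y, tt k n • y = x := by
  have key : ∀ j ≤ n, ∀ x : An.alg.X i, tt k n ^ j • x = 0 → ∃ y, tt k n • y = x := by
    intro j
    induction j with
    | zero =>
      intro _ x hx
      rw [pow_zero, _root_.one_smul] at hx
      exact ⟨0, by rw [_root_.smul_zero, hx]⟩
    | succ j ih =>
      intro hj x hx
      replace hx : tt k n • (tt k n ^ j • x) = 0 := by rw [smul_smul, ← pow_succ', hx]
      -- `t^j x` is killed by `t`, hence equals `t^n y`. So `t^j` kills `x - t^{n-j} y`, to which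
      -- the induction hypothesis applies, and `n - j ≥ 1` makes the subtracted term divisible by
      -- `t`.
      obtain ⟨y, hy⟩ := An.exists_of_smul_eq_zero _ hx
      obtain ⟨z, hz⟩ := ih (by omega) (x - tt k n ^ (n - j) • y) (by
        rw [_root_.smul_sub, smul_smul, ← pow_add, Nat.add_sub_cancel' (by omega), hy, sub_self])
      refine ⟨z + tt k n ^ (n - j - 1) • y, ?_⟩
      rw [_root_.smul_add, hz, smul_smul, ← pow_succ', show n - j - 1 + 1 = n - j by omega,
        sub_add_cancel]
  exact key n le_rfl x hx

lemma gammaCone_act {j : ℤ} (x : ((An.gamma e he).coker (tt k n ^ n)).X j) (α : An.alg.X (j + 1))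
    (a : An.trunc.X (j + 1 + 1)) :
    (An.gammaCone e he).act (tt k n ^ n) j ((x, ((α, a) : An.alg.X (j + 1) × An.trunc.X (j + 1 + 1))) :
      ((An.gamma e he).coker (tt k n ^ n)).X j × (An.gamma e he).X (j + 1)) =
      ((0, ((tt k n ^ n • α, 0) : An.alg.X (j + 1) × An.trunc.X (j + 1 + 1))) :
      ((An.gamma e he).coker (tt k n ^ n)).X j × (An.gamma e he).X (j + 1)) := by
  refine (cone_act _ _ _ _).trans (cone_ext ?_ (An.gamma_act e he α a))
  obtain ⟨x, rfl⟩ := QuotientAddGroup.mk_surjective x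
  refine (f_act ((An.gamma e he).toCoker (tt k n ^ n)) _ x).symm.trans ?_
  exact (QuotientAddGroup.eq_zero_iff _).2 (act_mem_im _ _)

lemma gammaCone_smul_gen {j : ℤ} (h : j + 1 + (-2 + 1) = j) (α : An.alg.X (j + 1)) :
    (An.gammaCone e he).smul h α (An.gammaGen e he) =
      ((0, ((sgn (j + 1) • α, 0) : An.alg.X (j + 1) × An.trunc.X (j + 1 + 1))) :
      ((An.gamma e he).coker (tt k n ^ n)).X j × (An.gamma e he).X (j + 1)) := by
  refine cone_ext (((An.gamma e he).coker (tt k n ^ n)).smul_zero h α) ?_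
  refine congrArg (sgn (j + 1) • ·) (a₂ := ((α, 0) : An.alg.X (j + 1) × An.trunc.X (j + 1 + 1)))
    (Prod.ext (An.alg.mul_one α) ?_) |>.trans (Prod.ext rfl (_root_.smul_zero _))
  exact (congrArg (sgn (j + 1) • ·) (map_zero _)).trans (_root_.smul_zero _)

/-- The generator of `t^n G_n[1]`. -/
def imGen : (An.imF.obj (An.gammaCone e he)).X (-2 + 1) :=
  ⟨(An.gammaCone e he).act (tt k n ^ n) _ (An.gammaGen e he), act_mem_im _ _⟩

lemma imF_smul_val (M : Mod An.alg) {i j l : ℤ} (h : i + j = l) (b : An.alg.X i)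
    (m : M.im (tt k n ^ n) j) :
    ((An.imF.obj M).smul h (An.red.f i b) m : M.im (tt k n ^ n) l).1 = M.smul h b m.1 :=
  congrArg Subtype.val (descend_smul An.red (M.image (tt k n ^ n)) (An.descends_image M) h b m)

/-- `t^n` kills the quotient `Γ_n / t^n Γ_n` and the summand `A_{n-1}[1]`, leaving the elements `t^n
α`. Since `t^n α = 0` exactly when `α ∈ t A_n`, that is when `α` reduces to zero, this is a free
`A`-module of rank one on a closed generator. -/
lemma isRep_im : IsRep (1 : k) (An.imF.obj (An.gammaCone e he)) (An.imGen e he) := by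
  refine isRep_of_bijective _ ?_ (fun {i j} h => ?_)
  · exact Subtype.ext ((d_act _ _).trans (An.isRep_gammaCone e he).closed)
  · obtain rfl : i = j + 1 := by omega
    have key (α : An.alg.X (j + 1)) : ((An.imF.obj (An.gammaCone e he)).smul h
        (An.red.f _ α) (An.imGen e he) : (An.gammaCone e he).im (tt k n ^ n) j).1 =
        ((0, ((tt k n ^ n • sgn (j + 1) • α, 0) : An.alg.X (j + 1) × An.trunc.X (j + 1 + 1))) :
      ((An.gamma e he).coker (tt k n ^ n)).X j × (An.gamma e he).X (j + 1)) := by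
      refine (An.imF_smul_val _ h α (An.imGen e he)).trans ((smul_act _ h α _).trans ?_)
      rw [An.gammaCone_smul_gen e he h α]
      exact An.gammaCone_act e he _ _ _
    constructor
    · refine (injective_iff_map_eq_zero
        (((An.imF.obj (An.gammaCone e he)).smulHom h).flip (An.imGen e he))).2 (fun a ha => ?_)
      obtain ⟨α, rfl⟩ := An.red_surjective _ a
      have h₁ := (key α).symm.trans (congrArg Subtype.val ha)
      have h₂ : tt k n ^ n • sgn (j + 1) • α = 0 := congrArg (fun x => (Prod.snd x).1) h₁
      obtain ⟨y, hy⟩ := An.exists_of_pow_smul_eq_zero _ h₂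
      have h₃ : α = tt k n • sgn (j + 1) • y := by
        rw [smul_comm, hy, smul_smul, sgn_sq, one_zsmul]
      rw [h₃, An.red_smul]
    · rintro ⟨_, ⟨x, ⟨α, a⟩⟩, rfl⟩
      refine ⟨An.red.f _ (sgn (j + 1) • α), Subtype.ext ((key _).trans ?_)⟩
      rw [smul_smul, sgn_sq, one_zsmul]
      exact (An.gammaCone_act e he _ _ _).symm

end CDGDeformation

/-! ### Morphisms out of representing modules in the derived category -/

section Rep

open Generation

variable {R : Type u} [CommRing R] {B : CDGAlgebra R} {t r : R} {N : ℕ} {G : Mod B} {e : ℤ}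
  {γ : G.X (e + 1)}

/-- The converse of `IsRep.null`: a null homotopy evaluated at `γ` gives the primitive, as `r dγ =
0`. -/
lemma Mod.IsRep.exists_of_homotopic (hG : Mod.IsRep r G γ) {M : Mod B} {f : G ⟶ M}
    (hf : Mod.homotopic B f 0) : ∃ w, M.act r _ (f.f _ γ) = M.act r _ (M.d e w) := by
  obtain ⟨H⟩ := hf
  refine ⟨H.h e γ, ?_⟩
  have h₁ := H.comm e γ
  have h₂ : M.act r _ (H.h (e + 1) (G.d (e + 1) γ)) = 0 := by
    rw [← H.h_act, hG.closed, map_zero]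
  rw [Mod.zero_f, sub_zero] at h₁
  rw [h₁, map_add, h₂, add_zero]

/-- `rM` is acyclic in degree `e + 1`. -/
def Mod.ImAcyclic (r : R) (e : ℤ) (M : Mod B) : Prop :=
  ∀ x : M.X (e + 1), M.act r _ (M.d _ x) = 0 → ∃ w, M.act r _ x = M.act r _ (M.d e w)

variable (hG : Mod.IsRep r G γ) (hac : ∀ M : Mod B, Mod.IsNAcyclic t N M → M.ImAcyclic r e)

include hG hac

/-- Homotopy classes of maps `G ⟶ M` are cohomology classes of `rM`, which vanish for acyclic `M` by
`hac`. Hence morphisms out of `G` do not change when passing to the Verdier quotient, which the next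
lemmas exploit. -/
lemma Mod.IsRep.leftOrthogonal : (acyclics B t N).leftOrthogonal ((Hot.Q B).obj G) := by
  rintro ⟨M⟩ f hM
  obtain ⟨f, rfl⟩ := (Hot.Q B).map_surjective (X := G) (Y := M) f
  obtain ⟨w, hw⟩ := hac M hM (f.f _ γ) (by
    rw [← Mod.f_d, ← Mod.f_act, hG.closed, map_zero])
  exact ((Hot.map_eq_iff _ _).2 (hG.null M f w hw)).trans ((Hot.Q B).map_zero _ _)

lemma Mod.IsRep.map_surjective (M : Mod B) :
    Function.Surjective ((toDer B t N).map : (G ⟶ M) → _) := by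
  intro g
  obtain ⟨f, rfl⟩ := (ObjectProperty.leftOrthogonal.map_bijective_of_isTriangulated
    (hG.leftOrthogonal hac) (acyclics B t N).trW.Q ((Hot.Q B).obj M)).2 g
  obtain ⟨f, rfl⟩ := (Hot.Q B).map_surjective (X := G) (Y := M) f
  exact ⟨f, rfl⟩

lemma Mod.IsRep.map_eq_zero_iff {M : Mod B} (f : G ⟶ M) :
    (toDer B t N).map f = 0 ↔ ∃ w, M.act r _ (f.f _ γ) = M.act r _ (M.d e w) := by
  constructor
  · intro h
    refine hG.exists_of_homotopic ((Hot.map_eq_iff _ _).1 ?_)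
    refine (ObjectProperty.leftOrthogonal.map_bijective_of_isTriangulated
      (hG.leftOrthogonal hac) (acyclics B t N).trW.Q ((Hot.Q B).obj M)).1 ?_
    exact h.trans (((toDer B t N).map_zero G M)).symm
  · rintro ⟨w, hw⟩
    have h₁ := (Hot.map_eq_iff _ _).2 (hG.null M f w hw)
    exact (congrArg (acyclics B t N).trW.Q.map h₁).trans ((toDer B t N).map_zero G M)

/-- Morphisms in a localization need not form a small set in general. Those out of `G` are a
quotient of morphisms of modules. -/
lemma Mod.IsRep.small (X : Der B t N) : Small.{u} ((toDer B t N).obj G ⟶ X) := by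
  let M := (toDer B t N).objPreimage X
  have : Small.{u} (G ⟶ M) := small_self _
  refine small_of_surjective (α := (G ⟶ M))
    (f := fun f => (toDer B t N).map f ≫ ((toDer B t N).objObjPreimageIso X).hom) ?_
  intro g
  obtain ⟨f, hf⟩ := hG.map_surjective hac M (g ≫ ((toDer B t N).objObjPreimageIso X).inv)
  exact ⟨f, by simp [hf]⟩

lemma Mod.IsRep.isSmall : IsSmall ((toDer B t N).obj G) := by
  classical
  intro N' S ι hS X s hs g
  let M (j : ULift.{u} ℕ) : Mod B := (toDer B t N).objPreimage (N' j.down)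
  let ε (j : ULift.{u} ℕ) : (toDer B t N).obj (M j) ≅ N' j.down :=
    (toDer B t N).objObjPreimageIso (N' j.down)
  have hM := isColimitCofanMkObjOfIsColimit (toDer B t N) _ _ (Mod.isColimitDsum M)
  let θ : (toDer B t N).obj (Mod.dsum M) ⟶ S :=
    Cofan.IsColimit.desc hM (fun j => (ε j).hom ≫ ι j.down)
  have hθ (j : ULift.{u} ℕ) : (toDer B t N).map (Mod.dinj M j) ≫ θ = (ε j).hom ≫ ι j.down :=
    Cofan.IsColimit.fac hM _ j
  let θ' : S ⟶ (toDer B t N).obj (Mod.dsum M) :=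
    Cofan.IsColimit.desc hS (fun m => (ε ⟨m⟩).inv ≫ (toDer B t N).map (Mod.dinj M ⟨m⟩))
  have hθ' (m : ℕ) : ι m ≫ θ' = (ε ⟨m⟩).inv ≫ (toDer B t N).map (Mod.dinj M ⟨m⟩) :=
    Cofan.IsColimit.fac hS _ m
  have hθθ : θ' ≫ θ = 𝟙 S := Cofan.IsColimit.hom_ext hS _ _ (fun m => by
    change ι m ≫ θ' ≫ θ = ι m ≫ 𝟙 S
    rw [reassoc_of% (hθ' m), hθ, Iso.inv_hom_id_assoc, Category.comp_id])
  obtain ⟨f, hf⟩ := hG.map_surjective hac (Mod.dsum M) (g ≫ θ')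
  -- Smallness comes from finite support: up to homotopy `f` is determined by `r f(γ)`, and `f(γ)`
  -- lies in a direct sum. So `f` agrees with a finite sum of maps factoring through the summands.
  let x : Π₀ j, (M j).X (e + 1) := f.f _ γ
  have hx (j : ULift.{u} ℕ) : (M j).act r _ ((M j).d _ (x j)) = 0 := by
    have : (M j).act r _ ((M j).d _ ((Mod.dproj M j).f _ (f.f _ γ))) = 0 := by
      rw [← Mod.f_d, ← Mod.f_d, ← Mod.f_act, ← Mod.f_act, hG.closed, map_zero, map_zero]
    exact this
  choose φ hφ using fun j => hG.lift (M j) (x j) (hx j)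
  have key : ∀ F : Finset (ULift.{u} ℕ), ∃ ψ : G ⟶ Mod.dsum M, (toDer B t N).map ψ ≫ θ ≫ s = 0 ∧
      (Mod.dsum M).act r _ (ψ.f _ γ) =
        (Mod.dsum M).act r _ (∑ j ∈ F, (Mod.dinj M j).f (e + 1) (x j)) := by
    intro F
    induction F using Finset.induction_on with
    | empty => exact ⟨0, by rw [Functor.map_zero, zero_comp], by simp⟩
    | insert j F hj ih =>
      obtain ⟨ψ, h₁, h₂⟩ := ih
      refine ⟨φ j ≫ Mod.dinj M j + ψ, ?_, ?_⟩
      · rw [Functor.map_add, Preadditive.add_comp, h₁, add_zero, Functor.map_comp, Category.assoc,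
          reassoc_of% (hθ j)]
        have := hs j.down ((toDer B t N).map (φ j) ≫ (ε j).hom)
        rwa [Category.assoc] at this
      · rw [Finset.sum_insert hj, map_add, Mod.add_f, map_add, h₂, Mod.comp_f, ← Mod.f_act, hφ,
          Mod.f_act]
  obtain ⟨ψ, h₁, h₂⟩ := key x.support
  have h₃ : ∑ j ∈ x.support, (Mod.dinj M j).f (e + 1) (x j) = f.f _ γ :=
    DFinsupp.sum_single (f := x)
  have h₄ : (toDer B t N).map (f - ψ) = 0 := (hG.map_eq_zero_iff hac _).2 ⟨0, by
    rw [Mod.sub_f, map_sub, h₂, h₃, sub_self, map_zero, map_zero]⟩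
  rw [Functor.map_sub, sub_eq_zero] at h₄
  rw [← Category.comp_id g, ← hθθ, Category.assoc, Category.assoc, ← Category.assoc, ← hf, h₄]
  exact h₁

/-- A ghost identity means that all maps from `G` to the shifts of `M` vanish. Every cycle of `r
M⟦i⟧` in the degree of `γ` is the image of `rγ` under such a map. -/
lemma Mod.IsRep.imAcyclic_of_isGhost {M : Mod B}
    (h : IsGhost ((toDer B t N).obj G) (𝟙 ((toDer B t N).obj M))) (i : ℤ) :
    (M⟦i⟧).ImAcyclic r e := by
  intro x hx
  obtain ⟨f, hf⟩ := hG.lift (M⟦i⟧) x hx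
  rw [← hf, ← hG.map_eq_zero_iff hac]
  have := h i ((toDer B t N).map f ≫ ((toDer B t N).commShiftIso i).hom.app M)
  rw [CategoryTheory.Functor.map_id, Category.comp_id] at this
  rwa [← cancel_mono (((toDer B t N).commShiftIso i).hom.app M), zero_comp]

end Rep

end CDG

end

/-! ### Generation of `T_n` and `D(A)`, and the main theorem -/

noncomputable section

namespace CDG

section

open Generation

variable {R : Type u} [CommRing R] {B : CDGAlgebra R} {r : R}

lemma Mod.shift_act (M : Mod B) (a : ℤ) {i : ℤ} (m : M.X (i + a)) :
    (M⟦a⟧).act r i m = M.act r (i + a) m := by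
  have e : sgn (a * 0) • M.act r (i + a) m = M.act r (i + a) m := by simp
  exact e

/-- The generator only tests cohomology in one degree. Testing all shifts of `M` reaches every
degree. -/
lemma Mod.imAcyclic_of_shift {M : Mod B} {e : ℤ} (h : ∀ i : ℤ, (M⟦i⟧).ImAcyclic r e) (l : ℤ) :
    M.ImAcyclic r l := by
  obtain ⟨i, rfl⟩ : ∃ i, l = e + i := ⟨l - e, by omega⟩
  intro x hx
  have hd (m : M.X (e + 1 + i)) : (M⟦i⟧).act r _ ((M⟦i⟧).d (e + 1) m) =
      sgn i • M.tr (show e + 1 + i + 1 = e + 1 + 1 + i by omega) (M.act r _ (M.d _ m)) :=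
    (Mod.shift_act M i _).trans (by
      refine (map_zsmul (M.act r (e + 1 + 1 + i)) _ _).trans ?_
      exact congrArg (sgn i • ·) (Mod.act_tr r _ _))
  obtain ⟨w, hw⟩ := h i (M.tr (show e + i + 1 = e + 1 + i by omega) x) ((hd _).trans (by
    rw [Mod.d_tr, Mod.act_tr, hx, map_zero, map_zero, _root_.smul_zero]
    rfl))
  have hw' := (Mod.shift_act M i _).symm.trans (hw.trans (Mod.shift_act M i _))
  replace hw' : M.act r (e + 1 + i) (M.tr (by omega) x) =
    M.act r (e + 1 + i) (sgn i • M.tr (by omega) (M.d (e + i) w)) := hw'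
  refine ⟨sgn i • (show M.X (e + i) from w), ?_⟩
  have := congrArg (M.tr (show e + 1 + i = e + i + 1 by omega)) hw'
  rw [Mod.act_tr, Mod.tr_tr, Mod.tr_rfl, map_zsmul, Mod.act_tr, map_zsmul, Mod.tr_tr,
    Mod.tr_rfl] at this
  rw [map_zsmul, map_zsmul]
  exact this

lemma isGhost_id_of_iso {C : Type*} [Category* C] [Preadditive C] [HasZeroObject C] [HasShift C ℤ]
    [∀ a : ℤ, (shiftFunctor C a).Additive] [Pretriangulated C] {G X Y : C} (e : X ≅ Y)
    (h : IsGhost G (𝟙 X)) : IsGhost G (𝟙 Y) := fun i g => by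
  have := h i (g ≫ e.inv⟦i⟧')
  rw [CategoryTheory.Functor.map_id, Category.comp_id] at this ⊢
  rwa [← cancel_mono (e.inv⟦i⟧'), zero_comp]

lemma isLocalizing_top {C : Type*} [Category* C] [Preadditive C] [HasZeroObject C] [HasShift C ℤ]
    [∀ a : ℤ, (shiftFunctor C a).Additive] [Pretriangulated C] :
    IsLocalizing.{u} (⊤ : ObjectProperty C) where
  iso := inferInstance
  triangulated :=
    have : (⊤ : ObjectProperty C).ContainsZero := ⟨⟨_, isZero_zero C, trivial⟩⟩
    have : (⊤ : ObjectProperty C).IsStableUnderShift ℤ := ⟨fun _ => ⟨fun _ _ => trivial⟩⟩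
    have : (⊤ : ObjectProperty C).IsTriangulatedClosed₂ := .mk' (fun _ _ _ _ => trivial)
    { }
  coproduct _ := ⟨fun _ _ => trivial⟩

end

namespace CDGDeformation

open CDG.Mod CDG.Generation

variable {k : Type u} [CommRing k] {n : ℕ} {A : DGAlgebra k} (An : CDGDeformation A n)
  (e : An.alg.X 2) (he : tt k n • e = An.alg.curv)

lemma imAcyclic_iff (M : Mod An.alg) :
    (∀ l, M.ImAcyclic (tt k n ^ n) l) ↔ IsAcyclic (An.imF.obj M) := by
  constructor
  · rintro h i ⟨_, x, rfl⟩ hx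
    obtain ⟨w, hw⟩ := h i x ((d_act _ _).symm.trans (congrArg Subtype.val hx))
    exact ⟨⟨M.act (tt k n ^ n) i w, act_mem_im _ _⟩, Subtype.ext ((d_act _ _).trans hw.symm)⟩
  · intro h i x hx
    obtain ⟨⟨_, w, rfl⟩, hw⟩ := h i ⟨M.act (tt k n ^ n) _ x, act_mem_im _ _⟩
      (Subtype.ext ((d_act _ _).trans hx))
    exact ⟨w, (congrArg Subtype.val hw).symm.trans (d_act _ _)⟩

lemma imAcyclic_of_isNAcyclic (M : Mod An.alg) (h : IsNAcyclic (tt k n) (n + 1) M) (l : ℤ) :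
    M.ImAcyclic (tt k n ^ n) l :=
  (An.imAcyclic_iff M).2 ((An.isNAcyclic_succ_iff M).1 h).2 l

lemma imAcyclic_one_iff (M : Mod A.toCDGAlgebra) :
    (∀ l, M.ImAcyclic 1 l) ↔ IsNAcyclic (0 : k) 1 M := by
  rw [isNAcyclic_zero_one_iff]
  constructor
  · intro h i x hx
    obtain ⟨w, hw⟩ := h i x (by rw [hx, map_zero])
    rw [act_one, act_one] at hw
    exact ⟨w, hw.symm⟩
  · intro h i x hx
    rw [act_one] at hx
    obtain ⟨w, hw⟩ := h i x hx
    exact ⟨w, by rw [hw]⟩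

/-- If `G_n[1]` does not see `X`, then `t^n X` is acyclic, and in `T_n` this forces `X = 0`. -/
lemma isZero_of_isGhost {X : An.Dn} (hX : An.T X)
    (h : IsGhost ((toDer An.alg (tt k n) (n + 1)).obj (An.gammaCone e he)) (𝟙 X)) : IsZero X := by
  let u := (toDer An.alg (tt k n) (n + 1)).objObjPreimageIso X
  refine An.isZero_of_T hX (IsZero.of_iso ?_ (An.imT.mapIso u.symm ≪≫ An.toDerImT.app _))
  refine (isZero_toDer_iff _).2 ((isNAcyclic_zero_one_iff _).2 ((An.imAcyclic_iff _).1 ?_))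
  exact imAcyclic_of_shift ((An.isRep_gammaCone e he).imAcyclic_of_isGhost
    (fun M hM => An.imAcyclic_of_isNAcyclic M hM _) (isGhost_id_of_iso u.symm h))

lemma isZero_of_isGhost_im {X : DA A} (h : IsGhost ((toDer A.toCDGAlgebra (0 : k) 1).obj
    (An.imF.obj (An.gammaCone e he))) (𝟙 X)) : IsZero X := by
  let u := (toDer A.toCDGAlgebra (0 : k) 1).objObjPreimageIso X
  refine IsZero.of_iso ?_ u.symm
  exact (isZero_toDer_iff _).2 ((imAcyclic_one_iff _).1 (imAcyclic_of_shift
    ((An.isRep_im e he).imAcyclic_of_isGhost (fun M hM => (imAcyclic_one_iff M).2 hM _)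
      (isGhost_id_of_iso u.symm h))))

lemma T_gammaCone : An.T ((toDer An.alg (tt k n) (n + 1)).obj (An.gammaCone e he)) :=
  ⟨_, (isNAcyclic_cokF_iff _).2 (isNAcyclic_cone_toCoker _ _ _), ⟨Iso.refl _⟩⟩

/-- `T_n` is generated by `G_n[1]`. -/
lemma T_le (P : ObjectProperty An.Dn) (hP : IsLocalizing.{u} P)
    (h : P ((toDer An.alg (tt k n) (n + 1)).obj (An.gammaCone e he))) : An.T ≤ P := by
  have hac (M : Mod An.alg) (hM : IsNAcyclic (tt k n) (n + 1) M) :=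
    An.imAcyclic_of_isNAcyclic M hM (-2)
  have (X : An.Dn) := (An.isRep_gammaCone e he).small hac X
  exact le_of_isLocalizing ((An.isRep_gammaCone e he).isSmall hac) hP An.isLocalizing_T h
    (An.T_gammaCone e he) (fun M => An.isZero_of_isGhost e he)

/-- `D(A)` is generated by `t^n G_n[1]`. -/
lemma top_le (P : ObjectProperty (DA A)) (hP : IsLocalizing.{u} P)
    (h : P ((toDer A.toCDGAlgebra (0 : k) 1).obj (An.imF.obj (An.gammaCone e he)))) : ⊤ ≤ P := by
  have hac (M : Mod A.toCDGAlgebra) (hM : IsNAcyclic (0 : k) 1 M) := (imAcyclic_one_iff M).2 hM (-2)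
  have (X : DA A) := (An.isRep_im e he).small hac X
  exact le_of_isLocalizing ((An.isRep_im e he).isSmall hac) hP isLocalizing_top h
    trivial (fun M _ => An.isZero_of_isGhost_im e he)

lemma imT_map_toDer {M N : Mod An.alg} (f : M ⟶ N) :
    An.imT.map ((toDer An.alg (tt k n) (n + 1)).map f) = An.toDerImT.hom.app M ≫
      (toDer A.toCDGAlgebra (0 : k) 1).map (An.imF.map f) ≫ An.toDerImT.inv.app N := by
  rw [← Category.assoc]
  exact ((An.toDerImT.app N).eq_comp_inv).2 (An.toDerImT.hom.naturality f)

/-- Both sides are `H^{-1}(t^n M)`: the source because `G_n[1]` represents it, the target because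
`t^n G_n[1]` is free on a closed generator of degree `-1`. -/
lemma bijective_imT (M : Mod An.alg) : Function.Bijective (An.imT.map :
    ((toDer An.alg (tt k n) (n + 1)).obj (An.gammaCone e he) ⟶
      (toDer An.alg (tt k n) (n + 1)).obj M) → _) := by
  have hac (M : Mod An.alg) (hM : IsNAcyclic (tt k n) (n + 1) M) :=
    An.imAcyclic_of_isNAcyclic M hM (-2)
  have hac' (M : Mod A.toCDGAlgebra) (hM : IsNAcyclic (0 : k) 1 M) := (imAcyclic_one_iff M).2 hM (-2)
  constructor
  · refine (injective_iff_map_eq_zero An.imT.mapAddHom).2 (fun g hg => ?_)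
    obtain ⟨f, rfl⟩ := (An.isRep_gammaCone e he).map_surjective hac M g
    replace hg : An.imT.map ((toDer An.alg (tt k n) (n + 1)).map f) = 0 := hg
    rw [imT_map_toDer, Preadditive.IsIso.comp_left_eq_zero, Preadditive.IsIso.comp_right_eq_zero,
      (An.isRep_im e he).map_eq_zero_iff hac'] at hg
    obtain ⟨⟨_, w, rfl⟩, hw⟩ := hg
    rw [act_one, act_one] at hw
    exact ((An.isRep_gammaCone e he).map_eq_zero_iff hac f).2 ⟨w, (f_act f _ _).symm.trans
      ((congrArg Subtype.val hw).trans (d_act _ _))⟩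
  · intro φ
    obtain ⟨ψ, hψ⟩ := (An.isRep_im e he).map_surjective hac' (An.imF.obj M)
      (An.toDerImT.inv.app _ ≫ φ ≫ An.toDerImT.hom.app M)
    -- The image of the generator has the form `t^n x` and is closed. Such an `x` is exactly the
    -- datum of a morphism from `G_n[1]` to `M`.
    obtain ⟨x, hx⟩ := (ψ.f _ (An.imGen e he)).2
    obtain ⟨f, hf⟩ := (An.isRep_gammaCone e he).lift M x (by
      have h₁ : (An.imF.obj M).d _ (ψ.f _ (An.imGen e he)) = 0 := by
        have := (An.isRep_im e he).closed
        rw [act_one] at this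
        rw [← f_d, this, map_zero]
      exact (d_act _ _).symm.trans ((congrArg (M.d _) hx).trans (congrArg Subtype.val h₁)))
    refine ⟨(toDer An.alg (tt k n) (n + 1)).map f, ?_⟩
    have h₂ : (toDer A.toCDGAlgebra (0 : k) 1).map (An.imF.map f - ψ) = 0 := by
      refine ((An.isRep_im e he).map_eq_zero_iff hac' _).2 ⟨0, ?_⟩
      rw [act_one, map_zero, map_zero, sub_f, sub_eq_zero]
      exact Subtype.ext ((f_act f _ _).trans (hf.trans hx))
    rw [Functor.map_sub, sub_eq_zero] at h₂
    rw [imT_map_toDer, h₂, hψ]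
    simp

lemma bijOut_gammaCone : Coproducts.bijOut An.imT
    ((toDer An.alg (tt k n) (n + 1)).obj (An.gammaCone e he)) := fun Y => by
  let u := (toDer An.alg (tt k n) (n + 1)).objObjPreimageIso Y
  have h := An.bijective_imT e he ((toDer An.alg (tt k n) (n + 1)).objPreimage Y)
  constructor
  · intro f g hfg
    rw [← cancel_mono u.inv]
    apply h.1
    rw [Functor.map_comp, Functor.map_comp, hfg]
  · intro φ
    obtain ⟨f, hf⟩ := h.2 (φ ≫ An.imT.map u.inv)
    exact ⟨f ≫ u.hom, by rw [Functor.map_comp, hf, Category.assoc, ← Functor.map_comp,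
      Iso.inv_hom_id, CategoryTheory.Functor.map_id, Category.comp_id]⟩

/-- The sources on which `Im t^n` is bijective form a localizing subcategory containing `G_n[1]`,
hence all of `T_n`. -/
lemma bijective_of_T (X Y : An.Dn) (h : An.T X) :
    Function.Bijective (An.imT.map : (X ⟶ Y) → _) := by
  obtain ⟨e, he⟩ := An.exists_curv_div
  exact An.T_le e he _ (Coproducts.isLocalizing_bijOut An.imT) (An.bijOut_gammaCone e he) X h Y

/-- Fullness on `T_n` makes its image localizing in `D(A)`. The image contains the generator `t^n
G_n[1]`, so it is everything. -/
lemma exists_T (Z : DA A) : ∃ X, An.T X ∧ Nonempty (An.imT.obj X ≅ Z) := by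
  obtain ⟨e, he⟩ := An.exists_curv_div
  exact An.top_le e he _ (Coproducts.isLocalizing_image An.imT An.T An.isLocalizing_T
    (fun X Y h => (An.bijective_of_T X Y h).2))
    ⟨_, An.T_gammaCone e he, ⟨An.toDerImT.app _⟩⟩ Z trivial

lemma T_G : An.T ((toDer An.alg (tt k n) (n + 1)).obj (An.G e he)) := by
  have := An.isLocalizing_T.iso
  have := An.isLocalizing_T.triangulated
  exact An.T.prop_of_iso (((toDer An.alg (tt k n) (n + 1)).commShiftIso (-1 : ℤ)).app
    (An.gammaCone e he)).symm (An.T.le_shift (-1) _ (An.T_gammaCone e he))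

/-- `T_n` is generated by `G_n`. -/
lemma T_le_of_G (P : ObjectProperty An.Dn) (hP : IsLocalizing.{u} P)
    (h : P ((toDer An.alg (tt k n) (n + 1)).obj (An.G e he))) : An.T ≤ P := by
  have := hP.iso
  have := hP.triangulated
  refine An.T_le e he P hP (P.prop_of_iso ?_ (P.le_shift (1 : ℤ) _ h))
  exact (((toDer An.alg (tt k n) (n + 1)).commShiftIso (1 : ℤ)).app (An.G e he)).symm ≪≫
    (toDer An.alg (tt k n) (n + 1)).mapIso ((shiftFunctorCompIsoId (Mod An.alg) (-1 : ℤ) 1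
      (by omega)).app (An.gammaCone e he))

end CDGDeformation

end CDG

end

theorem mainTheorem8 {k : Type u} [CommRing k] (A : CDG.DGAlgebra k) (n : ℕ)
    (An : CDG.CDGDeformation A n) :
    -- `T_n` is the minimal localizing subcategory of `D^n(A_n)` containing `G_n`
    CDG.IsLocalizing.{u} An.T ∧
    (∀ (e : An.alg.X 2) (he : CDG.tt k n • e = An.alg.curv),
      An.T ((CDG.toDer An.alg (CDG.tt k n) (n + 1)).obj (An.G e he)) ∧
      ∀ P : ObjectProperty An.Dn, CDG.IsLocalizing.{u} P →
        P ((CDG.toDer An.alg (CDG.tt k n) (n + 1)).obj (An.G e he)) → An.T ≤ P) ∧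
    -- `Im t^n` restricts to an equivalence `T_n ≃ D(A)`
    (An.T.ι ⋙ An.imT).IsEquivalence ∧
    -- `Im t^n` exhibits `D(A)` as the Verdier quotient of `D^n(A_n)` by the essential image of `ι_n`
    An.iota.essImage.IsTriangulated ∧
    An.imT.IsLocalization An.iota.essImage.trW ∧
    -- there is a recollement, in which the adjoints of `ι_n` are `Coker t^n` and `Ker t^n`
    ∃ ρ : CDG.Recollement An.iota An.imT,
      Nonempty (CDG.toDer An.alg (CDG.tt k n) (n + 1) ⋙ ρ.iL ≅
        CDG.Mod.cokF An.alg (CDG.tt k n ^ n) ⋙ CDG.toDer An.trunc (CDG.tt k n) n) ∧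
      Nonempty (CDG.toDer An.alg (CDG.tt k n) (n + 1) ⋙ ρ.iR ≅
        CDG.Mod.kerF An.alg (CDG.tt k n ^ n) ⋙ CDG.toDer An.trunc (CDG.tt k n) n) := by
  have := An.iota_full_faithful.1
  have := An.iota_full_faithful.2
  have hE (Z : CDG.DA A) : ∃ X, IsZero (An.iotaL.obj X) ∧ Nonempty (An.imT.obj X ≅ Z) := by
    simpa only [An.T_iff] using An.exists_T Z
  have hF (X Y : An.Dn) (h : IsZero (An.iotaL.obj X)) :
      Function.Bijective (An.imT.map : (X ⟶ Y) → _) := An.bijective_of_T X Y ((An.T_iff X).2 h)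
  exact ⟨An.isLocalizing_T, fun e he => ⟨An.T_G e he, An.T_le_of_G e he⟩,
    CDG.RecollementCriterion.isEquivalence hE hF An.T An.T_iff, inferInstance,
    CDG.RecollementCriterion.isLocalization hE hF An.iotaLAdj An.isZero_imT_iota,
    CDG.RecollementCriterion.recollement hE hF An.iotaLAdj An.isZero_imT_iota An.iotaRAdj,
    ⟨An.toDerIotaL⟩, ⟨An.toDerIotaR⟩⟩
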